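/- For $j=1,2$ let $1\le r_j\le m_j$, let $G_j$ be a complex Lie subgroup of ${\rm GL}(m_j,\mathbb C)$, and let $F_j$ be a nonempty complex submanifold of the Grassmannian ${\rm Gr}_{r_j}(m_j,\mathbb C)$ on which the canonical action of $G_j$ induces a transitive holomorphic action. ($F_j$ may be only injectively immersed; if it is embedded, the induced action is automatically holomorphic.) Let $M$ be a smooth connected manifold (Hausdorff, second countable) with $\dim M=m_1$, let $(P_j,M,G_j)$ be smooth principal bundles, where $P_1$ is a subbundle of the complex frame bundle of $T^{\mathbb C}M$, and let $\nabla_2$ be a connection on $P_2$. Let $Q_j=P_j\times_{G_j}F_j$ be the associated bundles, with projections $\pi_j:Q_j\to M$. A point of $Q_1$ over $x$ is a complex subspace of $T^{\mathbb C}_xM$ of dimension $r_1$, and a point of $Q_2$ over $x$ is a complex subspace, of dimension $r_2$, of the fibre over $x$ of the vector bundle $P_2\times_{G_2}\mathbb C^{m_2}$. Let $p$ be a smooth section of $Q_1$, and denote by the same letter the corresponding complex vector subbundle $p\subseteq T^{\mathbb C}M$. Let $\mathscr G^p_0\subseteq T^{\mathbb C}Q_2$ be the complex subbundle which is horizontal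 with respect to the connection induced by $\nabla_2$ on $Q_2$ and satisfies $d\pi_2(\mathscr G^p_0)=p$, let $(\ker d\pi_2)^{0,1}$ be the bundle of vertical vectors of type $(0,1)$ (for the complex structure of the fibres, induced from $F_2$), and let $$\mathscr G^p=\mathscr G^p_0\oplus(\ker d\pi_2)^{0,1}.$$ Call a complex distribution $\mathscr F$ on a manifold integrable if $[X,Y]\in\Gamma(\mathscr F)$ for all smooth sections $X,Y\in\Gamma(\mathscr F)$. Let $R_2$ be the curvature form of $\nabla_2$, extended complex bilinearly and acting on the fibres of $P_2\times_{G_2}\mathbb C^{m_2}$. Then the following assertions are equivalent: (i) $\mathscr G^p$ is integrable. (ii) $p$ is integrable, and $R_2(\Lambda^2_xp)(q)\subseteq q$ for all $x\in M$ and all $q\in\pi_2^{-1}(x)$. -/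

import Mathlib

open scoped Manifold ContDiff TensorProduct
open Set

noncomputable section

namespace Twistor

/-! ## Complexified tangent spaces and complex distributions -/

section Complexification

/-- The element `v + i w` of the complexification `ℂ ⊗[ℝ] V` of a real vector space `V`. -/
def toC {V : Type*} [AddCommGroup V] [Module ℝ V] (v w : V) : ℂ ⊗[ℝ] V :=
  (1 : ℂ) ⊗ₜ[ℝ] v + Complex.I ⊗ₜ[ℝ] w

/-- The real part `ℂ ⊗[ℝ] V → V`, `v + i w ↦ v`. -/
def rePart {V : Type*} [AddCommGroup V] [Module ℝ V] : ℂ ⊗[ℝ] V →ₗ[ℝ] V :=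
  (TensorProduct.lid ℝ V).toLinearMap ∘ₗ LinearMap.rTensor V Complex.reLm

/-- The imaginary part `ℂ ⊗[ℝ] V → V`, `v + i w ↦ w`. -/
def imPart {V : Type*} [AddCommGroup V] [Module ℝ V] : ℂ ⊗[ℝ] V →ₗ[ℝ] V :=
  (TensorProduct.lid ℝ V).toLinearMap ∘ₗ LinearMap.rTensor V Complex.imLm

variable {E H : Type*} [NormedAddCommGroup E] [NormedSpace ℝ E] [TopologicalSpace H]
  (I : ModelWithCorners ℝ E H) {N : Type*} [TopologicalSpace N] [ChartedSpace H N]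

/-- The complexified tangent space `T^ℂ_q N`. -/
abbrev CTangent (q : N) : Type _ := ℂ ⊗[ℝ] TangentSpace I q

/-- The section `X` of `T^ℂ N` is smooth: so are its real and imaginary parts. -/
def IsSmoothSection [IsManifold I ∞ N] (X : ∀ q : N, CTangent I q) : Prop :=
  ContMDiff I I.tangent ∞ (fun q => (⟨q, rePart (X q)⟩ : TangentBundle I N)) ∧
  ContMDiff I I.tangent ∞ (fun q => (⟨q, imPart (X q)⟩ : TangentBundle I N))

/-- The Lie bracket of vector fields, extended `ℂ`-bilinearly to sections of `T^ℂ N`: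
`[V + iW, V' + iW'] = ([V,V'] - [W,W']) + i ([V,W'] + [W,V'])`. -/
def complexBracket (X Y : ∀ q : N, CTangent I q) (q : N) : CTangent I q :=
  toC
    (VectorField.mlieBracket I (fun z => rePart (X z)) (fun z => rePart (Y z)) q
      - VectorField.mlieBracket I (fun z => imPart (X z)) (fun z => imPart (Y z)) q)
    (VectorField.mlieBracket I (fun z => rePart (X z)) (fun z => imPart (Y z)) q
      + VectorField.mlieBracket I (fun z => imPart (X z)) (fun z => rePart (Y z)) q)

/-- A complex distribution `D` is integrable if `[X, Y] ∈ Γ(D)` for all `X, Y ∈ Γ(D)`. -/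
def IsIntegrable [IsManifold I ∞ N] (D : ∀ q : N, Submodule ℂ (CTangent I q)) : Prop :=
  ∀ X Y : ∀ q : N, CTangent I q, IsSmoothSection I X → IsSmoothSection I Y →
    (∀ q, X q ∈ D q) → (∀ q, Y q ∈ D q) → ∀ q, complexBracket I X Y q ∈ D q

end Complexification

/-! ## The Grassmannian as a complex manifold -/

section Grassmannian

/-- The Grassmannian `Gr_r(m, ℂ)` of `r`-dimensional subspaces of `ℂ^m`. -/
def Gr (r m : ℕ) : Type := {W : Submodule ℂ (Fin m → ℂ) // Module.finrank ℂ W = r}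

/-- The model space `Hom(ℂ^r, ℂ^(m-r))` of the Grassmannian. -/
abbrev GrModel (r m : ℕ) : Type := (Fin r → ℂ) →L[ℂ] (Fin (m - r) → ℂ)

/-- A splitting `ℂ^r × ℂ^(m-r) ≅ ℂ^m`. -/
abbrev Splitting (r m : ℕ) : Type :=
  ((Fin r → ℂ) × (Fin (m - r) → ℂ)) ≃L[ℂ] (Fin m → ℂ)

variable {r m : ℕ}

/-- The linear map `k ↦ e (k, A k)`. -/
def graphMap (e : Splitting r m) (A : GrModel r m) : (Fin r → ℂ) →L[ℂ] (Fin m → ℂ) :=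
  (e : _ →L[ℂ] _) ∘L ((ContinuousLinearMap.id ℂ (Fin r → ℂ)).prod A)

theorem graphMap_injective (e : Splitting r m) (A : GrModel r m) :
    Function.Injective (graphMap e A) := by
  intro k k' h
  have := e.injective h
  simpa using congrArg Prod.fst this

/-- The subspace `{e (k, A k)}`: the graph of `A` with respect to the splitting `e`. -/
def graphPoint (e : Splitting r m) (A : GrModel r m) : Gr r m :=
  ⟨LinearMap.range (graphMap e A).toLinearMap, by
    rw [LinearMap.finrank_range_of_inj (graphMap_injective e A)]; simp⟩

theorem graphPoint_injective (e : Splitting r m) : Function.Injective (graphPoint e) := by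
  intro A A' h
  ext1 k
  have h1 : graphMap e A k ∈ LinearMap.range (graphMap e A').toLinearMap := by
    have h0 : LinearMap.range (graphMap e A).toLinearMap
        = LinearMap.range (graphMap e A').toLinearMap := congrArg Subtype.val h
    rw [← h0]
    exact ⟨k, rfl⟩
  obtain ⟨k', hk'⟩ := h1
  have h2 : ((k', A' k') : (Fin r → ℂ) × (Fin (m - r) → ℂ)) = (k, A k) := e.injective hk'
  have h3 : k' = k := congrArg Prod.fst h2
  have h4 : A' k' = A k := congrArg Prod.snd h2
  rw [← h4, h3]

/-- The affine chart of the Grassmannian attached to a splitting `e`. It sends the graph of `A`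
to `A`. -/
def grChart (e : Splitting r m) : PartialEquiv (Gr r m) (GrModel r m) where
  toFun := Function.invFun (graphPoint e)
  invFun := graphPoint e
  source := range (graphPoint e)
  target := univ
  map_source' _ _ := mem_univ _
  map_target' A _ := ⟨A, rfl⟩
  left_inv' _ hW := Function.invFun_eq hW
  right_inv' A _ := Function.leftInverse_invFun (graphPoint_injective e) A

/-- First component of `e'⁻¹ ∘ e ∘ (id, A)`. -/
def transFst (e e' : Splitting r m) (A : GrModel r m) : (Fin r → ℂ) →L[ℂ] (Fin r → ℂ) :=
  (ContinuousLinearMap.fst ℂ (Fin r → ℂ) (Fin (m - r) → ℂ)) ∘L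
    ((e'.symm : _ →L[ℂ] _) ∘L graphMap e A)

/-- Second component of `e'⁻¹ ∘ e ∘ (id, A)`. -/
def transSnd (e e' : Splitting r m) (A : GrModel r m) : GrModel r m :=
  (ContinuousLinearMap.snd ℂ (Fin r → ℂ) (Fin (m - r) → ℂ)) ∘L
    ((e'.symm : _ →L[ℂ] _) ∘L graphMap e A)

theorem graphMap_eq (e e' : Splitting r m) (A : GrModel r m) (k : Fin r → ℂ) :
    graphMap e A k = e' (transFst e e' A k, transSnd e e' A k) := by
  simp [transFst, transSnd]

theorem graphPoint_eq_of_isUnit (e e' : Splitting r m) (A : GrModel r m)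
    (h : IsUnit (transFst e e' A)) :
    graphPoint e' (transSnd e e' A ∘L Ring.inverse (transFst e e' A)) = graphPoint e A := by
  obtain ⟨g, hg⟩ := h
  apply Subtype.ext
  rw [← hg, Ring.inverse_unit]
  have key : ∀ k, graphMap e A k
      = graphMap e' (transSnd e e' A ∘L (↑g⁻¹ : (Fin r → ℂ) →L[ℂ] (Fin r → ℂ))) (g.1 k) := by
    intro k
    have h1 : (↑g⁻¹ : (Fin r → ℂ) →L[ℂ] (Fin r → ℂ)) (g.1 k) = k :=
      congrArg (fun T : (Fin r → ℂ) →L[ℂ] (Fin r → ℂ) => T k) g.inv_mul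
    rw [graphMap_eq e e', ← hg]
    simp [graphMap, h1]
  have h2 : ∀ k, g.1 ((↑g⁻¹ : (Fin r → ℂ) →L[ℂ] (Fin r → ℂ)) k) = k := fun k =>
    congrArg (fun T : (Fin r → ℂ) →L[ℂ] (Fin r → ℂ) => T k) g.mul_inv
  apply le_antisymm
  · rintro _ ⟨k, rfl⟩
    refine ⟨(↑g⁻¹ : (Fin r → ℂ) →L[ℂ] (Fin r → ℂ)) k, ?_⟩
    have := key ((↑g⁻¹ : (Fin r → ℂ) →L[ℂ] (Fin r → ℂ)) k)
    rw [h2] at this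
    exact this
  · rintro _ ⟨k, rfl⟩
    exact ⟨g.1 k, (key k).symm⟩

theorem grChart_trans_source (e e' : Splitting r m) :
    ((grChart e).symm.trans (grChart e')).source = {A | IsUnit (transFst e e' A)} := by
  ext A
  rw [PartialEquiv.trans_source]
  constructor
  · rintro ⟨-, A', hA'⟩
    change graphPoint e' A' = graphPoint e A at hA'
    have hinj : Function.Injective (transFst e e' A) := by
      rw [injective_iff_map_eq_zero]
      intro k hk
      have h1 : graphMap e A k ∈ LinearMap.range (graphMap e' A').toLinearMap := by
        have := congrArg Subtype.val hA'
        change LinearMap.range (graphMap e' A').toLinearMap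
          = LinearMap.range (graphMap e A).toLinearMap at this
        rw [this]
        exact ⟨k, rfl⟩
      obtain ⟨k', hk'⟩ := h1
      rw [graphMap_eq e e'] at hk'
      have h2 : ((k', A' k') : (Fin r → ℂ) × (Fin (m - r) → ℂ))
        = (transFst e e' A k, transSnd e e' A k) := e'.injective hk'
      have h3 : k' = 0 := (congrArg Prod.fst h2).trans hk
      have h4 : graphMap e A k = 0 := by
        rw [graphMap_eq e e', ← h2, h3]; simp
      exact graphMap_injective e A (h4.trans (map_zero _).symm)
    have : IsUnit (transFst e e' A).toLinearMap :=
      LinearMap.isUnit_iff_ker_eq_bot _ |>.2 (LinearMap.ker_eq_bot.2 hinj)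
    change IsUnit (transFst e e' A)
    rw [ContinuousLinearMap.isUnit_iff_bijective]
    exact (Module.End.isUnit_iff _).1 this
  · intro h
    exact ⟨mem_univ _, _, graphPoint_eq_of_isUnit e e' A h⟩

theorem grChart_trans_apply (e e' : Splitting r m) {A : GrModel r m}
    (h : IsUnit (transFst e e' A)) :
    (grChart e).symm.trans (grChart e') A
      = transSnd e e' A ∘L Ring.inverse (transFst e e' A) := by
  change Function.invFun (graphPoint e') (graphPoint e A) = _
  rw [← graphPoint_eq_of_isUnit e e' A h]
  exact Function.leftInverse_invFun (graphPoint_injective e') _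

theorem contDiff_graphMap (e : Splitting r m) : ContDiff ℂ ω (graphMap e) := by
  unfold graphMap
  refine contDiff_const.clm_comp ?_
  have : (fun A : GrModel r m => (ContinuousLinearMap.id ℂ (Fin r → ℂ)).prod A)
    = fun A => (ContinuousLinearMap.inl ℂ (Fin r → ℂ) (Fin (m - r) → ℂ)) +
        (ContinuousLinearMap.inr ℂ (Fin r → ℂ) (Fin (m - r) → ℂ)) ∘L A := by
    funext A
    ext1 k
    simp
  change ContDiff ℂ ω (fun A : GrModel r m => (ContinuousLinearMap.id ℂ (Fin r → ℂ)).prod A)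
  rw [this]
  exact contDiff_const.add (contDiff_const.clm_comp contDiff_id)

theorem contDiff_transFst (e e' : Splitting r m) : ContDiff ℂ ω (transFst e e') :=
  contDiff_const.clm_comp (contDiff_const.clm_comp (contDiff_graphMap e))

theorem contDiff_transSnd (e e' : Splitting r m) : ContDiff ℂ ω (transSnd e e') :=
  contDiff_const.clm_comp (contDiff_const.clm_comp (contDiff_graphMap e))

theorem contDiffOn_grChart_trans (e e' : Splitting r m) :
    ContDiffOn ℂ ω ((grChart e).symm.trans (grChart e'))
      ((grChart e).symm.trans (grChart e')).source := by
  rw [grChart_trans_source]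
  have : ContDiffOn ℂ ω
      (fun A => transSnd e e' A ∘L Ring.inverse (transFst e e' A))
      {A | IsUnit (transFst e e' A)} := by
    refine (contDiff_transSnd e e').contDiffOn.clm_comp ?_
    rintro A ⟨g, hg⟩
    refine ContDiffAt.contDiffWithinAt ?_
    have hinv : ContDiffAt ℂ ω
        (Ring.inverse : ((Fin r → ℂ) →L[ℂ] (Fin r → ℂ)) → _) (transFst e e' A) := by
      rw [← hg]
      exact contDiffAt_ringInverse ℂ g
    exact ContDiffAt.comp A hinv (contDiff_transFst e e').contDiffAt
  exact this.congr fun A hA => grChart_trans_apply e e' hA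

theorem exists_mem_grChart_source (W : Gr r m) :
    ∃ e : Splitting r m, W ∈ (grChart e).source := by
  obtain ⟨W, hW⟩ := W
  obtain ⟨L, hL⟩ := Submodule.exists_isCompl W
  have hm : Module.finrank ℂ W + Module.finrank ℂ L = m := by
    rw [Submodule.finrank_add_eq_of_isCompl hL]; simp
  have e₁ : (Fin r → ℂ) ≃ₗ[ℂ] W := LinearEquiv.ofFinrankEq _ _ (by simp [hW])
  have e₂ : (Fin (m - r) → ℂ) ≃ₗ[ℂ] L :=
    LinearEquiv.ofFinrankEq _ _ (by rw [Module.finrank_fin_fun]; omega)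
  let e : Splitting r m :=
    ((e₁.prodCongr e₂).trans (W.prodEquivOfIsCompl L hL)).toContinuousLinearEquiv
  have he : ∀ k, graphMap e 0 k = (e₁ k : Fin m → ℂ) := by
    intro k
    change ((e₁.prodCongr e₂).trans (W.prodEquivOfIsCompl L hL)) (k, 0) = _
    simp
  refine ⟨e, 0, Subtype.ext ?_⟩
  apply le_antisymm
  · rintro _ ⟨k, rfl⟩
    change graphMap e 0 k ∈ W
    rw [he]
    exact (e₁ k).2
  · intro w hw
    refine ⟨e₁.symm ⟨w, hw⟩, ?_⟩
    change graphMap e 0 _ = w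
    rw [he]
    simp

/-- The complex atlas of the Grassmannian. -/
def grCore (r m : ℕ) : ChartedSpaceCore (GrModel r m) (Gr r m) where
  atlas := range grChart
  chartAt W := grChart (exists_mem_grChart_source W).choose
  mem_chart_source W := (exists_mem_grChart_source W).choose_spec
  chart_mem_atlas W := ⟨_, rfl⟩
  open_source := by
    rintro _ _ ⟨e, rfl⟩ ⟨e', rfl⟩
    rw [grChart_trans_source]
    exact Units.isOpen.preimage (contDiff_transFst e e').continuous
  continuousOn_toFun := by
    rintro _ _ ⟨e, rfl⟩ ⟨e', rfl⟩
    exact (contDiffOn_grChart_trans e e').continuousOn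

instance (r m : ℕ) : TopologicalSpace (Gr r m) := (grCore r m).toTopologicalSpace

instance (r m : ℕ) : ChartedSpace (GrModel r m) (Gr r m) := (grCore r m).toChartedSpace

instance (r m : ℕ) : IsManifold 𝓘(ℂ, GrModel r m) ω (Gr r m) := by
  apply isManifold_of_contDiffOn
  intro e e' he he'
  have he2 : e ∈ ⋃ (c : PartialEquiv (Gr r m) (GrModel r m)) (hc : c ∈ (grCore r m).atlas),
    {(grCore r m).openPartialHomeomorph c hc} := he
  have he2' : e' ∈ ⋃ (c : PartialEquiv (Gr r m) (GrModel r m)) (hc : c ∈ (grCore r m).atlas),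
    {(grCore r m).openPartialHomeomorph c hc} := he'
  simp only [mem_iUnion, mem_singleton_iff] at he2 he2'
  obtain ⟨_, ⟨c, rfl⟩, rfl⟩ := he2
  obtain ⟨_, ⟨c', rfl⟩, rfl⟩ := he2'
  refine (contDiffOn_grChart_trans c c').mono ?_
  intro A hA
  exact hA.1

end Grassmannian

/-! ## Homogeneous complex submanifolds of the Grassmannian -/

section Fibres

/-- The complex general linear group `GL(m, ℂ)`, an open subset of the complex vector space of
endomorphisms of `ℂ^m`. -/
abbrev GLC (m : ℕ) : Type := ((Fin m → ℂ) →L[ℂ] (Fin m → ℂ))ˣ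

/-- The complex Lie group `G` as a complex Lie subgroup of `GL(m, ℂ)`: the inclusion is an injective
homomorphism of groups, a holomorphic map, and an immersion. -/
structure ComplexLieSubgroup (m : ℕ) (EG : Type*) [NormedAddCommGroup EG] [NormedSpace ℂ EG]
    (G : Type*) [Group G] [TopologicalSpace G] [ChartedSpace EG G] where
  rep : G →* GLC m
  rep_injective : Function.Injective rep
  contMDiff_rep : ContMDiff 𝓘(ℂ, EG) 𝓘(ℂ, (Fin m → ℂ) →L[ℂ] (Fin m → ℂ)) ω rep
  immersion_rep : ∀ g : G,
    Function.Injective (mfderiv 𝓘(ℂ, EG) 𝓘(ℂ, (Fin m → ℂ) →L[ℂ] (Fin m → ℂ)) rep g)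

variable {m : ℕ} {EG : Type*} [NormedAddCommGroup EG] [NormedSpace ℂ EG]
  {G : Type*} [Group G] [TopologicalSpace G] [ChartedSpace EG G]

/-- The endomorphism of `ℂ^m` given by an element of the Lie algebra `T_1 G` of a Lie subgroup `G`
of `GL(m, ℂ)`. -/
def ComplexLieSubgroup.lieRep (Γ : ComplexLieSubgroup m EG G)
    (a : TangentSpace 𝓘(ℝ, EG) (1 : G)) : (Fin m → ℂ) →L[ℂ] (Fin m → ℂ) :=
  mfderiv 𝓘(ℝ, EG) 𝓘(ℝ, (Fin m → ℂ) →L[ℂ] (Fin m → ℂ))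
    (fun g : G => (Γ.rep g : (Fin m → ℂ) →L[ℂ] (Fin m → ℂ))) 1 a

/-- The complex manifold `F` as a complex submanifold of `Gr_r(m, ℂ)`, on which the canonical action
of the Lie subgroup `G` of `GL(m, ℂ)` induces a transitive holomorphic action. -/
structure HomogeneousSubmanifold (Γ : ComplexLieSubgroup m EG G) (r : ℕ)
    (EF : Type*) [NormedAddCommGroup EF] [NormedSpace ℂ EF]
    (F : Type*) [TopologicalSpace F] [ChartedSpace EF F] where
  nonempty : Nonempty F
  incl : F → Gr r m
  incl_injective : Function.Injective incl
  contMDiff_incl : ContMDiff 𝓘(ℂ, EF) 𝓘(ℂ, GrModel r m) ω incl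
  immersion_incl : ∀ f : F,
    Function.Injective (mfderiv 𝓘(ℂ, EF) 𝓘(ℂ, GrModel r m) incl f)
  smul : G → F → F
  incl_smul : ∀ g f, (incl (smul g f)).1
    = (incl f).1.map (Γ.rep g : (Fin m → ℂ) →L[ℂ] (Fin m → ℂ)).toLinearMap
  contMDiff_smul : ContMDiff (𝓘(ℂ, EG).prod 𝓘(ℂ, EF)) 𝓘(ℂ, EF) ω
    (fun z : G × F => smul z.1 z.2)
  transitive : ∀ f f' : F, ∃ g : G, smul g f = f'

variable {Γ : ComplexLieSubgroup m EG G} {r : ℕ}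
  {EF : Type*} [NormedAddCommGroup EF] [NormedSpace ℂ EF]
  {F : Type*} [TopologicalSpace F] [ChartedSpace EF F]

theorem HomogeneousSubmanifold.smul_one (𝓕 : HomogeneousSubmanifold Γ r EF F) (f : F) :
    𝓕.smul 1 f = f := by
  apply 𝓕.incl_injective
  apply Subtype.ext
  rw [𝓕.incl_smul, map_one]
  exact Submodule.map_id _

theorem HomogeneousSubmanifold.smul_mul (𝓕 : HomogeneousSubmanifold Γ r EF F) (g h : G) (f : F) :
    𝓕.smul (g * h) f = 𝓕.smul g (𝓕.smul h f) := by
  apply 𝓕.incl_injective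
  apply Subtype.ext
  rw [𝓕.incl_smul, 𝓕.incl_smul, 𝓕.incl_smul, map_mul, ← Submodule.map_comp]
  rfl

/-- The complex structure of the tangent spaces of a complex manifold. (As the changes of
coordinates are holomorphic, multiplication by `i` may be computed in any chart.) -/
def complexStructure (f : F) (v : TangentSpace 𝓘(ℝ, EF) f) : TangentSpace 𝓘(ℝ, EF) f :=
  let w : EF := v
  (Complex.I • w : EF)

end Fibres

/-! ## A complex manifold as a real manifold -/

section Restrict

variable {E₁ E₂ E₃ : Type*} [NormedAddCommGroup E₁] [NormedSpace ℂ E₁]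
  [NormedAddCommGroup E₂] [NormedSpace ℂ E₂] [NormedAddCommGroup E₃] [NormedSpace ℂ E₃]
  {M₁ M₂ M₃ : Type*} [TopologicalSpace M₁] [ChartedSpace E₁ M₁]
  [TopologicalSpace M₂] [ChartedSpace E₂ M₂] [TopologicalSpace M₃] [ChartedSpace E₃ M₃]

theorem isManifold_real (h : IsManifold 𝓘(ℂ, E₁) ω M₁) : IsManifold 𝓘(ℝ, E₁) ∞ M₁ := by
  apply isManifold_of_contDiffOn
  intro e e' he he'
  have h1 : e.symm ≫ₕ e' ∈ contDiffGroupoid ω 𝓘(ℂ, E₁) :=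
    StructureGroupoid.compatible _ he he'
  have h2 : ContDiffOn ℂ ω (e.symm ≫ₕ e') (e.symm ≫ₕ e').source :=
    contMDiffOn_iff_contDiffOn.1 (contMDiffOn_of_mem_contDiffGroupoid h1)
  refine ((h2.restrict_scalars ℝ).of_le le_top).mono ?_
  intro x hx
  exact hx.1

theorem contMDiff_real_of_prod {f : M₁ × M₂ → M₃}
    (hf : ContMDiff (𝓘(ℂ, E₁).prod 𝓘(ℂ, E₂)) 𝓘(ℂ, E₃) ω f) :
    ContMDiff (𝓘(ℝ, E₁).prod 𝓘(ℝ, E₂)) 𝓘(ℝ, E₃) ∞ f := by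
  intro x
  have h1 := contMDiffAt_iff.1 (hf x)
  exact contMDiffAt_iff.2 ⟨h1.1, (h1.2.restrict_scalars ℝ).of_le le_top⟩

end Restrict

/-! ## Principal bundles -/

section Principal

/-- The data of a principal bundle: the projection `P → M` and the right action of `G` on `P`. -/
structure PrincipalData (M G P : Type*) where
  proj : P → M
  act : P → G → P

/-- A smooth local section `sec` of `P` over an open set `domain`, together with the smooth map
`coord` for which `u = sec (proj u) · coord u`. For a free action, this is the same as a smooth
equivariant local trivialization `P|_U ≅ U × G`. -/
structure LocalSection {M G P : Type*} (B : PrincipalData M G P)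
    (EM : Type*) [NormedAddCommGroup EM] [NormedSpace ℝ EM] [TopologicalSpace M] [ChartedSpace EM M]
    (EG : Type*) [NormedAddCommGroup EG] [NormedSpace ℝ EG] [TopologicalSpace G] [ChartedSpace EG G]
    (EP : Type*) [NormedAddCommGroup EP] [NormedSpace ℝ EP] [TopologicalSpace P]
    [ChartedSpace EP P] where
  domain : Set M
  isOpen_domain : IsOpen domain
  sec : M → P
  coord : P → G
  contMDiffOn_sec : ContMDiffOn 𝓘(ℝ, EM) 𝓘(ℝ, EP) ∞ sec domain
  contMDiffOn_coord : ContMDiffOn 𝓘(ℝ, EP) 𝓘(ℝ, EG) ∞ coord (B.proj ⁻¹' domain)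
  proj_sec : ∀ x ∈ domain, B.proj (sec x) = x
  act_coord : ∀ u, B.proj u ∈ domain → B.act (sec (B.proj u)) (coord u) = u

/-- `(P, M, G)` is a smooth principal bundle: `G` acts smoothly and freely on `P` from the right,
preserving the fibres of the smooth map `P → M`, and `P` is locally trivial. -/
structure PrincipalBundle
    (EM : Type*) [NormedAddCommGroup EM] [NormedSpace ℝ EM]
    (M : Type*) [TopologicalSpace M] [ChartedSpace EM M]
    (EG : Type*) [NormedAddCommGroup EG] [NormedSpace ℝ EG]
    (G : Type*) [Group G] [TopologicalSpace G] [ChartedSpace EG G]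
    (EP : Type*) [NormedAddCommGroup EP] [NormedSpace ℝ EP]
    (P : Type*) [TopologicalSpace P] [ChartedSpace EP P] extends PrincipalData M G P where
  contMDiff_proj : ContMDiff 𝓘(ℝ, EP) 𝓘(ℝ, EM) ∞ proj
  contMDiff_act : ContMDiff (𝓘(ℝ, EP).prod 𝓘(ℝ, EG)) 𝓘(ℝ, EP) ∞
    (fun z : P × G => act z.1 z.2)
  act_one : ∀ u, act u 1 = u
  act_mul : ∀ u g h, act u (g * h) = act (act u g) h
  proj_act : ∀ u g, proj (act u g) = proj u
  free : ∀ u g, act u g = u → g = 1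
  locally_trivial : ∀ x : M, ∃ σ : LocalSection toPrincipalData EM EG EP, x ∈ σ.domain

end Principal

section Associated

variable {EM : Type*} [NormedAddCommGroup EM] [NormedSpace ℝ EM]
  {M : Type*} [TopologicalSpace M] [ChartedSpace EM M]
  {EG : Type*} [NormedAddCommGroup EG] [NormedSpace ℂ EG]
  {G : Type*} [Group G] [TopologicalSpace G] [ChartedSpace EG G]
  {EP : Type*} [NormedAddCommGroup EP] [NormedSpace ℝ EP]
  {P : Type*} [TopologicalSpace P] [ChartedSpace EP P]
  {EF : Type*} [NormedAddCommGroup EF] [NormedSpace ℂ EF]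
  {F : Type*} [TopologicalSpace F] [ChartedSpace EF F]
  {m r : ℕ} {Γ : ComplexLieSubgroup m EG G}

theorem LocalSection.coord_act {B : PrincipalBundle EM M EG G EP P}
    (σ : LocalSection B.toPrincipalData EM EG EP) {u : P} (hu : B.proj u ∈ σ.domain) (g : G) :
    σ.coord (B.act u g) = σ.coord u * g := by
  have h1 : B.act (σ.sec (B.proj u)) (σ.coord (B.act u g)) = B.act u g := by
    have := σ.act_coord (B.act u g) (by rw [B.proj_act]; exact hu)
    rwa [B.proj_act] at this
  have h2 : B.act (σ.sec (B.proj u)) (σ.coord u * g) = B.act u g := by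
    rw [B.act_mul, σ.act_coord u hu]
  have h3 : B.act (σ.sec (B.proj u)) (σ.coord (B.act u g) * (σ.coord u * g)⁻¹)
      = σ.sec (B.proj u) := by
    rw [B.act_mul, h1, ← h2, ← B.act_mul, mul_inv_cancel, B.act_one]
  exact mul_inv_eq_one.1 (B.free _ _ h3)

/-- The equivalence relation on `P × F` whose classes are the orbits of `G`:
`(u · g, f) ~ (u, g · f)`. -/
def assocSetoid (B : PrincipalBundle EM M EG G EP P) (𝓕 : HomogeneousSubmanifold Γ r EF F) :
    Setoid (P × F) where
  r z w := ∃ g : G, w.1 = B.act z.1 g ∧ z.2 = 𝓕.smul g w.2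
  iseqv := by
    refine ⟨fun z => ⟨1, (B.act_one _).symm, (𝓕.smul_one _).symm⟩, ?_, ?_⟩
    · rintro z w ⟨g, h1, h2⟩
      refine ⟨g⁻¹, ?_, ?_⟩
      · rw [h1, ← B.act_mul, mul_inv_cancel, B.act_one]
      · rw [h2, ← 𝓕.smul_mul, inv_mul_cancel, 𝓕.smul_one]
    · rintro z w y ⟨g, h1, h2⟩ ⟨h, h3, h4⟩
      exact ⟨g * h, by rw [h3, h1, B.act_mul], by rw [h2, h4, 𝓕.smul_mul]⟩

/-- The associated bundle `P ×_G F`. -/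
def Assoc (B : PrincipalBundle EM M EG G EP P) (𝓕 : HomogeneousSubmanifold Γ r EF F) : Type _ :=
  Quotient (assocSetoid B 𝓕)

namespace Assoc

variable (B : PrincipalBundle EM M EG G EP P) (𝓕 : HomogeneousSubmanifold Γ r EF F)

/-- The point `[u, f]` of `P ×_G F`. -/
def mk (u : P) (f : F) : Assoc B 𝓕 := Quotient.mk (assocSetoid B 𝓕) (u, f)

variable {B 𝓕}

/-- The projection `P ×_G F → M`. -/
def proj (q : Assoc B 𝓕) : M :=
  Quotient.lift (fun z : P × F => B.proj z.1)
    (by rintro z w ⟨g, h, -⟩; exact ((congrArg B.proj h).trans (B.proj_act _ _)).symm) q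

theorem mk_act (u : P) (g : G) (f : F) : mk B 𝓕 (B.act u g) f = mk B 𝓕 u (𝓕.smul g f) :=
  (Quotient.sound ⟨g, rfl, rfl⟩ :
    Quotient.mk (assocSetoid B 𝓕) (u, 𝓕.smul g f) = Quotient.mk _ (B.act u g, f)).symm

theorem smul_coord_out (σ : LocalSection B.toPrincipalData EM EG EP) {u : P}
    (hu : B.proj u ∈ σ.domain) (f : F) :
    𝓕.smul (σ.coord (Quotient.out (mk B 𝓕 u f)).1) (Quotient.out (mk B 𝓕 u f)).2
      = 𝓕.smul (σ.coord u) f := by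
  obtain ⟨g, h1, h2⟩ : (assocSetoid B 𝓕) (u, f) (Quotient.out (mk B 𝓕 u f)) :=
    (assocSetoid B 𝓕).iseqv.symm (Quotient.mk_out (s := assocSetoid B 𝓕) (u, f))
  rw [h1, σ.coord_act hu, 𝓕.smul_mul, ← h2]

/-- The trivialization `[sec x, f] ↦ (x, f)` of `P ×_G F` given by a local section of `P`. -/
def chart (σ : LocalSection B.toPrincipalData EM EG EP) : PartialEquiv (Assoc B 𝓕) (M × F) where
  toFun q := (proj q, 𝓕.smul (σ.coord (Quotient.out q).1) (Quotient.out q).2)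
  invFun z := mk B 𝓕 (σ.sec z.1) z.2
  source := proj ⁻¹' σ.domain
  target := σ.domain ×ˢ univ
  map_source' _ hq := ⟨hq, mem_univ _⟩
  map_target' z hz := by
    change B.proj (σ.sec z.1) ∈ σ.domain
    rw [σ.proj_sec _ hz.1]; exact hz.1
  left_inv' q hq := by
    obtain ⟨⟨u, f⟩, rfl⟩ := Quotient.exists_rep q
    have hu : B.proj u ∈ σ.domain := hq
    change mk B 𝓕 (σ.sec (B.proj u)) (𝓕.smul (σ.coord (Quotient.out (mk B 𝓕 u f)).1)
      (Quotient.out (mk B 𝓕 u f)).2) = mk B 𝓕 u f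
    rw [smul_coord_out σ hu, ← mk_act, σ.act_coord u hu]
  right_inv' z hz := by
    have hx : B.proj (σ.sec z.1) = z.1 := σ.proj_sec _ hz.1
    have hu : B.proj (σ.sec z.1) ∈ σ.domain := by rw [hx]; exact hz.1
    have h1 : σ.coord (σ.sec z.1) = 1 := by
      have h2 := σ.act_coord _ hu
      rw [hx] at h2
      exact B.free _ _ h2
    refine Prod.ext hx ?_
    change 𝓕.smul (σ.coord (Quotient.out (mk B 𝓕 (σ.sec z.1) z.2)).1)
      (Quotient.out (mk B 𝓕 (σ.sec z.1) z.2)).2 = z.2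
    rw [smul_coord_out σ hu, h1, 𝓕.smul_one]

theorem chart_trans_apply (σ τ : LocalSection B.toPrincipalData EM EG EP) {z : M × F}
    (hz : z ∈ (σ.domain ∩ τ.domain) ×ˢ (univ : Set F)) :
    ((chart (𝓕 := 𝓕) σ).symm.trans (chart τ)) z = (z.1, 𝓕.smul (τ.coord (σ.sec z.1)) z.2) := by
  have hx : B.proj (σ.sec z.1) = z.1 := σ.proj_sec _ hz.1.1
  refine Prod.ext hx ?_
  exact smul_coord_out τ (by rw [hx]; exact hz.1.2) z.2

theorem chart_trans_source (σ τ : LocalSection B.toPrincipalData EM EG EP) :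
    ((chart (𝓕 := 𝓕) σ).symm.trans (chart τ)).source
      = (σ.domain ∩ τ.domain) ×ˢ (univ : Set F) := by
  ext z
  constructor
  · rintro ⟨h1, h2⟩
    have h3 : B.proj (σ.sec z.1) ∈ τ.domain := h2
    rw [σ.proj_sec _ h1.1] at h3
    exact ⟨⟨h1.1, h3⟩, mem_univ _⟩
  · rintro ⟨h1, -⟩
    refine ⟨⟨h1.1, mem_univ _⟩, ?_⟩
    change B.proj (σ.sec z.1) ∈ τ.domain
    rw [σ.proj_sec _ h1.1]
    exact h1.2

theorem contMDiffOn_chart_trans (σ τ : LocalSection B.toPrincipalData EM EG EP) :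
    ContMDiffOn (𝓘(ℝ, EM).prod 𝓘(ℝ, EF)) (𝓘(ℝ, EM).prod 𝓘(ℝ, EF)) ∞
      ((chart (𝓕 := 𝓕) σ).symm.trans (chart τ))
      ((chart (𝓕 := 𝓕) σ).symm.trans (chart τ)).source := by
  rw [chart_trans_source]
  have h1 : ContMDiffOn 𝓘(ℝ, EM) 𝓘(ℝ, EG) ∞ (fun x => τ.coord (σ.sec x))
      (σ.domain ∩ τ.domain) := by
    refine τ.contMDiffOn_coord.comp (σ.contMDiffOn_sec.mono inter_subset_left) ?_
    intro x hx
    change B.proj (σ.sec x) ∈ τ.domain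
    rw [σ.proj_sec _ hx.1]
    exact hx.2
  have h2 : ContMDiffOn (𝓘(ℝ, EM).prod 𝓘(ℝ, EF)) 𝓘(ℝ, EG) ∞
      (fun z : M × F => τ.coord (σ.sec z.1)) ((σ.domain ∩ τ.domain) ×ˢ (univ : Set F)) :=
    h1.comp contMDiffOn_fst (fun z hz => hz.1)
  have h3 := (contMDiff_real_of_prod 𝓕.contMDiff_smul).comp_contMDiffOn
    (h2.prodMk contMDiffOn_snd)
  exact (contMDiffOn_fst.prodMk h3).congr fun z hz => chart_trans_apply σ τ hz

variable (B 𝓕) in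
/-- The bundle atlas of `P ×_G F`, consisting of the trivializations given by local sections
of `P`. -/
def core : ChartedSpaceCore (M × F) (Assoc B 𝓕) where
  atlas := range chart
  chartAt q := chart (B.locally_trivial (proj q)).choose
  mem_chart_source q := (B.locally_trivial (proj q)).choose_spec
  chart_mem_atlas _ := ⟨_, rfl⟩
  open_source := by
    rintro _ _ ⟨σ, rfl⟩ ⟨τ, rfl⟩
    rw [chart_trans_source]
    exact (σ.isOpen_domain.inter τ.isOpen_domain).prod isOpen_univ
  continuousOn_toFun := by
    rintro _ _ ⟨σ, rfl⟩ ⟨τ, rfl⟩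
    exact (contMDiffOn_chart_trans σ τ).continuousOn

instance : TopologicalSpace (Assoc B 𝓕) := (core B 𝓕).toTopologicalSpace

/-- `P ×_G F` is locally `M × F`. -/
@[reducible]
def bundleChartedSpace : ChartedSpace (M × F) (Assoc B 𝓕) := (core B 𝓕).toChartedSpace

instance : ChartedSpace (ModelProd EM EF) (Assoc B 𝓕) :=
  letI := bundleChartedSpace (B := B) (𝓕 := 𝓕)
  ChartedSpace.comp (ModelProd EM EF) (M × F) (Assoc B 𝓕)

instance [IsManifold 𝓘(ℝ, EM) ∞ M] [h : IsManifold 𝓘(ℂ, EF) ω F] :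
    IsManifold (𝓘(ℝ, EM).prod 𝓘(ℝ, EF)) ∞ (Assoc B 𝓕) := by
  have hF : IsManifold 𝓘(ℝ, EF) ∞ F := isManifold_real h
  let _ := bundleChartedSpace (B := B) (𝓕 := 𝓕)
  apply isManifold_of_contDiffOn
  rintro _ _ ⟨φ, hφ, c, hc, rfl⟩ ⟨φ', hφ', c', hc', rfl⟩
  have hφ2 : φ ∈ ⋃ (d : PartialEquiv (Assoc B 𝓕) (M × F)) (hd : d ∈ (core B 𝓕).atlas),
    {(core B 𝓕).openPartialHomeomorph d hd} := hφ
  have hφ2' : φ' ∈ ⋃ (d : PartialEquiv (Assoc B 𝓕) (M × F)) (hd : d ∈ (core B 𝓕).atlas),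
    {(core B 𝓕).openPartialHomeomorph d hd} := hφ'
  simp only [mem_iUnion, mem_singleton_iff] at hφ2 hφ2'
  obtain ⟨_, ⟨σ, rfl⟩, rfl⟩ := hφ2
  obtain ⟨_, ⟨τ, rfl⟩, rfl⟩ := hφ2'
  have h1 := contMDiffOn_symm_of_mem_maximalAtlas (I := 𝓘(ℝ, EM).prod 𝓘(ℝ, EF)) (n := ∞)
    (IsManifold.subset_maximalAtlas hc)
  have h2 := contMDiffOn_of_mem_maximalAtlas (I := 𝓘(ℝ, EM).prod 𝓘(ℝ, EF)) (n := ∞)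
    (IsManifold.subset_maximalAtlas hc')
  have h3 := contMDiffOn_chart_trans (𝓕 := 𝓕) σ τ
  have h4 := h2.comp' (h3.comp' h1)
  have h5 := (𝓘(ℝ, EM).prod 𝓘(ℝ, EF)).contMDiff.comp_contMDiffOn
    (h4.comp' ((𝓘(ℝ, EM).prod 𝓘(ℝ, EF)).contMDiffOn_symm))
  refine (contMDiffOn_iff_contDiffOn.1 h5).mono ?_
  rintro x ⟨⟨⟨h6, h7⟩, h8, h9⟩, -⟩
  refine ⟨mem_range_self _, ⟨h6, ?_, ?_⟩, ?_⟩
  · exact h7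
  · exact h8
  · exact h9

end Assoc

/-- A smooth section of the bundle `P ×_G F → M`. -/
structure SmoothSection (B : PrincipalBundle EM M EG G EP P)
    (𝓕 : HomogeneousSubmanifold Γ r EF F) where
  toFun : M → Assoc B 𝓕
  contMDiff_toFun : ContMDiff 𝓘(ℝ, EM) (𝓘(ℝ, EM).prod 𝓘(ℝ, EF)) ∞ toFun
  proj_toFun : ∀ x, (toFun x).proj = x

end Associated

/-! ## Subbundles of the complex frame bundle, and complex distributions given by sections -/

section Frames

variable {EM : Type*} [NormedAddCommGroup EM] [NormedSpace ℝ EM]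
  {M : Type*} [TopologicalSpace M] [ChartedSpace EM M]
  {EG : Type*} [NormedAddCommGroup EG] [NormedSpace ℂ EG]
  {G : Type*} [Group G] [TopologicalSpace G] [ChartedSpace EG G]
  {EP : Type*} [NormedAddCommGroup EP] [NormedSpace ℝ EP]
  {P : Type*} [TopologicalSpace P] [ChartedSpace EP P]
  {EF : Type*} [NormedAddCommGroup EF] [NormedSpace ℂ EF]
  {F : Type*} [TopologicalSpace F] [ChartedSpace EF F]
  {m r : ℕ} {Γ : ComplexLieSubgroup m EG G}

/-- The principal bundle `(P, M, G)` as a subbundle of the complex frame bundle of `T^ℂ M`: each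
`u ∈ P` over `x` is a complex frame `ℂ^m ≅ T^ℂ_x M`, which depends smoothly on `u`, and the frame of
`u · g` is the composition of the frame of `u` with `g`. -/
structure FrameSubbundle [IsManifold 𝓘(ℝ, EM) ∞ M] (B : PrincipalBundle EM M EG G EP P)
    (Γ : ComplexLieSubgroup m EG G) where
  frame : ∀ u : P, (Fin m → ℂ) ≃ₗ[ℂ] CTangent 𝓘(ℝ, EM) (B.proj u)
  frame_act : ∀ (u : P) (g : G) (w : Fin m → ℂ),
    (⟨B.proj (B.act u g), frame (B.act u g) w⟩ : Σ x : M, CTangent 𝓘(ℝ, EM) x)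
      = ⟨B.proj u, frame u ((Γ.rep g : (Fin m → ℂ) →L[ℂ] (Fin m → ℂ)) w)⟩
  contMDiff_rePart : ∀ w : Fin m → ℂ, ContMDiff 𝓘(ℝ, EP) 𝓘(ℝ, EM).tangent ∞
    (fun u => (⟨B.proj u, rePart (frame u w)⟩ : TangentBundle 𝓘(ℝ, EM) M))
  contMDiff_imPart : ∀ w : Fin m → ℂ, ContMDiff 𝓘(ℝ, EP) 𝓘(ℝ, EM).tangent ∞
    (fun u => (⟨B.proj u, imPart (frame u w)⟩ : TangentBundle 𝓘(ℝ, EM) M))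

/-- `InSubspace θ x q v`: the point `q` of `P ×_G F` lies over `x`, and the vector `v ∈ T^ℂ_x M` is in
the subspace of `T^ℂ_x M` corresponding to `q`. This is the image of the subspace `f` of `ℂ^m` under
the frame `u`, if `q = [u, f]`. -/
inductive InSubspace [IsManifold 𝓘(ℝ, EM) ∞ M] {B : PrincipalBundle EM M EG G EP P}
    (θ : FrameSubbundle B Γ) (𝓕 : HomogeneousSubmanifold Γ r EF F) :
    ∀ x : M, Assoc B 𝓕 → CTangent 𝓘(ℝ, EM) x → Prop
  | intro (u : P) (f : F) (w : Fin m → ℂ) (hw : w ∈ (𝓕.incl f).1) :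
      InSubspace θ 𝓕 (B.proj u) (Assoc.mk B 𝓕 u f) (θ.frame u w)

/-- The complex distribution `p ⊆ T^ℂ M` corresponding to a section `p` of `P ×_G F`, where `P` is a
subbundle of the complex frame bundle of `T^ℂ M`. -/
def SmoothSection.distribution [IsManifold 𝓘(ℝ, EM) ∞ M] {B : PrincipalBundle EM M EG G EP P}
    {𝓕 : HomogeneousSubmanifold Γ r EF F} (p : SmoothSection B 𝓕) (θ : FrameSubbundle B Γ) (x : M) :
    Submodule ℂ (CTangent 𝓘(ℝ, EM) x) :=
  Submodule.span ℂ {v | InSubspace θ 𝓕 x (p.toFun x) v}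

end Frames

/-! ## Connections, curvature, and the induced complex distribution -/

section Connections

variable {EM : Type*} [NormedAddCommGroup EM] [NormedSpace ℝ EM]
  {M : Type*} [TopologicalSpace M] [ChartedSpace EM M]
  {EG : Type*} [NormedAddCommGroup EG] [NormedSpace ℂ EG]
  {G : Type*} [Group G] [TopologicalSpace G] [ChartedSpace EG G]
  {EP : Type*} [NormedAddCommGroup EP] [NormedSpace ℝ EP]
  {P : Type*} [TopologicalSpace P] [ChartedSpace EP P] [IsManifold 𝓘(ℝ, EP) ∞ P]
  {EF : Type*} [NormedAddCommGroup EF] [NormedSpace ℂ EF]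
  {F : Type*} [TopologicalSpace F] [ChartedSpace EF F]
  {m r : ℕ} {Γ : ComplexLieSubgroup m EG G}

/-- A connection on the principal bundle `(P, M, G)`, given by its connection form: a smooth `1`-form
on `P` with values in the Lie algebra `T_1 G` such that `form (A^*) = A` for the fundamental vector
field `A^*` of each `A ∈ T_1 G`, and `R_g^* form = Ad(g⁻¹) form`. -/
structure Connection (B : PrincipalBundle EM M EG G EP P) where
  form : ∀ u : P, TangentSpace 𝓘(ℝ, EP) u →L[ℝ] TangentSpace 𝓘(ℝ, EG) (1 : G)
  contMDiff_form : ContMDiff (M' := EG) 𝓘(ℝ, EP).tangent 𝓘(ℝ, EG) ∞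
    (fun v : TangentBundle 𝓘(ℝ, EP) P => form v.proj v.snd)
  form_fundamental : ∀ (u : P) (A : TangentSpace 𝓘(ℝ, EG) (1 : G)),
    form (B.act u 1) (mfderiv 𝓘(ℝ, EG) 𝓘(ℝ, EP) (fun g : G => B.act u g) 1 A) = A
  form_act : ∀ (u : P) (g : G) (v : TangentSpace 𝓘(ℝ, EP) u),
    (form (B.act u g) (mfderiv 𝓘(ℝ, EP) 𝓘(ℝ, EP) (fun u' : P => B.act u' g) u v) : EG)
      = (mfderiv 𝓘(ℝ, EG) 𝓘(ℝ, EG) (fun h : G => g⁻¹ * h * g) 1 (form u v) : EG)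

/-- The differential of a map, extended `ℂ`-linearly to complexified tangent spaces. -/
def cdiff {E E' H H' N N' : Type*} [NormedAddCommGroup E] [NormedSpace ℝ E] [TopologicalSpace H]
    (I : ModelWithCorners ℝ E H) [TopologicalSpace N] [ChartedSpace H N]
    [NormedAddCommGroup E'] [NormedSpace ℝ E'] [TopologicalSpace H']
    (I' : ModelWithCorners ℝ E' H') [TopologicalSpace N'] [ChartedSpace H' N']
    (f : N → N') (q : N) : CTangent I q →ₗ[ℂ] CTangent I' (f q) :=
  (mfderiv I I' f q).toLinearMap.baseChange ℂ

namespace Connection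

variable {B : PrincipalBundle EM M EG G EP P} (C : Connection B)

/-- A complex tangent vector of `P` is horizontal if its real and imaginary parts are. -/
def IsHorizontal {u : P} (V : CTangent 𝓘(ℝ, EP) u) : Prop :=
  C.form u (rePart V) = 0 ∧ C.form u (imPart V) = 0

/-- The connection form in the preferred chart at `u`. -/
def chartForm (u : P) (y : EP) : EP →L[ℝ] EG :=
  (C.form ((extChartAt 𝓘(ℝ, EP) u).symm y)).comp
    (mfderiv 𝓘(ℝ, EP) 𝓘(ℝ, EP) (extChartAt 𝓘(ℝ, EP) u).symm y)

/-- The exterior derivative of the connection form at `u`, computed in the preferred chart at `u`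
(through which `T_u P` is identified with the model space):
`dα(v, w) = (D_v α)(w) - (D_w α)(v)`. -/
def dForm (u : P) (v w : TangentSpace 𝓘(ℝ, EP) u) : TangentSpace 𝓘(ℝ, EG) (1 : G) :=
  (fderiv ℝ (C.chartForm u) (extChartAt 𝓘(ℝ, EP) u u) v w
    - fderiv ℝ (C.chartForm u) (extChartAt 𝓘(ℝ, EP) u u) w v : EG)

/-- The curvature form at `u`, extended `ℂ`-bilinearly to complex horizontal vectors, as an
endomorphism of `ℂ^m`. (The curvature form is the horizontal part of the exterior derivative of the
connection form, so that on horizontal vectors it is the exterior derivative.) -/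
def curvature (Γ : ComplexLieSubgroup m EG G) (u : P) (V W : CTangent 𝓘(ℝ, EP) u) :
    (Fin m → ℂ) →L[ℂ] (Fin m → ℂ) :=
  (Γ.lieRep (C.dForm u (rePart V) (rePart W)) - Γ.lieRep (C.dForm u (imPart V) (imPart W)))
    + Complex.I •
      (Γ.lieRep (C.dForm u (rePart V) (imPart W)) + Γ.lieRep (C.dForm u (imPart V) (rePart W)))

/-- `R(Λ²_x p)(q) ⊆ q` for the point `q` of `P ×_G F` over `x`, seen as a subspace of the fibre over
`x` of the vector bundle `P ×_G ℂ^m`. If `q = [u, f]`, then the isomorphism `ℂ^m ≅ (P ×_G ℂ^m)_x`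
given by `u` identifies `q` with the subspace `f` of `ℂ^m`, and `R(X, Y)`, for `X, Y ∈ p_x`, with the
value of the curvature form on the horizontal lifts `V, W` of `X, Y` at `u`. -/
def CurvaturePreserves (p : ∀ x : M, Submodule ℂ (CTangent 𝓘(ℝ, EM) x))
    (𝓕 : HomogeneousSubmanifold Γ r EF F) (q : Assoc B 𝓕) : Prop :=
  ∀ (u : P) (f : F), Assoc.mk B 𝓕 u f = q →
    ∀ V W : CTangent 𝓘(ℝ, EP) u, C.IsHorizontal V → C.IsHorizontal W →
      cdiff 𝓘(ℝ, EP) 𝓘(ℝ, EM) B.proj u V ∈ p (B.proj u) →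
      cdiff 𝓘(ℝ, EP) 𝓘(ℝ, EM) B.proj u W ∈ p (B.proj u) →
      ∀ w ∈ (𝓕.incl f).1, C.curvature Γ u V W w ∈ (𝓕.incl f).1

/-- The complex tangent vectors of `P ×_G F` which are horizontal with respect to the connection
induced by `C`, and are projected into `p`. The horizontal vectors at `[u, f]` are the images of the
horizontal vectors at `u` under the differential of `[·, f] : P → P ×_G F`. -/
inductive HorizontalOver (p : ∀ x : M, Submodule ℂ (CTangent 𝓘(ℝ, EM) x))
    (𝓕 : HomogeneousSubmanifold Γ r EF F) :
    ∀ q : Assoc B 𝓕, CTangent (𝓘(ℝ, EM).prod 𝓘(ℝ, EF)) q → Prop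
  | intro (u : P) (f : F) (V : CTangent 𝓘(ℝ, EP) u) (hV : C.IsHorizontal V)
      (hp : cdiff 𝓘(ℝ, EP) 𝓘(ℝ, EM) B.proj u V ∈ p (B.proj u)) :
      HorizontalOver p 𝓕 (Assoc.mk B 𝓕 u f)
        (cdiff 𝓘(ℝ, EP) (𝓘(ℝ, EM).prod 𝓘(ℝ, EF)) (fun u' : P => Assoc.mk B 𝓕 u' f) u V)

end Connection

/-- The vertical vectors of `P ×_G F` of type `(0, 1)`. The complex structure of the fibres is that
of `F`, transported by the maps `[u, ·] : F → P ×_G F`, and the vectors of type `(0, 1)` of `F` are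
`ξ + i J ξ`, for `ξ` real and `J` the complex structure. -/
inductive VerticalAntiholomorphic (B : PrincipalBundle EM M EG G EP P)
    (𝓕 : HomogeneousSubmanifold Γ r EF F) :
    ∀ q : Assoc B 𝓕, CTangent (𝓘(ℝ, EM).prod 𝓘(ℝ, EF)) q → Prop
  | intro (u : P) (f : F) (ξ : TangentSpace 𝓘(ℝ, EF) f) :
      VerticalAntiholomorphic B 𝓕 (Assoc.mk B 𝓕 u f)
        (cdiff 𝓘(ℝ, EF) (𝓘(ℝ, EM).prod 𝓘(ℝ, EF)) (fun f' : F => Assoc.mk B 𝓕 u f') f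
          (toC ξ (complexStructure f ξ)))

/-- The complex distribution `𝒢^p = 𝒢^p_0 ⊕ (ker dπ)^{0,1}` on `Q = P ×_G F`, where `𝒢^p_0` is
horizontal, and is mapped onto `p` by the differential of the projection `π : Q → M`. -/
def inducedDistribution {B : PrincipalBundle EM M EG G EP P} (C : Connection B)
    (𝓕 : HomogeneousSubmanifold Γ r EF F) (p : ∀ x : M, Submodule ℂ (CTangent 𝓘(ℝ, EM) x))
    (q : Assoc B 𝓕) : Submodule ℂ (CTangent (𝓘(ℝ, EM).prod 𝓘(ℝ, EF)) q) :=
  Submodule.span ℂ {Z | C.HorizontalOver p 𝓕 q Z} ⊔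
    Submodule.span ℂ {Z | VerticalAntiholomorphic B 𝓕 q Z}

end Connections

end Twistor

end

/-! Write α for the connection form on P, and π : Q → M for the bundle Q = P ×_G F. In a chart of Q
given by a local section of P, with coordinates (x, z) in `EM × EF`, the horizontal vectors are the
kernel of ϑ = dz + a_z(A_x dx) (`vform`). Here A is α pulled back by the section, and a_z is the
infinitesimal action of the Lie algebra at z. Let ϑ^ℂ be the ℂ-linear extension of ϑ with values in
the complex vector space `EF` (`cvform`). On a vertical vector ξ + i Jξ it equals ξ + i·iξ = 0, so
its kernel is the complexified horizontal space plus the vertical vectors of type (0,1). Hence 𝒢^p =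
{Z : dπ Z ∈ p and ϑ^ℂ Z = 0} (`mem_inducedDistribution_iff`), and integrability splits into two
conditions on [X, Y].

Vertical condition. As ϑ^ℂ annihilates X and Y, ϑ^ℂ[X, Y] = -dϑ^ℂ(X, Y) (`form_bracket`). The action
is holomorphic, so dϑ(ζ, ·) is complex linear in vertical ζ, and the (0,1) parts of X and Y
contribute nothing. Under u ↦ [u, f] the form ϑ pulls back to n_u ∘ α, with n_u the map `gauge`. So
on horizontal vectors dϑ is n_u applied to the curvature (`extd_of_pullback`,
`extd_vform_horizontal`). Finally n_u(c) = 0 exactly when the vector field of c on F vanishes at f,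
that is, when c preserves the subspace f (`gauge_eq_zero_iff`, `md_orbit_eq_zero_iff`). Thus ϑ^ℂ[X,
Y] = 0 is the curvature condition for dπ X and dπ Y (`cvform_complexBracket`).

Horizontal condition. The x-component of [X, Y] is the bracket of the restrictions to a slice z =
const, which are local sections of p, plus derivatives in the direction of z, which stay in the
fixed subspace p_x. So integrability of p suffices (`cdiff_proj_complexBracket_mem`). Conversely,
horizontal lifts of sections of p are sections of 𝒢^p whose brackets project to the brackets
downstairs. Since every vector of p extends to a global section of p
(`SmoothSection.exists_section`), integrability of 𝒢^p yields both that of p and the curvature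
condition on all pairs of vectors of p. -/

open scoped Topology

set_option linter.unusedSectionVars false

noncomputable section

namespace Twistor

/-! ### Differentials as maps of model spaces, and vector fields in the preferred chart. -/

section MD

variable {E H N E' H' N' E'' H'' N'' : Type*}
  [NormedAddCommGroup E] [NormedSpace ℝ E] [TopologicalSpace H]
  [NormedAddCommGroup E'] [NormedSpace ℝ E'] [TopologicalSpace H']
  [NormedAddCommGroup E''] [NormedSpace ℝ E''] [TopologicalSpace H'']
  [TopologicalSpace N] [ChartedSpace H N]
  [TopologicalSpace N'] [ChartedSpace H' N']
  [TopologicalSpace N''] [ChartedSpace H'' N'']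

/-- The differential of a map, as a map between the model spaces. -/
def md (I : ModelWithCorners ℝ E H) (I' : ModelWithCorners ℝ E' H') (f : N → N') (x : N) :
    E →L[ℝ] E' := mfderiv I I' f x

variable {I : ModelWithCorners ℝ E H} {I' : ModelWithCorners ℝ E' H'}
  {I'' : ModelWithCorners ℝ E'' H''}

theorem md_comp {g : N' → N''} {f : N → N'} {x : N} (hg : MDifferentiableAt I' I'' g (f x))
    (hf : MDifferentiableAt I I' f x) :
    md I I'' (fun y => g (f y)) x = (md I' I'' g (f x)).comp (md I I' f x) :=
  mfderiv_comp x hg hf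

theorem md_comp_apply {g : N' → N''} {f : N → N'} {x : N}
    (hg : MDifferentiableAt I' I'' g (f x)) (hf : MDifferentiableAt I I' f x) (v : E) :
    md I I'' (fun y => g (f y)) x v = md I' I'' g (f x) (md I I' f x v) := by
  rw [md_comp hg hf]; rfl

theorem md_congr {f g : N → N'} {x : N} (h : f =ᶠ[𝓝 x] g) : md I I' f x = md I I' g x :=
  h.mfderiv_eq

theorem md_id (x : N) : md I I (fun y => y) x = ContinuousLinearMap.id ℝ E :=
  mfderiv_id

theorem md_const (c : N') (x : N) : md I I' (fun _ : N => c) x = 0 :=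
  mfderiv_const

theorem md_eq_fderiv (f : E → E') (x : E) : md 𝓘(ℝ, E) 𝓘(ℝ, E') f x = fderiv ℝ f x :=
  mfderiv_eq_fderiv

theorem md_prodMk {f : N → N'} {g : N → N''} {x : N} (hf : MDifferentiableAt I I' f x)
    (hg : MDifferentiableAt I I'' g x) :
    md I (I'.prod I'') (fun y => (f y, g y)) x = (md I I' f x).prod (md I I'' g x) :=
  mfderiv_prodMk hf hg

theorem md_two {f : N' × N'' → N} {a : N'} {b : N''}
    (hf : MDifferentiableAt (I'.prod I'') I f (a, b)) (v : E') (w : E'') :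
    md (I'.prod I'') I f (a, b) (v, w)
      = md I' I (fun y => f (y, b)) a v + md I'' I (fun y => f (a, y)) b w :=
  mfderiv_prod_eq_add_apply hf

variable [I.Boundaryless] [IsManifold I ∞ N] (q₀ : N)

theorem contMDiffOn_chart_symm :
    ContMDiffOn 𝓘(ℝ, E) I ∞ (extChartAt I q₀).symm (extChartAt I q₀).target :=
  contMDiffOn_extChartAt_symm q₀

theorem contMDiffAt_chart_symm {y : E} (hy : y ∈ (extChartAt I q₀).target) :
    ContMDiffAt 𝓘(ℝ, E) I ∞ (extChartAt I q₀).symm y :=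
  (contMDiffOn_chart_symm q₀).contMDiffAt ((isOpen_extChartAt_target q₀).mem_nhds hy)

theorem contMDiffAt_chart {x : N} (hx : x ∈ (extChartAt I q₀).source) :
    ContMDiffAt I 𝓘(ℝ, E) ∞ (extChartAt I q₀) x :=
  contMDiffAt_extChartAt' (by simpa using hx)

theorem md_symm_chart {y : E} (hy : y ∈ (extChartAt I q₀).target) (v : E) :
    md 𝓘(ℝ, E) I (extChartAt I q₀).symm y
      (md I 𝓘(ℝ, E) (extChartAt I q₀) ((extChartAt I q₀).symm y) v) = v := by
  have h := mfderivWithin_extChartAt_symm_comp_mfderiv_extChartAt (I := I) hy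
  rw [I.range_eq_univ, mfderivWithin_univ] at h
  exact congrArg (fun L : E →L[ℝ] E => L v) h

theorem md_chart_symm {y : E} (hy : y ∈ (extChartAt I q₀).target) (v : E) :
    md I 𝓘(ℝ, E) (extChartAt I q₀) ((extChartAt I q₀).symm y)
      (md 𝓘(ℝ, E) I (extChartAt I q₀).symm y v) = v := by
  have h := mfderiv_extChartAt_comp_mfderivWithin_extChartAt_symm (I := I) hy
  rw [I.range_eq_univ, mfderivWithin_univ] at h
  exact congrArg (fun L : E →L[ℝ] E => L v) h

/-- The tangent space at `q₀` is the model space seen through the preferred chart at `q₀`, so the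
chart is tangent to the identity at its centre. This is why pointwise computations are made in the
chart centred at the point in question. -/
theorem md_chart_self (v : E) : md I 𝓘(ℝ, E) (extChartAt I q₀) q₀ v = v := 
  congrArg (fun L : E →L[ℝ] E => L v) (mfderiv_extChartAt_self (I := I) (x := q₀))

theorem md_symm_self (v : E) : md 𝓘(ℝ, E) I (extChartAt I q₀).symm (extChartAt I q₀ q₀) v = v := by
  have h := md_symm_chart (I := I) q₀ (mem_extChartAt_target q₀) v
  rw [extChartAt_to_inv, md_chart_self] at h
  exact h

/-- A vector field in the preferred chart at `q₀`. -/
def hat (I : ModelWithCorners ℝ E H) (q₀ : N) (X : ∀ q : N, TangentSpace I q) (y : E) : E :=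
  md I 𝓘(ℝ, E) (extChartAt I q₀) ((extChartAt I q₀).symm y) (X ((extChartAt I q₀).symm y))

theorem md_hat (X : ∀ q : N, TangentSpace I q) {y : E} (hy : y ∈ (extChartAt I q₀).target) :
    md 𝓘(ℝ, E) I (extChartAt I q₀).symm y (hat I q₀ X y) = X ((extChartAt I q₀).symm y) :=
  md_symm_chart q₀ hy _

theorem hat_eq {X : ∀ q : N, TangentSpace I q} {y v : E} (hy : y ∈ (extChartAt I q₀).target)
    (h : X ((extChartAt I q₀).symm y) = md 𝓘(ℝ, E) I (extChartAt I q₀).symm y v) :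
    hat I q₀ X y = v := by
  unfold hat
  erw [h]
  exact md_chart_symm q₀ hy v

theorem hat_eq_pullback (X : ∀ q : N, TangentSpace I q) {y : E}
    (hy : y ∈ (extChartAt I q₀).target) :
    hat I q₀ X y
      = VectorField.mpullbackWithin 𝓘(ℝ, E) I (extChartAt I q₀).symm X (range I) y := by
  have h := isInvertible_mfderivWithin_extChartAt_symm (I := I) hy
  rw [VectorField.mpullbackWithin_apply]
  apply h.injective
  rw [ContinuousLinearMap.IsInvertible.self_apply_inverse h]
  rw [I.range_eq_univ, mfderivWithin_univ]
  exact md_hat q₀ X hy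

/-- The bracket on a manifold is the bracket of the pulled back fields in the chart, so brackets
reduce to derivatives in a vector space. -/
theorem mlieBracket_eq (X Y : ∀ q : N, TangentSpace I q) :
    VectorField.mlieBracket I X Y q₀
      = VectorField.lieBracket ℝ (hat I q₀ X) (hat I q₀ Y) (extChartAt I q₀ q₀) := by
  have key : ∀ X : ∀ q : N, TangentSpace I q, 
      VectorField.mpullbackWithin 𝓘(ℝ, E) I (extChartAt I q₀).symm X (range I) 
        =ᶠ[𝓝 (extChartAt I q₀ q₀)] hat I q₀ X := by
    intro X
    filter_upwards [extChartAt_target_mem_nhds (I := I) q₀] with y hy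
    exact (hat_eq_pullback q₀ X hy).symm
  -- The bracket is carried back by the inverse of the chart's differential at its centre, which is
  -- the identity.
  have hid : ∀ v : E, (ContinuousLinearMap.id ℝ E).inverse v = v := by
    intro v
    rw [ContinuousLinearMap.inverse_id]
    rfl
  rw [VectorField.mlieBracket, VectorField.mlieBracketWithin_apply, mfderiv_extChartAt_self]
  refine (hid _).trans ?_
  rw [preimage_univ, univ_inter]
  refine Eq.trans ?_ ((key X).lieBracket_vectorField_eq (key Y))
  simp only [I.range_eq_univ]
  exact congrFun VectorField.lieBracketWithin_univ _

end MD

/-! ### Real and imaginary parts in complexified vector spaces. -/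

section ComplexLinear

variable {V W : Type*} [AddCommGroup V] [Module ℝ V] [AddCommGroup W] [Module ℝ W]

theorem rePart_tmul (c : ℂ) (v : V) : rePart (c ⊗ₜ[ℝ] v) = c.re • v := by simp [rePart]

theorem imPart_tmul (c : ℂ) (v : V) : imPart (c ⊗ₜ[ℝ] v) = c.im • v := by simp [imPart]

@[simp] theorem rePart_toC (v w : V) : rePart (toC v w) = v := by
  simp [toC, rePart_tmul]

@[simp] theorem imPart_toC (v w : V) : imPart (toC v w) = w := by
  simp [toC, imPart_tmul]

theorem toC_re_im (z : ℂ ⊗[ℝ] V) : toC (rePart z) (imPart z) = z := by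
  induction z with
  | zero => simp [toC]
  | tmul c v =>
    rw [rePart_tmul, imPart_tmul, toC, ← TensorProduct.smul_tmul, ← TensorProduct.smul_tmul,
      ← TensorProduct.add_tmul]
    congr 1
    apply Complex.ext <;> simp
  | add x y hx hy =>
    rw [map_add, map_add]
    nth_rw 3 [← hx]
    nth_rw 3 [← hy]
    simp only [toC, TensorProduct.tmul_add]
    abel

theorem complex_ext {z w : ℂ ⊗[ℝ] V} (h1 : rePart z = rePart w) (h2 : imPart z = imPart w) :
    z = w := by
  rw [← toC_re_im z, h1, h2, toC_re_im]

theorem rePart_smul (c : ℂ) (z : ℂ ⊗[ℝ] V) :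
    rePart (c • z) = c.re • rePart z - c.im • imPart z := by
  induction z with
  | zero => simp
  | tmul d v =>
    rw [TensorProduct.smul_tmul', rePart_tmul, rePart_tmul, imPart_tmul, smul_smul, smul_smul,
      ← sub_smul]
    simp
  | add x y hx hy =>
    rw [smul_add, map_add, map_add, map_add, hx, hy]
    module

theorem imPart_smul (c : ℂ) (z : ℂ ⊗[ℝ] V) :
    imPart (c • z) = c.re • imPart z + c.im • rePart z := by
  induction z with
  | zero => simp
  | tmul d v =>
    rw [TensorProduct.smul_tmul', rePart_tmul, imPart_tmul, imPart_tmul, smul_smul, smul_smul,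
      ← add_smul]
    simp
  | add x y hx hy =>
    rw [smul_add, map_add, map_add, map_add, hx, hy]
    module

theorem rePart_baseChange (L : V →ₗ[ℝ] W) (z : ℂ ⊗[ℝ] V) :
    rePart (L.baseChange ℂ z) = L (rePart z) := by
  induction z with
  | zero => simp
  | tmul d v => simp [rePart_tmul]
  | add x y hx hy => simp only [map_add, hx, hy]

theorem imPart_baseChange (L : V →ₗ[ℝ] W) (z : ℂ ⊗[ℝ] V) :
    imPart (L.baseChange ℂ z) = L (imPart z) := by
  induction z with
  | zero => simp
  | tmul d v => simp [imPart_tmul]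
  | add x y hx hy => simp only [map_add, hx, hy]

theorem smul_toC (c : ℂ) (v w : V) :
    c • toC v w = toC (c.re • v - c.im • w) (c.re • w + c.im • v) :=
  complex_ext (by simp [rePart_smul]) (by simp [imPart_smul])

variable {U : Type*} [AddCommGroup U] [Module ℂ U] [Module ℝ U] [IsScalarTower ℝ ℂ U]

/-- The `ℂ`-linear extension of an `ℝ`-linear map with values in a complex vector space. -/
def cext (L : V →ₗ[ℝ] U) : ℂ ⊗[ℝ] V →ₗ[ℂ] U where
  toFun z := L (rePart z) + Complex.I • L (imPart z)
  map_add' z w := by simp only [map_add, smul_add]; abel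
  map_smul' c z := by
    have hc : ∀ u : U, c • u = c.re • u + c.im • Complex.I • u := by
      intro u
      rw [← smul_assoc, ← algebraMap_smul ℂ c.re u, ← add_smul]
      congr 1
      apply Complex.ext <;> simp
    have hI : ∀ u : U, Complex.I • Complex.I • u = -u := by
      intro u
      rw [smul_smul, Complex.I_mul_I, neg_one_smul]
    have hr : ∀ (a : ℝ) (u : U), Complex.I • a • u = a • Complex.I • u := fun a u =>
      smul_comm _ _ _
    simp only [rePart_smul, imPart_smul, map_add, map_sub, map_smul, RingHom.id_apply]
    rw [hc]
    simp only [smul_add, hI, hr]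
    module

theorem cext_apply (L : V →ₗ[ℝ] U) (z : ℂ ⊗[ℝ] V) :
    cext L z = L (rePart z) + Complex.I • L (imPart z) := rfl

end ComplexLinear

/-! ### Brackets of complex vector fields in the kernel of a one-form. -/

section Forms

variable {E : Type*} [NormedAddCommGroup E] [NormedSpace ℝ E]
  {U : Type*} [NormedAddCommGroup U] [NormedSpace ℂ U]

/-- The exterior derivative of a vector-valued `1`-form on a vector space. -/
def extd (Φ : E → E →L[ℝ] U) (y v w : E) : U := fderiv ℝ Φ y v w - fderiv ℝ Φ y w v

/-- `Φ([X, Y]) = -dΦ(X, Y)` if `X` and `Y` are annihilated by `Φ`. -/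
theorem form_bracket {Φ : E → E →L[ℝ] U} {y : E} (hΦ : DifferentiableAt ℝ Φ y)
    {X₁ X₂ Y₁ Y₂ : E → E} (hX₁ : DifferentiableAt ℝ X₁ y) (hX₂ : DifferentiableAt ℝ X₂ y)
    (hY₁ : DifferentiableAt ℝ Y₁ y) (hY₂ : DifferentiableAt ℝ Y₂ y)
    (hX : ∀ᶠ x in 𝓝 y, Φ x (X₁ x) + Complex.I • Φ x (X₂ x) = 0)
    (hY : ∀ᶠ x in 𝓝 y, Φ x (Y₁ x) + Complex.I • Φ x (Y₂ x) = 0) :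
    Φ y (VectorField.lieBracket ℝ X₁ Y₁ y - VectorField.lieBracket ℝ X₂ Y₂ y)
      + Complex.I • Φ y (VectorField.lieBracket ℝ X₁ Y₂ y + VectorField.lieBracket ℝ X₂ Y₁ y)
      = -((extd Φ y (X₁ y) (Y₁ y) - extd Φ y (X₂ y) (Y₂ y))
          + Complex.I • (extd Φ y (X₁ y) (Y₂ y) + extd Φ y (X₂ y) (Y₁ y))) := by
  -- The derivative in direction `v` of the equation `Φ(Z₁) + iΦ(Z₂) = 0`, which holds near `y`.
  have key : ∀ {Z₁ Z₂ : E → E}, DifferentiableAt ℝ Z₁ y → DifferentiableAt ℝ Z₂ y →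
      (∀ᶠ x in 𝓝 y, Φ x (Z₁ x) + Complex.I • Φ x (Z₂ x) = 0) → ∀ v : E,
      (fderiv ℝ Φ y v (Z₁ y) + Φ y (fderiv ℝ Z₁ y v))
        + Complex.I • (fderiv ℝ Φ y v (Z₂ y) + Φ y (fderiv ℝ Z₂ y v)) = 0 := by
    intro Z₁ Z₂ h1 h2 h v
    have h3 := ((hΦ.hasFDerivAt.clm_apply h1.hasFDerivAt).add
      ((hΦ.hasFDerivAt.clm_apply h2.hasFDerivAt).const_smul Complex.I))
    have h4 : HasFDerivAt (fun x => Φ x (Z₁ x) + Complex.I • Φ x (Z₂ x)) (0 : E →L[ℝ] U) y :=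
      (hasFDerivAt_const (0 : U) y).congr_of_eventuallyEq h
    have h5 := congrArg (fun L : E →L[ℝ] U => L v) (h3.unique h4)
    simp at h5
    rw [← h5]
    module
  have hI : ∀ u : U, Complex.I • Complex.I • u = -u := by
    intro u
    rw [smul_smul, Complex.I_mul_I, neg_one_smul]
  -- The equation of X is differentiated along Y₁ + iY₂, and that of Y along X₁ + iX₂. In the
  -- difference the derivatives of the fields form the bracket, and those of `Φ` form its exterior
  -- derivative.
  have e1 := key hX₁ hX₂ hX (Y₁ y)
  have e2 := congrArg (fun u : U => Complex.I • u) (key hX₁ hX₂ hX (Y₂ y))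
  have e3 := key hY₁ hY₂ hY (X₁ y)
  have e4 := congrArg (fun u : U => Complex.I • u) (key hY₁ hY₂ hY (X₂ y))
  simp only [smul_add, hI, smul_zero] at e1 e2 e3 e4
  simp only [VectorField.lieBracket_eq, extd, map_sub, map_add, smul_add, smul_sub]
  linear_combination (norm := module) e3 + e4 - e1 - e2

end Forms

/-! ### Real differentials of holomorphic maps. -/

section Holomorphic

variable {E₁ E₂ : Type*} [NormedAddCommGroup E₁] [NormedSpace ℂ E₁]
  [NormedAddCommGroup E₂] [NormedSpace ℂ E₂]
  {M₁ M₂ : Type*} [TopologicalSpace M₁] [ChartedSpace E₁ M₁]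
  [TopologicalSpace M₂] [ChartedSpace E₂ M₂]

theorem contMDiffAt_real {f : M₁ → M₂} {x : M₁}
    (hf : ContMDiffAt 𝓘(ℂ, E₁) 𝓘(ℂ, E₂) ω f x) : ContMDiffAt 𝓘(ℝ, E₁) 𝓘(ℝ, E₂) ∞ f x := by
  have h1 := contMDiffAt_iff.1 hf
  exact contMDiffAt_iff.2 ⟨h1.1, (h1.2.restrict_scalars ℝ).of_le le_top⟩

theorem md_eq_mfderiv_complex {f : M₁ → M₂} {x : M₁}
    (hf : MDifferentiableAt 𝓘(ℂ, E₁) 𝓘(ℂ, E₂) f x) (v : E₁) :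
    md 𝓘(ℝ, E₁) 𝓘(ℝ, E₂) f x v = mfderiv 𝓘(ℂ, E₁) 𝓘(ℂ, E₂) f x v := by
  have h1 := hf.hasMFDerivAt
  let L : E₁ →L[ℂ] E₂ := mfderiv 𝓘(ℂ, E₁) 𝓘(ℂ, E₂) f x
  let L' : E₁ →L[ℝ] E₂ := L.restrictScalars ℝ
  have h2 : HasMFDerivAt 𝓘(ℝ, E₁) 𝓘(ℝ, E₂) f x L' :=
    ⟨h1.1, HasFDerivWithinAt.restrictScalars ℝ (f' := L) h1.2⟩
  exact congrArg (fun L : E₁ →L[ℝ] E₂ => L v) h2.mfderiv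

/-- Holomorphy of the actions and charts is used through this statement: the real differentials
commute with multiplication by i. -/
theorem md_smul_complex {f : M₁ → M₂} {x : M₁}
    (hf : MDifferentiableAt 𝓘(ℂ, E₁) 𝓘(ℂ, E₂) f x) (c : ℂ) (v : E₁) :
    md 𝓘(ℝ, E₁) 𝓘(ℝ, E₂) f x (c • v) = c • md 𝓘(ℝ, E₁) 𝓘(ℝ, E₂) f x v := by
  rw [md_eq_mfderiv_complex hf, md_eq_mfderiv_complex hf]
  exact map_smul (show E₁ →L[ℂ] E₂ from mfderiv 𝓘(ℂ, E₁) 𝓘(ℂ, E₂) f x) c v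

end Holomorphic

/-! ### Charts of the associated bundle in terms of representatives. -/

section Local

variable {EM : Type*} [NormedAddCommGroup EM] [NormedSpace ℝ EM]
  {M : Type*} [TopologicalSpace M] [ChartedSpace EM M] [IsManifold 𝓘(ℝ, EM) ∞ M]
  {EG : Type*} [NormedAddCommGroup EG] [NormedSpace ℂ EG]
  {G : Type*} [Group G] [TopologicalSpace G] [ChartedSpace EG G] [LieGroup 𝓘(ℂ, EG) ω G]
  {EP : Type*} [NormedAddCommGroup EP] [NormedSpace ℝ EP]
  {P : Type*} [TopologicalSpace P] [ChartedSpace EP P] [IsManifold 𝓘(ℝ, EP) ∞ P]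
  {EF : Type*} [NormedAddCommGroup EF] [NormedSpace ℂ EF]
  {F : Type*} [TopologicalSpace F] [ChartedSpace EF F] [IsManifold 𝓘(ℂ, EF) ω F]
  {m r : ℕ} {Γ : ComplexLieSubgroup m EG G}

variable {B : PrincipalBundle EM M EG G EP P} {𝓕 : HomogeneousSubmanifold Γ r EF F}

namespace Assoc

/-- The local section of `P` defining the preferred chart at `q₀`. -/
def sect (q₀ : Assoc B 𝓕) : LocalSection B.toPrincipalData EM EG EP :=
  (B.locally_trivial (proj q₀)).choose

/-- The point of the fibre `F` defining the preferred chart at `q₀`. -/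
def fibPt (q₀ : Assoc B 𝓕) : F := (chart (𝓕 := 𝓕) (sect q₀) q₀).2

/-- The inverse of the preferred chart at `q₀`. -/
theorem chart_symm_eq (q₀ : Assoc B 𝓕) (y : EM × EF) :
    (extChartAt (𝓘(ℝ, EM).prod 𝓘(ℝ, EF)) q₀).symm y
      = mk B 𝓕 ((sect q₀).sec ((extChartAt 𝓘(ℝ, EM) (proj q₀)).symm y.1))
          ((extChartAt 𝓘(ℝ, EF) (fibPt q₀)).symm y.2) := rfl

/-- The preferred chart at `q₀`, in terms of representatives. -/
def kap (q₀ : Assoc B 𝓕) (z : P × F) : EM × EF :=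
  (extChartAt 𝓘(ℝ, EM) (proj q₀) (B.proj z.1),
    extChartAt 𝓘(ℝ, EF) (fibPt q₀) (𝓕.smul ((sect q₀).coord z.1) z.2))

/-- The chart is defined through `Quotient.out`. By `smul_coord_out` its fibre component is the same
for every representative, so its domain can be read off from any `(u, f)`. -/
theorem mem_source_iff (q₀ : Assoc B 𝓕) {u : P} {f : F} :
    mk B 𝓕 u f ∈ (extChartAt (𝓘(ℝ, EM).prod 𝓘(ℝ, EF)) q₀).source ↔
      B.proj u ∈ (sect q₀).domain ∧ B.proj u ∈ (extChartAt 𝓘(ℝ, EM) (proj q₀)).source ∧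
      𝓕.smul ((sect q₀).coord u) f ∈ (extChartAt 𝓘(ℝ, EF) (fibPt q₀)).source := by
  rw [extChartAt_source, extChartAt_source, extChartAt_source]
  have h : mk B 𝓕 u f ∈ (chartAt (ModelProd EM EF) q₀).source ↔
      B.proj u ∈ (sect q₀).domain ∧ B.proj u ∈ (chartAt EM (proj q₀)).source ∧
      𝓕.smul ((sect q₀).coord (Quotient.out (mk B 𝓕 u f)).1) (Quotient.out (mk B 𝓕 u f)).2
        ∈ (chartAt EF (fibPt q₀)).source := Iff.rfl
  rw [h]
  refine and_congr_right fun hu => ?_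
  rw [smul_coord_out _ hu]

theorem chart_mk (q₀ : Assoc B 𝓕) {u : P} (hu : B.proj u ∈ (sect q₀).domain) (f : F) :
    extChartAt (𝓘(ℝ, EM).prod 𝓘(ℝ, EF)) q₀ (mk B 𝓕 u f) = kap q₀ (u, f) := by
  refine Prod.ext rfl ?_
  change extChartAt 𝓘(ℝ, EF) (fibPt q₀) (𝓕.smul ((sect q₀).coord (Quotient.out (mk B 𝓕 u f)).1)
    (Quotient.out (mk B 𝓕 u f)).2) = _
  rw [smul_coord_out _ hu]
  rfl

theorem mem_target_iff (q₀ : Assoc B 𝓕) {y : EM × EF} :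
    y ∈ (extChartAt (𝓘(ℝ, EM).prod 𝓘(ℝ, EF)) q₀).target ↔
      y.1 ∈ (extChartAt 𝓘(ℝ, EM) (proj q₀)).target ∧
      (extChartAt 𝓘(ℝ, EM) (proj q₀)).symm y.1 ∈ (sect q₀).domain ∧
      y.2 ∈ (extChartAt 𝓘(ℝ, EF) (fibPt q₀)).target := by
  rw [extChartAt_target, extChartAt_target, extChartAt_target]
  constructor
  · rintro ⟨⟨⟨h1, h2⟩, h3, -⟩, -⟩
    exact ⟨⟨h1, y.1, rfl⟩, h3, h2, y.2, rfl⟩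
  · rintro ⟨⟨h1, -⟩, h3, h2, -⟩
    exact ⟨⟨⟨h1, h2⟩, h3, mem_univ _⟩, y, rfl⟩

theorem isManifold_fibre (_ : HomogeneousSubmanifold Γ r EF F) : IsManifold 𝓘(ℝ, EF) ∞ F :=
  isManifold_real ‹_›

theorem contMDiffAt_kap (q₀ : Assoc B 𝓕) {u : P} {f : F}
    (h : mk B 𝓕 u f ∈ (extChartAt (𝓘(ℝ, EM).prod 𝓘(ℝ, EF)) q₀).source) :
    ContMDiffAt (𝓘(ℝ, EP).prod 𝓘(ℝ, EF)) 𝓘(ℝ, EM × EF) ∞ (kap q₀) (u, f) := by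
  have hF : IsManifold 𝓘(ℝ, EF) ∞ F := isManifold_fibre 𝓕
  obtain ⟨h1, h2, h3⟩ := (mem_source_iff q₀).1 h
  refine ContMDiffAt.prodMk_space ?_ ?_
  · have := contMDiffAt_chart (I := 𝓘(ℝ, EM)) (proj q₀) h2
    exact this.comp (u, f) ((B.contMDiff_proj u).comp (u, f) contMDiffAt_fst)
  · have h4 := contMDiffAt_chart (I := 𝓘(ℝ, EF)) (fibPt q₀) h3
    have h5 : ContMDiffAt 𝓘(ℝ, EP) 𝓘(ℝ, EG) ∞ (sect q₀).coord u :=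
      (sect q₀).contMDiffOn_coord.contMDiffAt
        (((sect q₀).isOpen_domain.preimage B.contMDiff_proj.continuous).mem_nhds h1)
    have h6 := contMDiff_real_of_prod 𝓕.contMDiff_smul ((sect q₀).coord u, f)
    exact h4.comp (u, f) (h6.comp (u, f)
      ((h5.comp (u, f) contMDiffAt_fst).prodMk contMDiffAt_snd))

theorem chart_symm_kap (q₀ : Assoc B 𝓕) {u : P} {f : F}
    (h : mk B 𝓕 u f ∈ (extChartAt (𝓘(ℝ, EM).prod 𝓘(ℝ, EF)) q₀).source) :
    (extChartAt (𝓘(ℝ, EM).prod 𝓘(ℝ, EF)) q₀).symm (kap q₀ (u, f)) = mk B 𝓕 u f := by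
  rw [← chart_mk q₀ ((mem_source_iff q₀).1 h).1]
  exact (extChartAt _ q₀).left_inv h

theorem kap_mem_target (q₀ : Assoc B 𝓕) {u : P} {f : F}
    (h : mk B 𝓕 u f ∈ (extChartAt (𝓘(ℝ, EM).prod 𝓘(ℝ, EF)) q₀).source) :
    kap q₀ (u, f) ∈ (extChartAt (𝓘(ℝ, EM).prod 𝓘(ℝ, EF)) q₀).target := by
  rw [← chart_mk q₀ ((mem_source_iff q₀).1 h).1]
  exact (extChartAt _ q₀).map_source h

theorem eventually_mk_mem (q₀ : Assoc B 𝓕) {u : P} {f : F}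
    (h : mk B 𝓕 u f ∈ (extChartAt (𝓘(ℝ, EM).prod 𝓘(ℝ, EF)) q₀).source) :
    ∀ᶠ z : P × F in 𝓝 (u, f),
      mk B 𝓕 z.1 z.2 ∈ (extChartAt (𝓘(ℝ, EM).prod 𝓘(ℝ, EF)) q₀).source := by
  obtain ⟨h1, h2, h3⟩ := (mem_source_iff q₀).1 h
  have h5 : ContMDiffAt 𝓘(ℝ, EP) 𝓘(ℝ, EG) ∞ (sect q₀).coord u :=
    (sect q₀).contMDiffOn_coord.contMDiffAt
      (((sect q₀).isOpen_domain.preimage B.contMDiff_proj.continuous).mem_nhds h1)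
  have h6 := contMDiff_real_of_prod 𝓕.contMDiff_smul ((sect q₀).coord u, f)
  have h7 : ContinuousAt (fun z : P × F => 𝓕.smul ((sect q₀).coord z.1) z.2) (u, f) :=
    ContinuousAt.comp (f := fun z : P × F => ((sect q₀).coord z.1, z.2)) (x := (u, f))
      h6.continuousAt
      ((h5.continuousAt.comp (x := (u, f)) continuousAt_fst).prodMk continuousAt_snd)
  have h8 : ContinuousAt (fun z : P × F => B.proj z.1) (u, f) :=
    (B.contMDiff_proj.continuous.comp continuous_fst).continuousAt
  filter_upwards [h8.eventually ((sect q₀).isOpen_domain.mem_nhds h1),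
    h8.eventually ((isOpen_extChartAt_source (I := 𝓘(ℝ, EM)) (proj q₀)).mem_nhds h2),
    h7.eventually ((isOpen_extChartAt_source (I := 𝓘(ℝ, EF)) (fibPt q₀)).mem_nhds h3)]
    with z a b c
  exact (mem_source_iff q₀).2 ⟨a, b, c⟩

/-- Near `(u, f)` the quotient map is the inverse chart composed with the smooth map `kap`. -/
theorem contMDiff_mk : ContMDiff (𝓘(ℝ, EP).prod 𝓘(ℝ, EF)) (𝓘(ℝ, EM).prod 𝓘(ℝ, EF)) ∞
    (fun z : P × F => mk B 𝓕 z.1 z.2) := by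
  rintro ⟨u, f⟩
  have h : mk B 𝓕 u f ∈ (extChartAt (𝓘(ℝ, EM).prod 𝓘(ℝ, EF)) (mk B 𝓕 u f)).source :=
    mem_extChartAt_source _
  have h1 := (contMDiffAt_chart_symm (I := 𝓘(ℝ, EM).prod 𝓘(ℝ, EF)) (mk B 𝓕 u f)
    (kap_mem_target _ h)).comp (u, f) (contMDiffAt_kap _ h)
  refine h1.congr_of_eventuallyEq ?_
  filter_upwards [eventually_mk_mem _ h] with z hz
  exact (chart_symm_kap (mk B 𝓕 u f) hz).symm

end Assoc

end Local

/-- Variant of `md_prodMk` in which the target carries the model of the vector space `E' × E''`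
instead of the product of the two models; these are equal, but only after rewriting. -/
theorem md_prodMk_space {E H N E' E'' : Type*}
    [NormedAddCommGroup E] [NormedSpace ℝ E] [TopologicalSpace H]
    [NormedAddCommGroup E'] [NormedSpace ℝ E'] [NormedAddCommGroup E''] [NormedSpace ℝ E'']
    [TopologicalSpace N] [ChartedSpace H N] {I : ModelWithCorners ℝ E H}
    {f : N → E'} {g : N → E''} {x : N} (hf : MDifferentiableAt I 𝓘(ℝ, E') f x)
    (hg : MDifferentiableAt I 𝓘(ℝ, E'') g x) :
    md I 𝓘(ℝ, E' × E'') (fun y => (f y, g y)) x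
      = (md I 𝓘(ℝ, E') f x).prod (md I 𝓘(ℝ, E'') g x) := by
  have h := md_prodMk hf hg
  rw [← modelWithCornersSelf_prod] at h
  rw [← h, ← chartedSpaceSelf_prod]

/-! ### The connection form and the vertical part in a local trivialization. -/

section LocalForm

variable {EM : Type*} [NormedAddCommGroup EM] [NormedSpace ℝ EM]
  {M : Type*} [TopologicalSpace M] [ChartedSpace EM M] [IsManifold 𝓘(ℝ, EM) ∞ M]
  {EG : Type*} [NormedAddCommGroup EG] [NormedSpace ℂ EG]
  {G : Type*} [Group G] [TopologicalSpace G] [ChartedSpace EG G] [LieGroup 𝓘(ℂ, EG) ω G]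
  {EP : Type*} [NormedAddCommGroup EP] [NormedSpace ℝ EP]
  {P : Type*} [TopologicalSpace P] [ChartedSpace EP P] [IsManifold 𝓘(ℝ, EP) ∞ P]
  {EF : Type*} [NormedAddCommGroup EF] [NormedSpace ℂ EF]
  {F : Type*} [TopologicalSpace F] [ChartedSpace EF F] [IsManifold 𝓘(ℂ, EF) ω F]
  {m r : ℕ} {Γ : ComplexLieSubgroup m EG G}

variable {B : PrincipalBundle EM M EG G EP P} {𝓕 : HomogeneousSubmanifold Γ r EF F}

section Smoothness

theorem contMDiff_mul_real : ContMDiff (𝓘(ℝ, EG).prod 𝓘(ℝ, EG)) 𝓘(ℝ, EG) ∞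
    (fun z : G × G => z.1 * z.2) :=
  contMDiff_real_of_prod (contMDiff_mul 𝓘(ℂ, EG) ω)

theorem contMDiff_mul_left_real (g : G) : ContMDiff 𝓘(ℝ, EG) 𝓘(ℝ, EG) ∞ (fun h : G => g * h) :=
  contMDiff_mul_real.comp (contMDiff_const.prodMk contMDiff_id)

theorem contMDiff_mul_right_real (g : G) : ContMDiff 𝓘(ℝ, EG) 𝓘(ℝ, EG) ∞ (fun h : G => h * g) :=
  contMDiff_mul_real.comp (contMDiff_id.prodMk contMDiff_const)

theorem contMDiff_conj_real (g : G) :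
    ContMDiff 𝓘(ℝ, EG) 𝓘(ℝ, EG) ∞ (fun h : G => g⁻¹ * h * g) :=
  (contMDiff_mul_right_real g).comp (contMDiff_mul_left_real g⁻¹)

theorem HomogeneousSubmanifold.contMDiff_smul_real (𝓕 : HomogeneousSubmanifold Γ r EF F) :
    ContMDiff (𝓘(ℝ, EG).prod 𝓘(ℝ, EF)) 𝓘(ℝ, EF) ∞ (fun z : G × F => 𝓕.smul z.1 z.2) :=
  contMDiff_real_of_prod 𝓕.contMDiff_smul

theorem HomogeneousSubmanifold.contMDiff_orbit_real (𝓕 : HomogeneousSubmanifold Γ r EF F) (f : F) :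
    ContMDiff 𝓘(ℝ, EG) 𝓘(ℝ, EF) ∞ (fun g : G => 𝓕.smul g f) :=
  𝓕.contMDiff_smul_real.comp (contMDiff_id.prodMk contMDiff_const)

theorem HomogeneousSubmanifold.contMDiff_translate_real (𝓕 : HomogeneousSubmanifold Γ r EF F)
    (g : G) : ContMDiff 𝓘(ℝ, EF) 𝓘(ℝ, EF) ∞ (fun f : F => 𝓕.smul g f) :=
  𝓕.contMDiff_smul_real.comp (contMDiff_const.prodMk contMDiff_id)

theorem HomogeneousSubmanifold.contMDiff_orbit (𝓕 : HomogeneousSubmanifold Γ r EF F) (f : F) :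
    ContMDiff 𝓘(ℂ, EG) 𝓘(ℂ, EF) ω (fun g : G => 𝓕.smul g f) :=
  𝓕.contMDiff_smul.comp (contMDiff_id.prodMk contMDiff_const)

theorem HomogeneousSubmanifold.contMDiff_translate (𝓕 : HomogeneousSubmanifold Γ r EF F)
    (g : G) : ContMDiff 𝓘(ℂ, EF) 𝓘(ℂ, EF) ω (fun f : F => 𝓕.smul g f) :=
  𝓕.contMDiff_smul.comp (contMDiff_const.prodMk contMDiff_id)

theorem PrincipalBundle.contMDiff_act_left (B : PrincipalBundle EM M EG G EP P) (u : P) :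
    ContMDiff 𝓘(ℝ, EG) 𝓘(ℝ, EP) ∞ (fun g : G => B.act u g) :=
  B.contMDiff_act.comp (contMDiff_const.prodMk contMDiff_id)

theorem PrincipalBundle.contMDiff_act_right (B : PrincipalBundle EM M EG G EP P) (g : G) :
    ContMDiff 𝓘(ℝ, EP) 𝓘(ℝ, EP) ∞ (fun u : P => B.act u g) :=
  B.contMDiff_act.comp (contMDiff_id.prodMk contMDiff_const)

end Smoothness

/-- The connection form at a point, as a map between the model spaces. -/
def Connection.fm (C : Connection B) (u : P) : EP →L[ℝ] EG := C.form u

theorem Connection.fm_fundamental (C : Connection B) (u : P) (c : EG) :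
    C.fm u (md 𝓘(ℝ, EG) 𝓘(ℝ, EP) (fun g : G => B.act u g) 1 c) = c := by
  have h : C.fm (B.act u 1) (md 𝓘(ℝ, EG) 𝓘(ℝ, EP) (fun g : G => B.act u g) 1 c) = c :=
    C.form_fundamental u c
  rwa [B.act_one] at h

theorem Connection.fm_act (C : Connection B) (u : P) (g : G) (v : EP) :
    C.fm (B.act u g) (md 𝓘(ℝ, EP) 𝓘(ℝ, EP) (fun u' : P => B.act u' g) u v)
      = md 𝓘(ℝ, EG) 𝓘(ℝ, EG) (fun h : G => g⁻¹ * h * g) 1 (C.fm u v) :=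
  C.form_act u g v

theorem infinity_ne_zero : (∞ : WithTop ℕ∞) ≠ 0 := by simp

namespace Assoc

variable (q₀ : Assoc B 𝓕)

/-- The local section of `P` attached to `q₀`, in the preferred chart of `M`. -/
def locSec (x : EM) : P := (sect q₀).sec ((extChartAt 𝓘(ℝ, EM) (proj q₀)).symm x)

theorem contMDiffAt_locSec {x : EM} (hx : x ∈ (extChartAt 𝓘(ℝ, EM) (proj q₀)).target)
    (hx' : (extChartAt 𝓘(ℝ, EM) (proj q₀)).symm x ∈ (sect q₀).domain) :
    ContMDiffAt 𝓘(ℝ, EM) 𝓘(ℝ, EP) ∞ (locSec q₀) x :=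
  ((sect q₀).contMDiffOn_sec.contMDiffAt ((sect q₀).isOpen_domain.mem_nhds hx')).comp x
    (contMDiffAt_chart_symm (I := 𝓘(ℝ, EM)) (proj q₀) hx)

theorem contMDiffAt_coord {u : P} (hu : B.proj u ∈ (sect q₀).domain) :
    ContMDiffAt 𝓘(ℝ, EP) 𝓘(ℝ, EG) ∞ (sect q₀).coord u :=
  (sect q₀).contMDiffOn_coord.contMDiffAt
    (((sect q₀).isOpen_domain.preimage B.contMDiff_proj.continuous).mem_nhds hu)

/-- The connection form pulled back to the base by the local section attached to `q₀`. -/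
def locForm (C : Connection B) (x : EM) : EM →L[ℝ] EG :=
  (C.fm (locSec q₀ x)).comp (md 𝓘(ℝ, EM) 𝓘(ℝ, EP) (locSec q₀) x)

/-- The infinitesimal action of `G` on the fibre `F`, in the preferred chart. -/
def infAct (z : EF) : EG →L[ℝ] EF :=
  md 𝓘(ℝ, EG) 𝓘(ℝ, EF) (fun g : G => extChartAt 𝓘(ℝ, EF) (fibPt q₀)
    (𝓕.smul g ((extChartAt 𝓘(ℝ, EF) (fibPt q₀)).symm z))) 1

/-- The vertical part of a tangent vector with respect to the induced connection, in the preferred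
chart. -/
def vform (C : Connection B) (y : EM × EF) : EM × EF →L[ℝ] EF :=
  ContinuousLinearMap.snd ℝ EM EF
    + ((infAct q₀ y.2).comp (locForm q₀ C y.1)).comp (ContinuousLinearMap.fst ℝ EM EF)

/-- The derivative at `h = 1` of `[u, h · f]`, in the preferred chart. -/
def gauge (u : P) (f : F) : EG →L[ℝ] EF :=
  md 𝓘(ℝ, EG) 𝓘(ℝ, EF) (fun h : G => extChartAt 𝓘(ℝ, EF) (fibPt q₀)
    (𝓕.smul ((sect q₀).coord u) (𝓕.smul h f))) 1

/-- The connection form in terms of the local trivialization of `P`. -/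
theorem fm_eq (C : Connection B) {u : P} (hu : B.proj u ∈ (sect q₀).domain)
    (hu' : B.proj u ∈ (extChartAt 𝓘(ℝ, EM) (proj q₀)).source) (V : EP) :
    C.fm u V
      = md 𝓘(ℝ, EG) 𝓘(ℝ, EG) (fun h : G => ((sect q₀).coord u)⁻¹ * h * (sect q₀).coord u) 1
          (locForm q₀ C (extChartAt 𝓘(ℝ, EM) (proj q₀) (B.proj u))
            (md 𝓘(ℝ, EP) 𝓘(ℝ, EM)
              (fun u' => extChartAt 𝓘(ℝ, EM) (proj q₀) (B.proj u')) u V))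
        + md 𝓘(ℝ, EG) 𝓘(ℝ, EG) (fun h : G => ((sect q₀).coord u)⁻¹ * h) ((sect q₀).coord u)
          (md 𝓘(ℝ, EP) 𝓘(ℝ, EG) (sect q₀).coord u V) := by
  set g := (sect q₀).coord u with hg
  set e := extChartAt 𝓘(ℝ, EM) (proj q₀) with he
  set x := e (B.proj u) with hx
  have hex : e.symm x = B.proj u := e.left_inv hu'
  have hsx : locSec q₀ x = (sect q₀).sec (B.proj u) := by
    unfold locSec
    rw [← he, hex]
  have hact : B.act (locSec q₀ x) g = u := by
    rw [hsx]
    exact (sect q₀).act_coord u hu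
  have hxd : ContMDiffAt 𝓘(ℝ, EP) 𝓘(ℝ, EM) ∞ (fun u' => e (B.proj u')) u :=
    (contMDiffAt_chart (I := 𝓘(ℝ, EM)) (proj q₀) hu').comp u (B.contMDiff_proj u)
  have hsd : ContMDiffAt 𝓘(ℝ, EM) 𝓘(ℝ, EP) ∞ (locSec q₀) x :=
    contMDiffAt_locSec q₀ (e.map_source hu') (by rw [← he, hex]; exact hu)
  have hcd := contMDiffAt_coord q₀ hu
  -- Near `u` the identity of P is `u' ↦ s(π u') · coord u'`; its differential is computed by the
  -- product rule.
  have hid : (fun u' => B.act (locSec q₀ (e (B.proj u'))) ((sect q₀).coord u'))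
      =ᶠ[𝓝 u] fun u' => u' := by
    have hc : Continuous B.proj := B.contMDiff_proj.continuous
    filter_upwards [(hc.tendsto u).eventually ((sect q₀).isOpen_domain.mem_nhds hu),
      (hc.tendsto u).eventually
        ((isOpen_extChartAt_source (I := 𝓘(ℝ, EM)) (proj q₀)).mem_nhds hu')] with u' h1 h2
    unfold locSec
    rw [← he, e.left_inv h2]
    exact (sect q₀).act_coord u' h1
  have hactd := (B.contMDiff_act (locSec q₀ x, g)).mdifferentiableAt infinity_ne_zero
  have hsxd := (hsd.comp u hxd).mdifferentiableAt infinity_ne_zero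
  have h1 : V = md 𝓘(ℝ, EP) 𝓘(ℝ, EP) (fun u' => B.act u' g) (locSec q₀ x)
        (md 𝓘(ℝ, EM) 𝓘(ℝ, EP) (locSec q₀) x
          (md 𝓘(ℝ, EP) 𝓘(ℝ, EM) (fun u' => e (B.proj u')) u V))
      + md 𝓘(ℝ, EG) 𝓘(ℝ, EP) (fun h : G => B.act (locSec q₀ x) h) g
          (md 𝓘(ℝ, EP) 𝓘(ℝ, EG) (sect q₀).coord u V) := by
    have h2 := congrArg (fun L : EP →L[ℝ] EP => L V) (md_congr (I := 𝓘(ℝ, EP)) (I' := 𝓘(ℝ, EP)) hid)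
    simp only [md_id, ContinuousLinearMap.id_apply] at h2
    rw [← md_comp_apply (g := locSec q₀) (f := fun u' => e (B.proj u'))
      (hsd.mdifferentiableAt infinity_ne_zero) (hxd.mdifferentiableAt infinity_ne_zero), ← md_two hactd]
    conv_lhs => rw [← h2]
    have h3 := md_prodMk hsxd (hcd.mdifferentiableAt infinity_ne_zero)
    have h4 := md_comp_apply (I := 𝓘(ℝ, EP)) (I' := 𝓘(ℝ, EP).prod 𝓘(ℝ, EG)) (I'' := 𝓘(ℝ, EP))
      (f := fun u' => (locSec q₀ (e (B.proj u')), (sect q₀).coord u'))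
      (g := fun z : P × G => B.act z.1 z.2) (x := u) hactd
      (hsxd.prodMk (hcd.mdifferentiableAt infinity_ne_zero)) V
    refine h4.trans ?_
    congr 1
    exact congrArg (fun L : EP →L[ℝ] EP × EG => L V) h3
  -- Since `s · h = u · (g⁻¹h)`, moving `h` gives a fundamental vector at `u`, on which the
  -- connection form is known.
  have h2 : ∀ c : EG, md 𝓘(ℝ, EG) 𝓘(ℝ, EP) (fun h : G => B.act (locSec q₀ x) h) g c
      = md 𝓘(ℝ, EG) 𝓘(ℝ, EP) (fun h : G => B.act u h) 1
          (md 𝓘(ℝ, EG) 𝓘(ℝ, EG) (fun h : G => g⁻¹ * h) g c) := by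
    intro c
    have h3 : (fun h : G => B.act (locSec q₀ x) h) = fun h : G => B.act u (g⁻¹ * h) := by
      funext h
      rw [← hact, ← B.act_mul, mul_inv_cancel_left]
    rw [h3, md_comp_apply (I' := 𝓘(ℝ, EG)) (g := fun h : G => B.act u h)
      (f := fun h : G => g⁻¹ * h)
      ((B.contMDiff_act_left u _).mdifferentiableAt infinity_ne_zero)
      ((contMDiff_mul_left_real g⁻¹ g).mdifferentiableAt infinity_ne_zero), inv_mul_cancel]
  conv_lhs => rw [h1, map_add, h2, C.fm_fundamental]
  congr 1
  -- The remaining term is the translate by `g` of a vector at the section; equivariance of the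
  -- connection form turns it into the adjoint action.
  have h3 := C.fm_act (locSec q₀ x) g (md 𝓘(ℝ, EM) 𝓘(ℝ, EP) (locSec q₀) x
          (md 𝓘(ℝ, EP) 𝓘(ℝ, EM) (fun u' => e (B.proj u')) u V))
  rw [hact] at h3
  exact h3

/-- The vertical part of the differential of `u ↦ [u, f]` is given by the connection form. -/
theorem vform_md_kap (C : Connection B) {u : P} {f : F}
    (h : mk B 𝓕 u f ∈ (extChartAt (𝓘(ℝ, EM).prod 𝓘(ℝ, EF)) q₀).source) (V : EP) :
    vform q₀ C (kap q₀ (u, f))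
        (md 𝓘(ℝ, EP) 𝓘(ℝ, EM × EF) (fun u' : P => kap q₀ (u', f)) u V)
      = gauge q₀ u f (C.fm u V) := by
  have hF : IsManifold 𝓘(ℝ, EF) ∞ F := isManifold_fibre 𝓕
  obtain ⟨hu, hu', hf⟩ := (mem_source_iff q₀).1 h
  rw [fm_eq q₀ C hu hu', map_add]
  set g := (sect q₀).coord u with hg
  set e := extChartAt 𝓘(ℝ, EM) (proj q₀) with he
  set ψ := extChartAt 𝓘(ℝ, EF) (fibPt q₀) with hψ
  have hxd : ContMDiffAt 𝓘(ℝ, EP) 𝓘(ℝ, EM) ∞ (fun u' => e (B.proj u')) u :=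
    (contMDiffAt_chart (I := 𝓘(ℝ, EM)) (proj q₀) hu').comp u (B.contMDiff_proj u)
  have hcd := contMDiffAt_coord q₀ hu
  have hψd := contMDiffAt_chart (I := 𝓘(ℝ, EF)) (fibPt q₀) hf
  have hod : ContMDiffAt 𝓘(ℝ, EG) 𝓘(ℝ, EF) ∞ (fun g' : G => ψ (𝓕.smul g' f)) g :=
    hψd.comp g (𝓕.contMDiff_orbit_real f g)
  have hzd : ContMDiffAt 𝓘(ℝ, EP) 𝓘(ℝ, EF) ∞ (fun u' => ψ (𝓕.smul ((sect q₀).coord u') f)) u :=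
    hod.comp u hcd
  have hgd : ContMDiffAt 𝓘(ℝ, EG) 𝓘(ℝ, EF) ∞ (fun h : G => ψ (𝓕.smul g (𝓕.smul h f))) 1 := by
    have h1 : ContMDiffAt 𝓘(ℝ, EG) 𝓘(ℝ, EF) ∞ (fun h : G => 𝓕.smul g (𝓕.smul h f)) 1 :=
      ((𝓕.contMDiff_translate_real g).comp (𝓕.contMDiff_orbit_real f)) 1
    refine ContMDiffAt.comp (g := ψ) (1 : G) ?_ h1
    rw [𝓕.smul_one]
    exact hψd
  have h1 : md 𝓘(ℝ, EP) 𝓘(ℝ, EM × EF) (fun u' : P => kap q₀ (u', f)) u V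
      = (md 𝓘(ℝ, EP) 𝓘(ℝ, EM) (fun u' => e (B.proj u')) u V,
          md 𝓘(ℝ, EG) 𝓘(ℝ, EF) (fun g' : G => ψ (𝓕.smul g' f)) g
            (md 𝓘(ℝ, EP) 𝓘(ℝ, EG) (sect q₀).coord u V)) := by
    rw [← md_comp_apply (g := fun g' : G => ψ (𝓕.smul g' f)) (f := (sect q₀).coord)
      (hod.mdifferentiableAt infinity_ne_zero)
      (hcd.mdifferentiableAt infinity_ne_zero)]
    have h2 := md_prodMk_space (hxd.mdifferentiableAt infinity_ne_zero)
      (hzd.mdifferentiableAt infinity_ne_zero)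
    exact congrArg (fun L : EP →L[ℝ] EM × EF => L V) h2
  -- `g · (g⁻¹hg) · f = h · (g · f)`: the conjugation in `fm_eq` turns `gauge` into the
  -- infinitesimal action at `g · f`.
  have h2 : ∀ c : EG, gauge q₀ u f
      (md 𝓘(ℝ, EG) 𝓘(ℝ, EG) (fun h : G => g⁻¹ * h * g) 1 c)
      = infAct q₀ (kap q₀ (u, f)).2 c := by
    intro c
    have h3 : ψ.symm (kap q₀ (u, f)).2 = 𝓕.smul g f := ψ.left_inv hf
    unfold gauge infAct
    rw [← hψ, h3, ← hg]
    have h4 : (g⁻¹ * 1 * g : G) = 1 := by simp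
    have h5 := md_comp_apply (I := 𝓘(ℝ, EG)) (I' := 𝓘(ℝ, EG)) (I'' := 𝓘(ℝ, EF))
      (g := fun h : G => ψ (𝓕.smul g (𝓕.smul h f))) (f := fun h : G => g⁻¹ * h * g) (x := 1)
      (by rw [h4]; exact hgd.mdifferentiableAt infinity_ne_zero)
      ((contMDiff_conj_real g 1).mdifferentiableAt infinity_ne_zero) c
    rw [h4] at h5
    rw [← h5]
    congr 2
    funext h
    rw [← 𝓕.smul_mul, ← 𝓕.smul_mul]
    congr 2
    group
  -- `g · (g⁻¹h) · f = h · f`: the left translation in `fm_eq` turns `gauge` into the differential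
  -- of the orbit map at `g`, which is the fibre component of the differential of `kap`.
  have h3 : ∀ c : EG, gauge q₀ u f (md 𝓘(ℝ, EG) 𝓘(ℝ, EG) (fun h : G => g⁻¹ * h) g c)
      = md 𝓘(ℝ, EG) 𝓘(ℝ, EF) (fun g' : G => ψ (𝓕.smul g' f)) g c := by
    intro c
    unfold gauge
    rw [← hψ, ← hg]
    have h4 : (g⁻¹ * g : G) = 1 := by simp
    have h5 := md_comp_apply (I := 𝓘(ℝ, EG)) (I' := 𝓘(ℝ, EG)) (I'' := 𝓘(ℝ, EF))
      (g := fun h : G => ψ (𝓕.smul g (𝓕.smul h f))) (f := fun h : G => g⁻¹ * h) (x := g)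
      (by rw [h4]; exact hgd.mdifferentiableAt infinity_ne_zero)
      ((contMDiff_mul_left_real g⁻¹ g).mdifferentiableAt infinity_ne_zero) c
    rw [h4] at h5
    rw [← h5]
    congr 2
    funext h
    rw [← 𝓕.smul_mul]
    congr 2
    group
  rw [h1, h2, h3]
  exact add_comm _ _

end Assoc

end LocalForm

/-! ### Inverse differentials of the chart at points of its source. -/

section Chart

variable {E H N : Type*} [NormedAddCommGroup E] [NormedSpace ℝ E] [TopologicalSpace H]
  [TopologicalSpace N] [ChartedSpace H N] {I : ModelWithCorners ℝ E H} [I.Boundaryless]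
  [IsManifold I ∞ N] (q₀ : N)

theorem md_symm_chart' {q : N} (hq : q ∈ (extChartAt I q₀).source) (v : E) :
    md 𝓘(ℝ, E) I (extChartAt I q₀).symm (extChartAt I q₀ q)
      (md I 𝓘(ℝ, E) (extChartAt I q₀) q v) = v := by
  have h := md_symm_chart (I := I) q₀ ((extChartAt I q₀).map_source hq) v
  rwa [(extChartAt I q₀).left_inv hq] at h

theorem md_chart_symm' {q : N} (hq : q ∈ (extChartAt I q₀).source) (v : E) :
    md I 𝓘(ℝ, E) (extChartAt I q₀) q
      (md 𝓘(ℝ, E) I (extChartAt I q₀).symm (extChartAt I q₀ q) v) = v := by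
  have h := md_chart_symm (I := I) q₀ ((extChartAt I q₀).map_source hq) v
  rwa [(extChartAt I q₀).left_inv hq] at h

end Chart

/-! ### Complex tangent vectors as pairs of vectors of the model space. -/

section CDiff

variable {E H N E' H' N' : Type*}
  [NormedAddCommGroup E] [NormedSpace ℝ E] [TopologicalSpace H]
  [NormedAddCommGroup E'] [NormedSpace ℝ E'] [TopologicalSpace H']
  [TopologicalSpace N] [ChartedSpace H N] [TopologicalSpace N'] [ChartedSpace H' N']
  {I : ModelWithCorners ℝ E H} {I' : ModelWithCorners ℝ E' H'} (f : N → N') (q : N)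

/-- The real part of a complex tangent vector, in the model space. -/
def reT {q : N} (Z : CTangent I q) : E := rePart Z

/-- The imaginary part of a complex tangent vector, in the model space. -/
def imT {q : N} (Z : CTangent I q) : E := imPart Z

/-- The complex tangent vector `v + i w`. -/
def ofT (I : ModelWithCorners ℝ E H) (q : N) (v w : E) : CTangent I q :=
  toC (V := TangentSpace I q) v w

variable {q}

@[simp] theorem reT_ofT (v w : E) : reT (ofT I q v w) = v :=
  rePart_toC (V := TangentSpace I q) v w

@[simp] theorem imT_ofT (v w : E) : imT (ofT I q v w) = w :=
  imPart_toC (V := TangentSpace I q) v w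

theorem ctangent_ext {Z W : CTangent I q} (h1 : reT Z = reT W) (h2 : imT Z = imT W) : Z = W :=
  complex_ext h1 h2

@[simp] theorem reT_zero : reT (0 : CTangent I q) = 0 :=
  map_zero (rePart (V := TangentSpace I q))
@[simp] theorem imT_zero : imT (0 : CTangent I q) = 0 :=
  map_zero (imPart (V := TangentSpace I q))
theorem reT_add (Z W : CTangent I q) : reT (Z + W) = reT Z + reT W := map_add rePart Z W
theorem imT_add (Z W : CTangent I q) : imT (Z + W) = imT Z + imT W := map_add imPart Z W
theorem reT_sub (Z W : CTangent I q) : reT (Z - W) = reT Z - reT W := map_sub rePart Z W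
theorem imT_sub (Z W : CTangent I q) : imT (Z - W) = imT Z - imT W := map_sub imPart Z W
theorem reT_smul (c : ℂ) (Z : CTangent I q) : reT (c • Z) = c.re • reT Z - c.im • imT Z :=
  rePart_smul c Z
theorem imT_smul (c : ℂ) (Z : CTangent I q) : imT (c • Z) = c.re • imT Z + c.im • reT Z :=
  imPart_smul c Z

theorem reT_cdiff (Z : CTangent I q) : reT (cdiff I I' f q Z) = md I I' f q (reT Z) :=
  rePart_baseChange _ _

theorem imT_cdiff (Z : CTangent I q) : imT (cdiff I I' f q Z) = md I I' f q (imT Z) :=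
  imPart_baseChange _ _

end CDiff

/-! ### The induced distribution as the solution set of two linear conditions. -/

section Characterization

variable {EM : Type*} [NormedAddCommGroup EM] [NormedSpace ℝ EM]
  {M : Type*} [TopologicalSpace M] [ChartedSpace EM M] [IsManifold 𝓘(ℝ, EM) ∞ M]
  {EG : Type*} [NormedAddCommGroup EG] [NormedSpace ℂ EG]
  {G : Type*} [Group G] [TopologicalSpace G] [ChartedSpace EG G] [LieGroup 𝓘(ℂ, EG) ω G]
  {EP : Type*} [NormedAddCommGroup EP] [NormedSpace ℝ EP]
  {P : Type*} [TopologicalSpace P] [ChartedSpace EP P] [IsManifold 𝓘(ℝ, EP) ∞ P]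
  {EF : Type*} [NormedAddCommGroup EF] [NormedSpace ℂ EF]
  {F : Type*} [TopologicalSpace F] [ChartedSpace EF F] [IsManifold 𝓘(ℂ, EF) ω F]
  {m r : ℕ} {Γ : ComplexLieSubgroup m EG G}

variable {B : PrincipalBundle EM M EG G EP P} {𝓕 : HomogeneousSubmanifold Γ r EF F}

/-- The map `x ↦ s(x) · coord u` is a local section of P through `u`, and its differential lifts
`v`. -/
theorem PrincipalBundle.exists_lift (B : PrincipalBundle EM M EG G EP P) (u : P) (v : EM) :
    ∃ V : EP, md 𝓘(ℝ, EP) 𝓘(ℝ, EM) B.proj u V = v := by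
  obtain ⟨σ, hσ⟩ := B.locally_trivial (B.proj u)
  have h1 : ContMDiffAt 𝓘(ℝ, EM) 𝓘(ℝ, EP) ∞ (fun x => B.act (σ.sec x) (σ.coord u)) (B.proj u) :=
    (B.contMDiff_act_right (σ.coord u) _).comp (B.proj u)
      (σ.contMDiffOn_sec.contMDiffAt (σ.isOpen_domain.mem_nhds hσ))
  refine ⟨md 𝓘(ℝ, EM) 𝓘(ℝ, EP) (fun x => B.act (σ.sec x) (σ.coord u)) (B.proj u) v, ?_⟩
  have h2 := md_comp_apply (I := 𝓘(ℝ, EM)) (I' := 𝓘(ℝ, EP)) (I'' := 𝓘(ℝ, EM)) (g := B.proj)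
    (f := fun x => B.act (σ.sec x) (σ.coord u)) (x := B.proj u)
    ((B.contMDiff_proj _).mdifferentiableAt infinity_ne_zero)
    (h1.mdifferentiableAt infinity_ne_zero) v
  rw [σ.act_coord u hσ] at h2
  rw [← h2]
  have h3 : (fun x => B.proj (B.act (σ.sec x) (σ.coord u))) =ᶠ[𝓝 (B.proj u)] fun x => x := by
    filter_upwards [σ.isOpen_domain.mem_nhds hσ] with x hx
    rw [B.proj_act, σ.proj_sec x hx]
  rw [md_congr h3, md_id]
  rfl

/-- Subtracting from any lift the fundamental vector of its connection form makes it horizontal. The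
projection is unchanged, because fundamental vectors are tangent to the fibres. -/
theorem Connection.exists_horizontal (C : Connection B) (u : P) (v : EM) :
    ∃ V : EP, C.fm u V = 0 ∧ md 𝓘(ℝ, EP) 𝓘(ℝ, EM) B.proj u V = v := by
  obtain ⟨V, hV⟩ := B.exists_lift u v
  refine ⟨V - md 𝓘(ℝ, EG) 𝓘(ℝ, EP) (fun g : G => B.act u g) 1 (C.fm u V), ?_, ?_⟩
  · rw [map_sub, C.fm_fundamental, sub_self]
  · have h1 := md_comp_apply (I := 𝓘(ℝ, EG)) (I' := 𝓘(ℝ, EP)) (I'' := 𝓘(ℝ, EM)) (g := B.proj)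
      (f := fun g : G => B.act u g) (x := 1)
      ((B.contMDiff_proj _).mdifferentiableAt infinity_ne_zero)
      ((B.contMDiff_act_left u 1).mdifferentiableAt infinity_ne_zero) (C.fm u V)
    simp only [B.proj_act, md_const, B.act_one] at h1
    rw [map_sub, hV, ← h1]
    simp

namespace Assoc

theorem exists_mk (q : Assoc B 𝓕) : ∃ (u : P) (f : F), mk B 𝓕 u f = q := by
  obtain ⟨⟨u, f⟩, h⟩ := Quotient.exists_rep q
  exact ⟨u, f, h⟩

theorem contMDiff_mk_left (f : F) : ContMDiff 𝓘(ℝ, EP) (𝓘(ℝ, EM).prod 𝓘(ℝ, EF)) ∞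
    (fun u : P => mk B 𝓕 u f) :=
  contMDiff_mk.comp (contMDiff_id.prodMk contMDiff_const)

theorem contMDiff_mk_right (u : P) : ContMDiff 𝓘(ℝ, EF) (𝓘(ℝ, EM).prod 𝓘(ℝ, EF)) ∞
    (fun f : F => mk B 𝓕 u f) :=
  contMDiff_mk.comp (contMDiff_const.prodMk contMDiff_id)

theorem contMDiff_proj : ContMDiff (𝓘(ℝ, EM).prod 𝓘(ℝ, EF)) 𝓘(ℝ, EM) ∞
    (proj : Assoc B 𝓕 → M) := by
  intro q
  have h1 := contMDiffAt_chart (I := 𝓘(ℝ, EM).prod 𝓘(ℝ, EF)) q (mem_extChartAt_source q)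
  have h2 := contMDiffAt_chart_symm (I := 𝓘(ℝ, EM)) (proj q)
    (mem_extChartAt_target (I := 𝓘(ℝ, EM)) (proj q))
  have h3 : ContMDiffAt (𝓘(ℝ, EM).prod 𝓘(ℝ, EF)) 𝓘(ℝ, EM) ∞
      (fun q' => (extChartAt (𝓘(ℝ, EM).prod 𝓘(ℝ, EF)) q q').1) q :=
    (contDiff_fst.contMDiff (x := extChartAt (𝓘(ℝ, EM).prod 𝓘(ℝ, EF)) q q)).comp q h1
  refine (ContMDiffAt.comp (g := (extChartAt 𝓘(ℝ, EM) (proj q)).symm) q h2 h3).congr_of_eventuallyEq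
    ?_
  filter_upwards [extChartAt_source_mem_nhds (I := 𝓘(ℝ, EM).prod 𝓘(ℝ, EF)) q] with q' hq'
  obtain ⟨⟨u, f⟩, rfl⟩ := Quotient.exists_rep q'
  exact ((extChartAt 𝓘(ℝ, EM) (proj q)).left_inv ((mem_source_iff q (u := u) (f := f)).1 hq').2.1).symm

theorem md_proj_md_mk (u : P) (f : F) (V : EP) :
    md (𝓘(ℝ, EM).prod 𝓘(ℝ, EF)) 𝓘(ℝ, EM) (proj : Assoc B 𝓕 → M) (mk B 𝓕 u f)
      (md 𝓘(ℝ, EP) (𝓘(ℝ, EM).prod 𝓘(ℝ, EF)) (fun u' => mk B 𝓕 u' f) u V)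
      = md 𝓘(ℝ, EP) 𝓘(ℝ, EM) B.proj u V :=
  (md_comp_apply (g := (proj : Assoc B 𝓕 → M)) (f := fun u' => mk B 𝓕 u' f)
    ((contMDiff_proj _).mdifferentiableAt infinity_ne_zero)
    ((contMDiff_mk_left f u).mdifferentiableAt infinity_ne_zero) V).symm

theorem md_proj_md_mk_right (u : P) (f : F) (ξ : EF) :
    md (𝓘(ℝ, EM).prod 𝓘(ℝ, EF)) 𝓘(ℝ, EM) (proj : Assoc B 𝓕 → M) (mk B 𝓕 u f)
      (md 𝓘(ℝ, EF) (𝓘(ℝ, EM).prod 𝓘(ℝ, EF)) (fun f' => mk B 𝓕 u f') f ξ) = 0 := by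
  rw [← md_comp_apply (g := (proj : Assoc B 𝓕 → M)) (f := fun f' => mk B 𝓕 u f')
    ((contMDiff_proj _).mdifferentiableAt infinity_ne_zero)
    ((contMDiff_mk_right u f).mdifferentiableAt infinity_ne_zero) ξ]
  have : (fun f' : F => proj (mk B 𝓕 u f')) = fun _ => B.proj u := rfl
  rw [this, md_const]
  rfl

variable (q₀ : Assoc B 𝓕)

theorem md_chart_md_mk {u : P} {f : F}
    (h : mk B 𝓕 u f ∈ (extChartAt (𝓘(ℝ, EM).prod 𝓘(ℝ, EF)) q₀).source) (V : EP) :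
    md (𝓘(ℝ, EM).prod 𝓘(ℝ, EF)) 𝓘(ℝ, EM × EF) (extChartAt (𝓘(ℝ, EM).prod 𝓘(ℝ, EF)) q₀) (mk B 𝓕 u f)
      (md 𝓘(ℝ, EP) (𝓘(ℝ, EM).prod 𝓘(ℝ, EF)) (fun u' => mk B 𝓕 u' f) u V)
      = md 𝓘(ℝ, EP) 𝓘(ℝ, EM × EF) (fun u' => kap q₀ (u', f)) u V := by
  rw [← md_comp_apply (g := extChartAt (𝓘(ℝ, EM).prod 𝓘(ℝ, EF)) q₀) (f := fun u' => mk B 𝓕 u' f)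
    ((contMDiffAt_chart q₀ h).mdifferentiableAt infinity_ne_zero)
    ((contMDiff_mk_left f u).mdifferentiableAt infinity_ne_zero) V]
  refine congrArg (fun L : EP →L[ℝ] EM × EF => L V) (md_congr ?_)
  have h1 : Filter.Tendsto (fun u' : P => (u', f)) (𝓝 u) (𝓝 (u, f)) :=
    (Continuous.prodMk continuous_id continuous_const).tendsto u
  filter_upwards [h1.eventually (eventually_mk_mem q₀ h)] with u' hu'
  exact chart_mk q₀ ((mem_source_iff q₀).1 hu').1 f

theorem md_chart_md_mk_right {u : P} {f : F}
    (h : mk B 𝓕 u f ∈ (extChartAt (𝓘(ℝ, EM).prod 𝓘(ℝ, EF)) q₀).source) (ξ : EF) :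
    md (𝓘(ℝ, EM).prod 𝓘(ℝ, EF)) 𝓘(ℝ, EM × EF) (extChartAt (𝓘(ℝ, EM).prod 𝓘(ℝ, EF)) q₀) (mk B 𝓕 u f)
      (md 𝓘(ℝ, EF) (𝓘(ℝ, EM).prod 𝓘(ℝ, EF)) (fun f' => mk B 𝓕 u f') f ξ)
      = (0, md 𝓘(ℝ, EF) 𝓘(ℝ, EF) (fun f' => extChartAt 𝓘(ℝ, EF) (fibPt q₀)
          (𝓕.smul ((sect q₀).coord u) f')) f ξ) := by
  have hF : IsManifold 𝓘(ℝ, EF) ∞ F := isManifold_fibre 𝓕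
  obtain ⟨hu, hu', hf⟩ := (mem_source_iff q₀).1 h
  rw [← md_comp_apply (g := extChartAt (𝓘(ℝ, EM).prod 𝓘(ℝ, EF)) q₀) (f := fun f' => mk B 𝓕 u f')
    ((contMDiffAt_chart q₀ h).mdifferentiableAt infinity_ne_zero)
    ((contMDiff_mk_right u f).mdifferentiableAt infinity_ne_zero) ξ]
  have h1 : (fun f' : F => extChartAt (𝓘(ℝ, EM).prod 𝓘(ℝ, EF)) q₀ (mk B 𝓕 u f'))
      = fun f' : F => (extChartAt 𝓘(ℝ, EM) (proj q₀) (B.proj u),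
          extChartAt 𝓘(ℝ, EF) (fibPt q₀) (𝓕.smul ((sect q₀).coord u) f')) := by
    funext f'
    exact chart_mk q₀ hu f'
  have h2 : ContMDiffAt 𝓘(ℝ, EF) 𝓘(ℝ, EF) ∞
      (fun f' : F => extChartAt 𝓘(ℝ, EF) (fibPt q₀) (𝓕.smul ((sect q₀).coord u) f')) f :=
    (contMDiffAt_chart (I := 𝓘(ℝ, EF)) (fibPt q₀) hf).comp f (𝓕.contMDiff_translate_real _ f)
  rw [h1, md_prodMk_space mdifferentiableAt_const (h2.mdifferentiableAt infinity_ne_zero), md_const]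
  rfl

/-- The first component of the differential of the preferred chart. -/
theorem md_chart_fst {q : Assoc B 𝓕}
    (h : q ∈ (extChartAt (𝓘(ℝ, EM).prod 𝓘(ℝ, EF)) q₀).source) (v : EM × EF) :
    (md (𝓘(ℝ, EM).prod 𝓘(ℝ, EF)) 𝓘(ℝ, EM × EF) (extChartAt (𝓘(ℝ, EM).prod 𝓘(ℝ, EF)) q₀) q v).1
      = md 𝓘(ℝ, EM) 𝓘(ℝ, EM) (extChartAt 𝓘(ℝ, EM) (proj q₀)) (proj q)
          (md (𝓘(ℝ, EM).prod 𝓘(ℝ, EF)) 𝓘(ℝ, EM) (proj : Assoc B 𝓕 → M) q v) := by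
  have hq : proj q ∈ (extChartAt 𝓘(ℝ, EM) (proj q₀)).source := by
    obtain ⟨⟨u, f⟩, rfl⟩ := Quotient.exists_rep q
    exact ((mem_source_iff q₀ (u := u) (f := f)).1 h).2.1
  rw [← md_comp_apply (g := extChartAt 𝓘(ℝ, EM) (proj q₀)) (f := (proj : Assoc B 𝓕 → M))
    ((contMDiffAt_chart (proj q₀) hq).mdifferentiableAt infinity_ne_zero)
    ((contMDiff_proj q).mdifferentiableAt infinity_ne_zero) v]
  have h1 := md_comp_apply (I := 𝓘(ℝ, EM).prod 𝓘(ℝ, EF)) (I' := 𝓘(ℝ, EM × EF)) (I'' := 𝓘(ℝ, EM))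
    (g := fun z : EM × EF => z.1) (f := extChartAt (𝓘(ℝ, EM).prod 𝓘(ℝ, EF)) q₀) (x := q)
    (contDiff_fst.contMDiff.contMDiffAt.mdifferentiableAt infinity_ne_zero)
    ((contMDiffAt_chart q₀ h).mdifferentiableAt infinity_ne_zero) v
  rw [md_eq_fderiv, fderiv_fst] at h1
  exact h1.symm

/-- The map is a chart after the translation by `g`; a preimage is obtained by inverting the chart
and translating by `g⁻¹`. -/
theorem translate_surjective {u : P} {f : F}
    (h : mk B 𝓕 u f ∈ (extChartAt (𝓘(ℝ, EM).prod 𝓘(ℝ, EF)) q₀).source) (ζ : EF) :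
    ∃ ξ : EF, md 𝓘(ℝ, EF) 𝓘(ℝ, EF) (fun f' => extChartAt 𝓘(ℝ, EF) (fibPt q₀)
          (𝓕.smul ((sect q₀).coord u) f')) f ξ = ζ := by
  have hF : IsManifold 𝓘(ℝ, EF) ∞ F := isManifold_fibre 𝓕
  obtain ⟨hu, hu', hf⟩ := (mem_source_iff q₀).1 h
  set g := (sect q₀).coord u
  have h1 : ∀ ζ, md 𝓘(ℝ, EF) 𝓘(ℝ, EF) (fun f' : F => 𝓕.smul g f') f
      (md 𝓘(ℝ, EF) 𝓘(ℝ, EF) (fun f' : F => 𝓕.smul g⁻¹ f') (𝓕.smul g f) ζ) = ζ := by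
    intro ζ
    have h2 := md_comp_apply (I := 𝓘(ℝ, EF)) (I' := 𝓘(ℝ, EF)) (I'' := 𝓘(ℝ, EF))
      (g := fun f' : F => 𝓕.smul g f') (f := fun f' : F => 𝓕.smul g⁻¹ f') (x := 𝓕.smul g f)
      ((𝓕.contMDiff_translate_real _ _).mdifferentiableAt infinity_ne_zero)
      ((𝓕.contMDiff_translate_real _ _).mdifferentiableAt infinity_ne_zero) ζ
    simp only [← 𝓕.smul_mul, mul_inv_cancel, inv_mul_cancel, 𝓕.smul_one, md_id] at h2
    exact h2.symm
  refine ⟨md 𝓘(ℝ, EF) 𝓘(ℝ, EF) (fun f' : F => 𝓕.smul g⁻¹ f') (𝓕.smul g f)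
      (md 𝓘(ℝ, EF) 𝓘(ℝ, EF) (extChartAt 𝓘(ℝ, EF) (fibPt q₀)).symm
        (extChartAt 𝓘(ℝ, EF) (fibPt q₀) (𝓕.smul g f)) ζ), ?_⟩
  rw [md_comp_apply (g := extChartAt 𝓘(ℝ, EF) (fibPt q₀)) (f := fun f' => 𝓕.smul g f')
    ((contMDiffAt_chart (fibPt q₀) hf).mdifferentiableAt infinity_ne_zero)
    ((𝓕.contMDiff_translate_real _ _).mdifferentiableAt infinity_ne_zero), h1,
    md_chart_symm' (fibPt q₀) hf]

/-- The preferred charts over ℝ and over ℂ are the same map, so the chart used for real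
differentials is holomorphic. -/
theorem contMDiffAt_complex_chart (f₀ : F) {f : F} (hf : f ∈ (extChartAt 𝓘(ℝ, EF) f₀).source) :
    ContMDiffAt 𝓘(ℂ, EF) 𝓘(ℂ, EF) ω (extChartAt 𝓘(ℝ, EF) f₀) f := by
  refine contMDiffAt_extChartAt' (I := 𝓘(ℂ, EF)) (x := f₀) (x' := f) ?_
  simpa using hf

theorem contMDiffAt_complex_chart_symm (f₀ : F) {z : EF}
    (hz : z ∈ (extChartAt 𝓘(ℝ, EF) f₀).target) :
    ContMDiffAt 𝓘(ℂ, EF) 𝓘(ℂ, EF) ω (extChartAt 𝓘(ℝ, EF) f₀).symm z :=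
  (contMDiffOn_extChartAt_symm (I := 𝓘(ℂ, EF)) (n := ω) f₀).contMDiffAt
    ((isOpen_extChartAt_target (I := 𝓘(ℂ, EF)) f₀).mem_nhds hz)

theorem translate_smul {u : P} {f : F}
    (h : mk B 𝓕 u f ∈ (extChartAt (𝓘(ℝ, EM).prod 𝓘(ℝ, EF)) q₀).source) (c : ℂ) (ξ : EF) :
    md 𝓘(ℝ, EF) 𝓘(ℝ, EF) (fun f' => extChartAt 𝓘(ℝ, EF) (fibPt q₀)
          (𝓕.smul ((sect q₀).coord u) f')) f (c • ξ)
      = c • md 𝓘(ℝ, EF) 𝓘(ℝ, EF) (fun f' => extChartAt 𝓘(ℝ, EF) (fibPt q₀)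
          (𝓕.smul ((sect q₀).coord u) f')) f ξ :=
  md_smul_complex (((contMDiffAt_complex_chart (fibPt q₀) ((mem_source_iff q₀).1 h).2.2).comp f
    (𝓕.contMDiff_translate _ f)).mdifferentiableAt (by simp)) c ξ

/-- The complex linear extension of the vertical part. -/
def cvform (C : Connection B) {q : Assoc B 𝓕} (Z : CTangent (𝓘(ℝ, EM).prod 𝓘(ℝ, EF)) q) : EF :=
  vform q₀ C (extChartAt (𝓘(ℝ, EM).prod 𝓘(ℝ, EF)) q₀ q)
      (md (𝓘(ℝ, EM).prod 𝓘(ℝ, EF)) 𝓘(ℝ, EM × EF) (extChartAt (𝓘(ℝ, EM).prod 𝓘(ℝ, EF)) q₀) q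
        (reT Z))
    + Complex.I • vform q₀ C (extChartAt (𝓘(ℝ, EM).prod 𝓘(ℝ, EF)) q₀ q)
      (md (𝓘(ℝ, EM).prod 𝓘(ℝ, EF)) 𝓘(ℝ, EM × EF) (extChartAt (𝓘(ℝ, EM).prod 𝓘(ℝ, EF)) q₀) q
        (imT Z))

theorem cvform_zero (C : Connection B) {q : Assoc B 𝓕} :
    cvform q₀ C (0 : CTangent (𝓘(ℝ, EM).prod 𝓘(ℝ, EF)) q) = 0 := by
  simp [cvform]

theorem cvform_add (C : Connection B) {q : Assoc B 𝓕}
    (Z W : CTangent (𝓘(ℝ, EM).prod 𝓘(ℝ, EF)) q) :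
    cvform q₀ C (Z + W) = cvform q₀ C Z + cvform q₀ C W := by
  simp only [cvform, reT_add, imT_add, map_add, smul_add]
  abel

theorem cvform_smul (C : Connection B) {q : Assoc B 𝓕} (c : ℂ)
    (Z : CTangent (𝓘(ℝ, EM).prod 𝓘(ℝ, EF)) q) :
    cvform q₀ C (c • Z) = c • cvform q₀ C Z := by
  have h := (cext ((vform q₀ C (extChartAt (𝓘(ℝ, EM).prod 𝓘(ℝ, EF)) q₀ q)).comp
    (md (𝓘(ℝ, EM).prod 𝓘(ℝ, EF)) 𝓘(ℝ, EM × EF)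
      (extChartAt (𝓘(ℝ, EM).prod 𝓘(ℝ, EF)) q₀) q)).toLinearMap).map_smul c (toC (reT Z) (imT Z))
  simp only [cext_apply, rePart_smul, imPart_smul, rePart_toC, imPart_toC] at h
  simp only [cvform, reT_smul, imT_smul]
  exact h

/-- The projection of `[·, f]` is the projection of P, and by `vform_md_kap` the vertical part of
its differential factors through the connection form, which vanishes on `V`. -/
theorem horizontalOver_mem (C : Connection B)
    (p : ∀ x : M, Submodule ℂ (CTangent 𝓘(ℝ, EM) x)) {q : Assoc B 𝓕}
    {Z : CTangent (𝓘(ℝ, EM).prod 𝓘(ℝ, EF)) q} (hZ : C.HorizontalOver p 𝓕 q Z)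
    (hq : q ∈ (extChartAt (𝓘(ℝ, EM).prod 𝓘(ℝ, EF)) q₀).source) :
    cdiff (𝓘(ℝ, EM).prod 𝓘(ℝ, EF)) 𝓘(ℝ, EM) proj q Z ∈ p (proj q) ∧ cvform q₀ C Z = 0 := by
  obtain ⟨u, f, V, hV, hp⟩ := hZ
  constructor
  · have h1 : cdiff (𝓘(ℝ, EM).prod 𝓘(ℝ, EF)) 𝓘(ℝ, EM) proj (mk B 𝓕 u f)
        (cdiff 𝓘(ℝ, EP) (𝓘(ℝ, EM).prod 𝓘(ℝ, EF)) (fun u' : P => Assoc.mk B 𝓕 u' f) u V)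
        = cdiff 𝓘(ℝ, EP) 𝓘(ℝ, EM) B.proj u V := by
      apply ctangent_ext (q := B.proj u)
      · erw [reT_cdiff, reT_cdiff, reT_cdiff, md_proj_md_mk]
      · erw [imT_cdiff, imT_cdiff, imT_cdiff, md_proj_md_mk]
    exact h1 ▸ hp
  · have key : ∀ V : EP, C.fm u V = 0 →
        vform q₀ C (extChartAt (𝓘(ℝ, EM).prod 𝓘(ℝ, EF)) q₀ (mk B 𝓕 u f))
          (md (𝓘(ℝ, EM).prod 𝓘(ℝ, EF)) 𝓘(ℝ, EM × EF) (extChartAt (𝓘(ℝ, EM).prod 𝓘(ℝ, EF)) q₀)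
            (mk B 𝓕 u f)
            (md 𝓘(ℝ, EP) (𝓘(ℝ, EM).prod 𝓘(ℝ, EF)) (fun u' => mk B 𝓕 u' f) u V)) = 0 := by
      intro V hV
      rw [md_chart_md_mk q₀ hq, chart_mk q₀ ((mem_source_iff q₀).1 hq).1, vform_md_kap q₀ C hq, hV,
        map_zero]
    rw [cvform, reT_cdiff, imT_cdiff, key (reT V) hV.1, key (imT V) hV.2, smul_zero, add_zero]

/-- On a vertical vector `ξ + i Jξ` the form takes the value `Lξ + i L(iξ)`, with `L` the
differential of a holomorphic translation. Complex linearity of `L` makes this zero. -/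
theorem verticalAntiholomorphic_mem (C : Connection B)
    (p : ∀ x : M, Submodule ℂ (CTangent 𝓘(ℝ, EM) x)) {q : Assoc B 𝓕}
    {Z : CTangent (𝓘(ℝ, EM).prod 𝓘(ℝ, EF)) q} (hZ : VerticalAntiholomorphic B 𝓕 q Z)
    (hq : q ∈ (extChartAt (𝓘(ℝ, EM).prod 𝓘(ℝ, EF)) q₀).source) :
    cdiff (𝓘(ℝ, EM).prod 𝓘(ℝ, EF)) 𝓘(ℝ, EM) proj q Z ∈ p (proj q) ∧ cvform q₀ C Z = 0 := by
  obtain ⟨u, f, ξ⟩ := hZ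
  change EF at ξ
  have hre : reT (toC ξ (complexStructure f ξ) : CTangent 𝓘(ℝ, EF) f) = ξ := reT_ofT ξ _
  have him : imT (toC ξ (complexStructure f ξ) : CTangent 𝓘(ℝ, EF) f)
      = Complex.I • ξ := imT_ofT _ _
  constructor
  · have h1 : cdiff (𝓘(ℝ, EM).prod 𝓘(ℝ, EF)) 𝓘(ℝ, EM) proj (mk B 𝓕 u f)
        (cdiff 𝓘(ℝ, EF) (𝓘(ℝ, EM).prod 𝓘(ℝ, EF)) (fun f' : F => Assoc.mk B 𝓕 u f') f
          (toC ξ (complexStructure f ξ))) = 0 := by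
      apply ctangent_ext
      · rw [reT_cdiff, reT_cdiff, reT_zero, md_proj_md_mk_right]
      · rw [imT_cdiff, imT_cdiff, imT_zero, md_proj_md_mk_right]
    rw [h1]
    exact Submodule.zero_mem _
  · have key : ∀ ξ : EF,
        vform q₀ C (extChartAt (𝓘(ℝ, EM).prod 𝓘(ℝ, EF)) q₀ (mk B 𝓕 u f))
          (md (𝓘(ℝ, EM).prod 𝓘(ℝ, EF)) 𝓘(ℝ, EM × EF) (extChartAt (𝓘(ℝ, EM).prod 𝓘(ℝ, EF)) q₀)
            (mk B 𝓕 u f)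
            (md 𝓘(ℝ, EF) (𝓘(ℝ, EM).prod 𝓘(ℝ, EF)) (fun f' => mk B 𝓕 u f') f ξ))
          = md 𝓘(ℝ, EF) 𝓘(ℝ, EF) (fun f' => extChartAt 𝓘(ℝ, EF) (fibPt q₀)
              (𝓕.smul ((sect q₀).coord u) f')) f ξ := by
      intro ξ
      rw [md_chart_md_mk_right q₀ hq]
      simp [vform]
    rw [cvform, reT_cdiff, imT_cdiff, key, key, hre, him, translate_smul q₀ hq, smul_smul,
      Complex.I_mul_I, neg_one_smul, add_neg_cancel]

/-- The condition that a complex tangent vector is in the induced distribution, in the preferred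
chart at `q₀`. -/
theorem mem_inducedDistribution_iff (C : Connection B)
    (p : ∀ x : M, Submodule ℂ (CTangent 𝓘(ℝ, EM) x)) {q : Assoc B 𝓕}
    (hq : q ∈ (extChartAt (𝓘(ℝ, EM).prod 𝓘(ℝ, EF)) q₀).source)
    (Z : CTangent (𝓘(ℝ, EM).prod 𝓘(ℝ, EF)) q) :
    Z ∈ inducedDistribution C 𝓕 p q ↔
      cdiff (𝓘(ℝ, EM).prod 𝓘(ℝ, EF)) 𝓘(ℝ, EM) proj q Z ∈ p (proj q) ∧ cvform q₀ C Z = 0 := by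
  constructor
  · let S : Submodule ℂ (CTangent (𝓘(ℝ, EM).prod 𝓘(ℝ, EF)) q) :=
      { carrier := {Z | cdiff (𝓘(ℝ, EM).prod 𝓘(ℝ, EF)) 𝓘(ℝ, EM) proj q Z ∈ p (proj q) ∧
          cvform q₀ C Z = 0}
        zero_mem' := ⟨by rw [map_zero]; exact Submodule.zero_mem _, cvform_zero q₀ C⟩
        add_mem' := fun h1 h2 => ⟨by rw [map_add]; exact Submodule.add_mem _ h1.1 h2.1,
          by rw [cvform_add, h1.2, h2.2, add_zero]⟩
        smul_mem' := fun c _ h1 => ⟨by rw [map_smul]; exact Submodule.smul_mem _ c h1.1,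
          by rw [cvform_smul, h1.2, smul_zero]⟩ }
    have h1 : inducedDistribution C 𝓕 p q ≤ S :=
      sup_le (Submodule.span_le.2 fun Z hZ => horizontalOver_mem q₀ C p hZ hq)
        (Submodule.span_le.2 fun Z hZ => verticalAntiholomorphic_mem q₀ C p hZ hq)
    exact fun hZ => h1 hZ
  · rintro ⟨h1, h2⟩
    obtain ⟨u, f, rfl⟩ := exists_mk q
    -- The horizontal lift `Z'` of the projection of `Z` is the candidate for the horizontal
    -- summand; it remains to see that `Z - Z'` is vertical of type (0,1).
    obtain ⟨V₁, hV₁, hV₁'⟩ := C.exists_horizontal u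
      (md (𝓘(ℝ, EM).prod 𝓘(ℝ, EF)) 𝓘(ℝ, EM) (proj : Assoc B 𝓕 → M) (mk B 𝓕 u f) (reT Z))
    obtain ⟨V₂, hV₂, hV₂'⟩ := C.exists_horizontal u
      (md (𝓘(ℝ, EM).prod 𝓘(ℝ, EF)) 𝓘(ℝ, EM) (proj : Assoc B 𝓕 → M) (mk B 𝓕 u f) (imT Z))
    set Z' : CTangent (𝓘(ℝ, EM).prod 𝓘(ℝ, EF)) (mk B 𝓕 u f) :=
      cdiff 𝓘(ℝ, EP) (𝓘(ℝ, EM).prod 𝓘(ℝ, EF)) (fun u' : P => Assoc.mk B 𝓕 u' f) u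
        (ofT 𝓘(ℝ, EP) u V₁ V₂) with hZ'
    have hp : cdiff 𝓘(ℝ, EP) 𝓘(ℝ, EM) B.proj u (ofT 𝓘(ℝ, EP) u V₁ V₂) ∈ p (B.proj u) := by
      have h3 : cdiff (𝓘(ℝ, EM).prod 𝓘(ℝ, EF)) 𝓘(ℝ, EM) proj (mk B 𝓕 u f) Z
          = cdiff 𝓘(ℝ, EP) 𝓘(ℝ, EM) B.proj u (ofT 𝓘(ℝ, EP) u V₁ V₂) := by
        apply ctangent_ext (q := B.proj u)
        · erw [reT_cdiff, reT_cdiff, reT_ofT, hV₁']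
        · erw [imT_cdiff, imT_cdiff, imT_ofT, hV₂']
      exact h3 ▸ h1
    have hh : C.HorizontalOver p 𝓕 (mk B 𝓕 u f) Z' :=
      Connection.HorizontalOver.intro u f _ ⟨by erw [rePart_toC]; exact hV₁,
        by erw [imPart_toC]; exact hV₂⟩ hp
    have h3 := (horizontalOver_mem q₀ C p hh hq).2
    set D := md (𝓘(ℝ, EM).prod 𝓘(ℝ, EF)) 𝓘(ℝ, EM × EF)
      (extChartAt (𝓘(ℝ, EM).prod 𝓘(ℝ, EF)) q₀) (mk B 𝓕 u f) with hD
    have hre : (D (reT (Z - Z'))).1 = 0 := by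
      rw [hD, md_chart_fst q₀ hq, reT_sub, map_sub, hZ', reT_cdiff, reT_ofT, md_proj_md_mk, hV₁',
        sub_self, map_zero]
    have him : (D (imT (Z - Z'))).1 = 0 := by
      rw [hD, md_chart_fst q₀ hq, imT_sub, map_sub, hZ', imT_cdiff, imT_ofT, md_proj_md_mk, hV₂',
        sub_self, map_zero]
    have h4 : cvform q₀ C (Z - Z') = 0 := by
      have h5 := cvform_add q₀ C (Z - Z') Z'
      rw [sub_add_cancel, h2, h3, add_zero] at h5
      exact h5.symm
    -- On vertical vectors the form only sees the fibre component, so its vanishing says that the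
    -- imaginary part is i times the real part.
    have h5 : (D (imT (Z - Z'))).2 = Complex.I • (D (reT (Z - Z'))).2 := by
      have h6 : (D (reT (Z - Z'))).2 + Complex.I • (D (imT (Z - Z'))).2 = 0 := by
        rw [← h4, cvform, ← hD]
        simp [vform, hre, him]
      have h7 := congrArg (fun v : EF => Complex.I • v) h6
      simp only [smul_add, smul_smul, Complex.I_mul_I, neg_one_smul, smul_zero] at h7
      rw [← sub_eq_add_neg, sub_eq_zero] at h7
      exact h7.symm
    obtain ⟨ξ, hξ⟩ := translate_surjective q₀ hq (D (reT (Z - Z'))).2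
    have hinj : Function.Injective D := fun v w hvw => by
      rw [← md_symm_chart' (I := 𝓘(ℝ, EM).prod 𝓘(ℝ, EF)) q₀ hq v,
        ← md_symm_chart' (I := 𝓘(ℝ, EM).prod 𝓘(ℝ, EF)) q₀ hq w, ← hD, hvw]
    have hv : Z - Z' = cdiff 𝓘(ℝ, EF) (𝓘(ℝ, EM).prod 𝓘(ℝ, EF)) (fun f' : F => Assoc.mk B 𝓕 u f') f
          (ofT 𝓘(ℝ, EF) f ξ (Complex.I • ξ)) := by
      apply ctangent_ext (q := mk B 𝓕 u f)
      · apply hinj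
        rw [reT_cdiff, reT_ofT, hD, md_chart_md_mk_right q₀ hq, hξ]
        exact Prod.ext hre rfl
      · apply hinj
        rw [imT_cdiff, imT_ofT, hD, md_chart_md_mk_right q₀ hq, translate_smul q₀ hq, hξ, ← h5]
        exact Prod.ext him rfl
    have hw : VerticalAntiholomorphic B 𝓕 (mk B 𝓕 u f) (Z - Z') := by
      rw [hv]
      exact VerticalAntiholomorphic.intro u f ξ
    have h8 : Z = Z' + (Z - Z') := by abel
    rw [h8]
    exact Submodule.add_mem_sup (Submodule.subset_span hh) (Submodule.subset_span hw)

end Assoc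

end Characterization

/-! ### Smooth dependence of partial differentials on parameters. -/

section Parametric

variable {𝕜 : Type*} [NontriviallyNormedField 𝕜]
  {X E E' : Type*} [NormedAddCommGroup X] [NormedSpace 𝕜 X] [NormedAddCommGroup E] [NormedSpace 𝕜 E]
  [NormedAddCommGroup E'] [NormedSpace 𝕜 E']
  {N : Type*} [TopologicalSpace N] [ChartedSpace E N]

/-- The partial differential at `g` of a map depending on parameters. -/
def mfderivParam (𝕜 : Type*) [NontriviallyNormedField 𝕜] {X E E' N : Type*}
    [NormedAddCommGroup E] [NormedSpace 𝕜 E] [NormedAddCommGroup E'] [NormedSpace 𝕜 E']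
    [TopologicalSpace N] [ChartedSpace E N] (h : X × N → E') (g : N) (x : X) : E →L[𝕜] E' :=
  mfderiv 𝓘(𝕜, E) 𝓘(𝕜, E') (fun g' => h (x, g')) g

/-- The partial differential at `g` of a map depending on parameters is smooth in the
parameters. -/
theorem contDiffAt_mfderiv_param {n : WithTop ℕ∞} (hn : n + 1 ≤ n) [IsManifold 𝓘(𝕜, E) n N]
    [IsManifold 𝓘(𝕜, E) 1 N] {h : X × N → E'} {x : X} {g : N}
    (hh : ContMDiffAt (𝓘(𝕜, X).prod 𝓘(𝕜, E)) 𝓘(𝕜, E') n h (x, g)) :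
    ContDiffAt 𝕜 n (mfderivParam (E := E) 𝕜 h g) x := by
  -- The condition `n + 1 ≤ n` holds for `∞` and `ω`: taking one derivative costs no regularity.
  have hn1 : 1 ≤ n := le_trans (by simp) hn
  have hn0 : n ≠ 0 := (lt_of_lt_of_le one_pos hn1).ne'
  set γ := extChartAt 𝓘(𝕜, E) g with hγ
  have hγs : ContMDiffAt 𝓘(𝕜, E) 𝓘(𝕜, E) n γ.symm (γ g) :=
    (contMDiffOn_extChartAt_symm g).contMDiffAt
      ((isOpen_extChartAt_target g).mem_nhds (mem_extChartAt_target g))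
  have h1 : ContMDiffAt 𝓘(𝕜, X × E) 𝓘(𝕜, E') n (fun z : X × E => h (z.1, γ.symm z.2)) (x, γ g) := by
    have h2 : ContMDiffAt 𝓘(𝕜, X × E) (𝓘(𝕜, X).prod 𝓘(𝕜, E)) n
        (fun z : X × E => (z.1, γ.symm z.2)) (x, γ g) :=
      contDiff_fst.contMDiff.contMDiffAt.prodMk
        (ContMDiffAt.comp (g := γ.symm) (x, γ g) hγs contDiff_snd.contMDiff.contMDiffAt)
    refine ContMDiffAt.comp (g := h) (x, γ g) ?_ h2
    rw [extChartAt_to_inv]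
    exact hh
  have h3 : ContDiffAt 𝕜 n (fun x' => fderiv 𝕜 (fun k => h (x', γ.symm k)) (γ g)) x :=
    ContDiffAt.fderiv (f := fun x' k => h (x', γ.symm k)) (g := fun _ => γ g)
      h1.contDiffAt contDiffAt_const hn
  refine h3.congr_of_eventuallyEq ?_
  have h4 : ∀ᶠ z in 𝓝 (x, g), ContMDiffAt (𝓘(𝕜, X).prod 𝓘(𝕜, E)) 𝓘(𝕜, E') 1 h z :=
    (contMDiffAt_iff_contMDiffAt_nhds (by simp)).1 (hh.of_le hn1)
  have h5 : Filter.Tendsto (fun x' : X => (x', g)) (𝓝 x) (𝓝 (x, g)) :=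
    (Continuous.prodMk continuous_id continuous_const).tendsto x
  filter_upwards [h5.eventually h4] with x' hx'
  have h6 : MDifferentiableAt 𝓘(𝕜, E) 𝓘(𝕜, E') (fun g' => h (x', g')) g :=
    (ContMDiffAt.comp (g := h) g hx' (contMDiffAt_const.prodMk contMDiffAt_id)).mdifferentiableAt
      one_ne_zero
  -- The chart at `g` is tangent to the identity at its centre, so the derivative in the chart is
  -- the intrinsic differential.
  have h7 : mfderiv 𝓘(𝕜, E) 𝓘(𝕜, E) γ.symm (γ g) = ContinuousLinearMap.id 𝕜 E := by
    have := mfderivWithin_range_extChartAt_symm (I := 𝓘(𝕜, E)) (x := g)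
    rwa [modelWithCornersSelf_coe, range_id, mfderivWithin_univ] at this
  have h8 : mfderiv 𝓘(𝕜, E) 𝓘(𝕜, E') (fun k => h (x', γ.symm k)) (γ g)
      = (mfderiv 𝓘(𝕜, E) 𝓘(𝕜, E') (fun g' => h (x', g')) (γ.symm (γ g))).comp
        (mfderiv 𝓘(𝕜, E) 𝓘(𝕜, E) γ.symm (γ g)) := by
    refine mfderiv_comp (g := fun g' => h (x', g')) (f := γ.symm) (γ g) ?_ (hγs.mdifferentiableAt hn0)
    rw [extChartAt_to_inv]
    exact h6
  rw [mfderiv_eq_fderiv, h7, extChartAt_to_inv] at h8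
  exact h8.symm

end Parametric

/-! ### Smoothness of the vertical part, and holomorphy of the infinitesimal action. -/

section Smoothness

variable {EM : Type*} [NormedAddCommGroup EM] [NormedSpace ℝ EM]
  {M : Type*} [TopologicalSpace M] [ChartedSpace EM M] [IsManifold 𝓘(ℝ, EM) ∞ M]
  {EG : Type*} [NormedAddCommGroup EG] [NormedSpace ℂ EG]
  {G : Type*} [Group G] [TopologicalSpace G] [ChartedSpace EG G] [LieGroup 𝓘(ℂ, EG) ω G]
  {EP : Type*} [NormedAddCommGroup EP] [NormedSpace ℝ EP]
  {P : Type*} [TopologicalSpace P] [ChartedSpace EP P] [IsManifold 𝓘(ℝ, EP) ∞ P]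
  {EF : Type*} [NormedAddCommGroup EF] [NormedSpace ℂ EF]
  {F : Type*} [TopologicalSpace F] [ChartedSpace EF F] [IsManifold 𝓘(ℂ, EF) ω F]
  {m r : ℕ} {Γ : ComplexLieSubgroup m EG G}

variable {B : PrincipalBundle EM M EG G EP P} {𝓕 : HomogeneousSubmanifold Γ r EF F}

/-- The pullback of the connection form by a smooth map of a vector space is smooth. -/
theorem Connection.contDiffOn_pullback {X : Type*} [NormedAddCommGroup X] [NormedSpace ℝ X]
    [FiniteDimensional ℝ X] (C : Connection B) {τ : X → P} {s : Set X} (hs : IsOpen s)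
    (hτ : ContMDiffOn 𝓘(ℝ, X) 𝓘(ℝ, EP) ∞ τ s) :
    ContDiffOn ℝ ∞ (fun x => (C.fm (τ x)).comp (md 𝓘(ℝ, X) 𝓘(ℝ, EP) τ x)) s := by
  -- As `X` is finite-dimensional, it suffices to evaluate on each fixed `v`; the value is then the
  -- connection form on the tangent map of `τ` applied to a constant field.
  rw [contDiffOn_clm_apply]
  intro v
  have h1 := hτ.contMDiffOn_tangentMapWithin (m := ∞) (by simp) hs.uniqueMDiffOn
  have h2 : ContMDiff 𝓘(ℝ, X) 𝓘(ℝ, X).tangent ∞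
      (fun x => (⟨x, v⟩ : TangentBundle 𝓘(ℝ, X) X)) :=
    contMDiff_vectorSpace_iff_contDiff.2 contDiff_const
  have h3 := C.contMDiff_form.comp_contMDiffOn (h1.comp h2.contMDiffOn (fun x hx => hx))
  refine (h3.contDiffOn).congr ?_
  intro x hx
  change C.fm (τ x) (mfderiv 𝓘(ℝ, X) 𝓘(ℝ, EP) τ x v) = C.fm (τ x)
    (mfderivWithin 𝓘(ℝ, X) 𝓘(ℝ, EP) τ s x v)
  rw [mfderivWithin_of_isOpen hs hx]

namespace Assoc

variable (q₀ : Assoc B 𝓕)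

theorem contDiffAt_locForm [FiniteDimensional ℝ EM] (C : Connection B) {x : EM}
    (hx : x ∈ (extChartAt 𝓘(ℝ, EM) (proj q₀)).target)
    (hx' : (extChartAt 𝓘(ℝ, EM) (proj q₀)).symm x ∈ (sect q₀).domain) :
    ContDiffAt ℝ ∞ (locForm q₀ C) x := by
  have ho : IsOpen ((extChartAt 𝓘(ℝ, EM) (proj q₀)).target ∩
      (extChartAt 𝓘(ℝ, EM) (proj q₀)).symm ⁻¹' (sect q₀).domain) :=
    (contMDiffOn_chart_symm (I := 𝓘(ℝ, EM)) (proj q₀)).continuousOn.isOpen_inter_preimage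
      (isOpen_extChartAt_target _) (sect q₀).isOpen_domain
  exact (C.contDiffOn_pullback ho fun x hx =>
    (contMDiffAt_locSec q₀ hx.1 hx.2).contMDiffWithinAt).contDiffAt (ho.mem_nhds ⟨hx, hx'⟩)

/-- The infinitesimal action, as a complex linear map. -/
def infActC (z : EF) : EG →L[ℂ] EF :=
  mfderiv 𝓘(ℂ, EG) 𝓘(ℂ, EF) (fun g : G => extChartAt 𝓘(ℝ, EF) (fibPt q₀)
    (𝓕.smul g ((extChartAt 𝓘(ℝ, EF) (fibPt q₀)).symm z))) 1

theorem contMDiffAt_infAct_aux {z : EF} (hz : z ∈ (extChartAt 𝓘(ℝ, EF) (fibPt q₀)).target) :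
    ContMDiffAt (𝓘(ℂ, EF).prod 𝓘(ℂ, EG)) 𝓘(ℂ, EF) ω
      (fun w : EF × G => extChartAt 𝓘(ℝ, EF) (fibPt q₀)
        (𝓕.smul w.2 ((extChartAt 𝓘(ℝ, EF) (fibPt q₀)).symm w.1))) (z, 1) := by
  have h1 : ContMDiffAt (𝓘(ℂ, EF).prod 𝓘(ℂ, EG)) 𝓘(ℂ, EF) ω
      (fun w : EF × G => 𝓕.smul w.2 ((extChartAt 𝓘(ℝ, EF) (fibPt q₀)).symm w.1)) (z, 1) :=
    (𝓕.contMDiff_smul _).comp (z, (1 : G)) (contMDiffAt_snd.prodMk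
      ((contMDiffAt_complex_chart_symm (fibPt q₀) hz).comp (z, (1 : G)) contMDiffAt_fst))
  refine ContMDiffAt.comp (g := extChartAt 𝓘(ℝ, EF) (fibPt q₀)) (z, (1 : G)) ?_ h1
  rw [𝓕.smul_one]
  exact contMDiffAt_complex_chart (fibPt q₀) ((extChartAt 𝓘(ℝ, EF) (fibPt q₀)).map_target hz)

theorem infAct_eq {z : EF} (hz : z ∈ (extChartAt 𝓘(ℝ, EF) (fibPt q₀)).target) :
    infAct q₀ z = (infActC q₀ z).restrictScalars ℝ := by
  ext c
  refine md_eq_mfderiv_complex ?_ c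
  exact ((contMDiffAt_infAct_aux q₀ hz).comp (1 : G)
    (contMDiffAt_const.prodMk contMDiffAt_id)).mdifferentiableAt (by simp)

theorem contDiffAt_infActC {z : EF} (hz : z ∈ (extChartAt 𝓘(ℝ, EF) (fibPt q₀)).target) :
    ContDiffAt ℂ ω (infActC q₀) z :=
  contDiffAt_mfderiv_param (by simp) (contMDiffAt_infAct_aux q₀ hz)

theorem contDiffAt_infAct {z : EF} (hz : z ∈ (extChartAt 𝓘(ℝ, EF) (fibPt q₀)).target) :
    ContDiffAt ℝ ∞ (infAct q₀) z := by
  have h1 : ContDiffAt ℝ ∞ (infActC q₀) z :=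
    ((contDiffAt_infActC q₀ hz).restrict_scalars ℝ).of_le le_top
  have h2 : ContDiffAt ℝ ∞ (fun z => (infActC q₀ z).restrictScalars ℝ) z :=
    (ContinuousLinearMap.restrictScalarsL ℂ EG EF ℝ ℝ).contDiff.contDiffAt.comp z h1
  refine h2.congr_of_eventuallyEq ?_
  filter_upwards [(isOpen_extChartAt_target (I := 𝓘(ℝ, EF)) (fibPt q₀)).mem_nhds hz] with z' hz'
  exact infAct_eq q₀ hz'

/-- The action is jointly holomorphic on G × F, so the infinitesimal action depends holomorphically
on the point of F. Through `extd_vform_vertical` this removes the (0,1) vertical vectors from the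
bracket computation. -/
theorem fderiv_infAct_smul {z : EF} (hz : z ∈ (extChartAt 𝓘(ℝ, EF) (fibPt q₀)).target)
    (k : ℂ) (ζ : EF) (c : EG) :
    fderiv ℝ (infAct q₀) z (k • ζ) c = k • fderiv ℝ (infAct q₀) z ζ c := by
  have h1 : DifferentiableAt ℂ (fun z => infActC q₀ z c) z :=
    ((contDiffAt_infActC q₀ hz).differentiableAt (by simp)).clm_apply (differentiableAt_const c)
  have h2 : HasFDerivAt (fun z => infAct q₀ z c)
      ((fderiv ℂ (fun z => infActC q₀ z c) z).restrictScalars ℝ) z := by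
    refine (h1.hasFDerivAt.restrictScalars ℝ).congr_of_eventuallyEq ?_
    filter_upwards [(isOpen_extChartAt_target (I := 𝓘(ℝ, EF)) (fibPt q₀)).mem_nhds hz] with z' hz'
    rw [infAct_eq q₀ hz']
    rfl
  have h3 := ((contDiffAt_infAct q₀ hz).differentiableAt (by simp)).hasFDerivAt.clm_apply
    (hasFDerivAt_const c z)
  have h4 : ∀ ζ, fderiv ℝ (infAct q₀) z ζ c = fderiv ℂ (fun z => infActC q₀ z c) z ζ := by
    intro ζ
    have h5 := congrArg (fun L : EF →L[ℝ] EF => L ζ) (h3.unique h2)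
    simpa using h5
  rw [h4, h4, map_smul]

theorem contDiffAt_vform [FiniteDimensional ℝ EM] (C : Connection B) {y : EM × EF}
    (hy : y ∈ (extChartAt (𝓘(ℝ, EM).prod 𝓘(ℝ, EF)) q₀).target) :
    ContDiffAt ℝ ∞ (vform q₀ C) y := by
  obtain ⟨h1, h2, h3⟩ := (mem_target_iff q₀).1 hy
  refine contDiffAt_const.add (ContDiffAt.clm_comp (ContDiffAt.clm_comp ?_ ?_) contDiffAt_const)
  · exact (contDiffAt_infAct q₀ h3).comp y contDiffAt_snd
  · exact (contDiffAt_locForm q₀ C h1 h2).comp y contDiffAt_fst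

/-- The exterior derivative of the vertical part, on a vertical vector. -/
theorem extd_vform_vertical [FiniteDimensional ℝ EM] (C : Connection B) {y : EM × EF}
    (hy : y ∈ (extChartAt (𝓘(ℝ, EM).prod 𝓘(ℝ, EF)) q₀).target) (ζ : EF) (w : EM × EF) :
    extd (vform q₀ C) y (0, ζ) w = fderiv ℝ (infAct q₀) y.2 ζ (locForm q₀ C y.1 w.1) := by
  obtain ⟨h1, h2, h3⟩ := (mem_target_iff q₀).1 hy
  have ha : HasFDerivAt (fun y : EM × EF => infAct q₀ y.2)
      ((fderiv ℝ (infAct q₀) y.2).comp (ContinuousLinearMap.snd ℝ EM EF)) y :=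
    ((contDiffAt_infAct q₀ h3).differentiableAt (by simp)).hasFDerivAt.comp y hasFDerivAt_snd
  have hb : HasFDerivAt (fun y : EM × EF => locForm q₀ C y.1)
      ((fderiv ℝ (locForm q₀ C) y.1).comp (ContinuousLinearMap.fst ℝ EM EF)) y :=
    ((contDiffAt_locForm q₀ C h1 h2).differentiableAt (by simp)).hasFDerivAt.comp y hasFDerivAt_fst
  have hv : ∀ v w : EM × EF, fderiv ℝ (vform q₀ C) y v w
      = fderiv ℝ (infAct q₀) y.2 v.2 (locForm q₀ C y.1 w.1)
        + infAct q₀ y.2 (fderiv ℝ (locForm q₀ C) y.1 v.1 w.1) := by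
    intro v w
    have h4 := (((contDiffAt_vform q₀ C hy).differentiableAt (by simp)).hasFDerivAt.clm_apply
      (hasFDerivAt_const w y))
    have h5 : HasFDerivAt (fun y => vform q₀ C y w) _ y :=
      (hasFDerivAt_const w.2 y).add (ha.clm_apply (hb.clm_apply (hasFDerivAt_const w.1 y)))
    have h6 := congrArg (fun L : EM × EF →L[ℝ] EF => L v) (h4.unique h5)
    simp at h6
    rw [h6]
    abel
  unfold extd
  -- The base component of `(0, ζ)` is zero, so only the term differentiating the infinitesimal
  -- action along `ζ` survives.
  rw [hv, hv]
  simp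

end Assoc

end Smoothness

/-! ### Exterior derivative and pullback. -/

section Pullback

variable {E E' U V : Type*} [NormedAddCommGroup E] [NormedSpace ℝ E]
  [NormedAddCommGroup E'] [NormedSpace ℝ E'] [NormedAddCommGroup U] [NormedSpace ℂ U]
  [NormedAddCommGroup V] [NormedSpace ℝ V]

/-- If `κ^*Φ = n ∘ α`, then `dΦ(κ_* v, κ_* w) = n(dα(v, w))` for `v` and `w` in the kernel of `α`. -/
theorem extd_of_pullback {Φ : E' → E' →L[ℝ] U} {κ : E → E'} {n : E → V →L[ℝ] U}
    {α : E → E →L[ℝ] V} {x : E} (hΦ : DifferentiableAt ℝ Φ (κ x)) (hκ : ContDiffAt ℝ ∞ κ x)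
    (hn : DifferentiableAt ℝ n x) (hα : DifferentiableAt ℝ α x)
    (h : ∀ᶠ y in 𝓝 x, (Φ (κ y)).comp (fderiv ℝ κ y) = (n y).comp (α y)) {v w : E}
    (hv : α x v = 0) (hw : α x w = 0) :
    extd Φ (κ x) (fderiv ℝ κ x v) (fderiv ℝ κ x w) = n x (fderiv ℝ α x v w - fderiv ℝ α x w v) := by
  have hκ1 : DifferentiableAt ℝ κ x := hκ.differentiableAt (by simp)
  have hκ2 : DifferentiableAt ℝ (fderiv ℝ κ) x :=
    (hκ.fderiv_right (m := ∞) (by simp)).differentiableAt (by simp)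
  have h1 := (hΦ.hasFDerivAt.comp x hκ1.hasFDerivAt).clm_comp hκ2.hasFDerivAt
  have h2 := (hn.hasFDerivAt.clm_comp hα.hasFDerivAt).congr_of_eventuallyEq h
  -- Both sides of the pullback identity are differentiated in direction `a` and evaluated on `b`.
  have key : ∀ a b : E, fderiv ℝ Φ (κ x) (fderiv ℝ κ x a) (fderiv ℝ κ x b)
      + Φ (κ x) (fderiv ℝ (fderiv ℝ κ) x a b)
      = n x (fderiv ℝ α x a b) + fderiv ℝ n x a (α x b) := by
    intro a b
    have h3 := congrArg (fun L : E →L[ℝ] E →L[ℝ] U => L a b) (h1.unique h2)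
    simp at h3
    rw [← h3]
    abel
  -- The second derivative of `κ` is symmetric, so it cancels in the exterior derivative.
  have hsymm : fderiv ℝ (fderiv ℝ κ) x v w = fderiv ℝ (fderiv ℝ κ) x w v :=
    (hκ.isSymmSndFDerivAt (by simpa using WithTop.coe_le_coe.2 (le_top (a := (2 : ℕ∞))))).eq v w
  have h3 := key v w
  have h4 := key w v
  -- The derivative of `n` only occurs multiplied by `α v` or `α w`, which vanish.
  rw [hw, map_zero, add_zero] at h3
  rw [hv, map_zero, add_zero, ← hsymm] at h4
  rw [map_sub, ← h3, ← h4, extd]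
  abel

end Pullback

/-! ### Manifold differentials as derivatives in the chart. -/

section Chart

variable {E H N E' : Type*} [NormedAddCommGroup E] [NormedSpace ℝ E] [TopologicalSpace H]
  [NormedAddCommGroup E'] [NormedSpace ℝ E']
  [TopologicalSpace N] [ChartedSpace H N] {I : ModelWithCorners ℝ E H} [I.Boundaryless]
  [IsManifold I ∞ N] (q₀ : N)

/-- The inverse chart is tangent to the identity at the centre, so the derivative read in the chart
is the manifold differential itself. -/
theorem hasFDerivAt_chart {f : N → E'} (hf : MDifferentiableAt I 𝓘(ℝ, E') f q₀) :
    HasFDerivAt (fun y => f ((extChartAt I q₀).symm y)) (md I 𝓘(ℝ, E') f q₀)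
      (extChartAt I q₀ q₀) := by
  have h1 : MDifferentiableAt 𝓘(ℝ, E) I (extChartAt I q₀).symm (extChartAt I q₀ q₀) :=
    (contMDiffAt_chart_symm q₀ (mem_extChartAt_target q₀)).mdifferentiableAt infinity_ne_zero
  have h2 : MDifferentiableAt I 𝓘(ℝ, E') f ((extChartAt I q₀).symm (extChartAt I q₀ q₀)) := by
    rwa [extChartAt_to_inv]
  have h3 : md 𝓘(ℝ, E) 𝓘(ℝ, E') (fun y => f ((extChartAt I q₀).symm y)) (extChartAt I q₀ q₀)
      = md I 𝓘(ℝ, E') f q₀ := by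
    ext v
    rw [md_comp_apply h2 h1, md_symm_self, extChartAt_to_inv]
  rw [← h3, md_eq_fderiv]
  exact (MDifferentiableAt.comp _ h2 h1).differentiableAt.hasFDerivAt

end Chart

/-! ### Curvature as the exterior derivative of the vertical part, and stabilizers of subspaces. -/

section Curvature

variable {EM : Type*} [NormedAddCommGroup EM] [NormedSpace ℝ EM]
  {M : Type*} [TopologicalSpace M] [ChartedSpace EM M] [IsManifold 𝓘(ℝ, EM) ∞ M]
  {EG : Type*} [NormedAddCommGroup EG] [NormedSpace ℂ EG]
  {G : Type*} [Group G] [TopologicalSpace G] [ChartedSpace EG G] [LieGroup 𝓘(ℂ, EG) ω G]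
  {EP : Type*} [NormedAddCommGroup EP] [NormedSpace ℝ EP]
  {P : Type*} [TopologicalSpace P] [ChartedSpace EP P] [IsManifold 𝓘(ℝ, EP) ∞ P]
  {EF : Type*} [NormedAddCommGroup EF] [NormedSpace ℂ EF]
  {F : Type*} [TopologicalSpace F] [ChartedSpace EF F] [IsManifold 𝓘(ℂ, EF) ω F]
  {m r : ℕ} {Γ : ComplexLieSubgroup m EG G}

variable {B : PrincipalBundle EM M EG G EP P} {𝓕 : HomogeneousSubmanifold Γ r EF F}

namespace Assoc

variable (q₀ : Assoc B 𝓕)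

theorem contMDiffAt_gauge_aux {X : Type*} [NormedAddCommGroup X] [NormedSpace ℝ X] {τ : X → P}
    {x : X} {f : F} (hτ : ContMDiffAt 𝓘(ℝ, X) 𝓘(ℝ, EP) ∞ τ x)
    (h : mk B 𝓕 (τ x) f ∈ (extChartAt (𝓘(ℝ, EM).prod 𝓘(ℝ, EF)) q₀).source) :
    ContMDiffAt (𝓘(ℝ, X).prod 𝓘(ℝ, EG)) 𝓘(ℝ, EF) ∞
      (fun w : X × G => extChartAt 𝓘(ℝ, EF) (fibPt q₀)
        (𝓕.smul ((sect q₀).coord (τ w.1)) (𝓕.smul w.2 f))) (x, 1) := by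
  have hF : IsManifold 𝓘(ℝ, EF) ∞ F := isManifold_fibre 𝓕
  obtain ⟨h1, h2, h3⟩ := (mem_source_iff q₀).1 h
  have h4 : ContMDiffAt 𝓘(ℝ, X) 𝓘(ℝ, EG) ∞ (fun x => (sect q₀).coord (τ x)) x :=
    (contMDiffAt_coord q₀ h1).comp x hτ
  have h5 : ContMDiffAt (𝓘(ℝ, X).prod 𝓘(ℝ, EG)) 𝓘(ℝ, EF) ∞
      (fun w : X × G => 𝓕.smul ((sect q₀).coord (τ w.1)) (𝓕.smul w.2 f)) (x, 1) :=
    (𝓕.contMDiff_smul_real _).comp (x, (1 : G))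
      ((h4.comp (x, (1 : G)) contMDiffAt_fst).prodMk
        ((𝓕.contMDiff_orbit_real f _).comp (x, (1 : G)) contMDiffAt_snd))
  refine ContMDiffAt.comp (g := extChartAt 𝓘(ℝ, EF) (fibPt q₀)) (x, (1 : G)) ?_ h5
  rw [𝓕.smul_one]
  exact contMDiffAt_chart (fibPt q₀) h3

theorem contDiffAt_gauge {X : Type*} [NormedAddCommGroup X] [NormedSpace ℝ X] {τ : X → P}
    {x : X} {f : F} (hτ : ContMDiffAt 𝓘(ℝ, X) 𝓘(ℝ, EP) ∞ τ x)
    (h : mk B 𝓕 (τ x) f ∈ (extChartAt (𝓘(ℝ, EM).prod 𝓘(ℝ, EF)) q₀).source) :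
    ContDiffAt ℝ ∞ (fun x => gauge q₀ (τ x) f) x := by
  have hG : IsManifold 𝓘(ℝ, EG) ∞ G := isManifold_real inferInstance
  exact contDiffAt_mfderiv_param (by simp) (contMDiffAt_gauge_aux q₀ hτ h)

/-- The exterior derivative of the vertical part, on horizontal vectors, is given by the curvature
form. -/
theorem extd_vform_horizontal [FiniteDimensional ℝ EM] [FiniteDimensional ℝ EP]
    (C : Connection B) {u : P} {f : F}
    (h : mk B 𝓕 u f ∈ (extChartAt (𝓘(ℝ, EM).prod 𝓘(ℝ, EF)) q₀).source) {V W : EP}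
    (hV : C.fm u V = 0) (hW : C.fm u W = 0) :
    extd (vform q₀ C) (kap q₀ (u, f))
        (md 𝓘(ℝ, EP) 𝓘(ℝ, EM × EF) (fun u' => kap q₀ (u', f)) u V)
        (md 𝓘(ℝ, EP) 𝓘(ℝ, EM × EF) (fun u' => kap q₀ (u', f)) u W)
      = gauge q₀ u f (C.dForm u V W) := by
  set w := (extChartAt 𝓘(ℝ, EP) u).symm with hw
  set e₀ := extChartAt 𝓘(ℝ, EP) u u with he₀
  have hwe : w e₀ = u := extChartAt_to_inv u
  have hwd : ContMDiffAt 𝓘(ℝ, EP) 𝓘(ℝ, EP) ∞ w e₀ :=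
    contMDiffAt_chart_symm u (mem_extChartAt_target u)
  have hkd : ∀ {u' : P}, mk B 𝓕 u' f ∈ (extChartAt (𝓘(ℝ, EM).prod 𝓘(ℝ, EF)) q₀).source →
      ContMDiffAt 𝓘(ℝ, EP) 𝓘(ℝ, EM × EF) ∞ (fun u' => kap q₀ (u', f)) u' := fun {u'} h =>
    ContMDiffAt.comp (g := kap q₀) (f := fun u' => (u', f)) u' (contMDiffAt_kap q₀ h)
      (contMDiffAt_id.prodMk contMDiffAt_const)
  have hk : HasFDerivAt (fun e => kap q₀ (w e, f))
      (md 𝓘(ℝ, EP) 𝓘(ℝ, EM × EF) (fun u' => kap q₀ (u', f)) u) e₀ :=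
    hasFDerivAt_chart u ((hkd h).mdifferentiableAt infinity_ne_zero)
  have hα : ContDiffOn ℝ ∞ (C.chartForm u) (extChartAt 𝓘(ℝ, EP) u).target :=
    C.contDiffOn_pullback (isOpen_extChartAt_target u) (contMDiffOn_chart_symm u)
  have hα0 : ∀ V : EP, C.chartForm u e₀ V = C.fm u V := by
    intro V
    change C.fm (w e₀) (md 𝓘(ℝ, EP) 𝓘(ℝ, EP) w e₀ V) = _
    rw [md_symm_self, hwe]
  have hev : ∀ᶠ e in 𝓝 e₀, e ∈ (extChartAt 𝓘(ℝ, EP) u).target ∧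
      mk B 𝓕 (w e) f ∈ (extChartAt (𝓘(ℝ, EM).prod 𝓘(ℝ, EF)) q₀).source := by
    refine Filter.Eventually.and ((isOpen_extChartAt_target u).mem_nhds (mem_extChartAt_target u)) ?_
    have h1 : Filter.Tendsto (fun e => (w e, f)) (𝓝 e₀) (𝓝 (u, f)) := by
      have := hwd.continuousAt.prodMk (continuousAt_const (y := f))
      rwa [ContinuousAt, hwe] at this
    exact h1.eventually (eventually_mk_mem q₀ h)
  have h' : mk B 𝓕 (w e₀) f ∈ (extChartAt (𝓘(ℝ, EM).prod 𝓘(ℝ, EF)) q₀).source := by rwa [hwe]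
  -- P is read in the chart at `u` in which `dForm` is computed. There `vform_md_kap` is the
  -- identity κ^*ϑ = n ∘ α with n the map `gauge`, and V and W lie in the kernel of α.
  have h1 := extd_of_pullback (Φ := vform q₀ C) (κ := fun e => kap q₀ (w e, f))
    (n := fun e => gauge q₀ (w e) f) (α := C.chartForm u) (x := e₀) (v := V) (w := W)
    ((contDiffAt_vform q₀ C (kap_mem_target q₀ h')).differentiableAt (by simp))
    (ContMDiffAt.comp (g := fun u' => kap q₀ (u', f)) e₀ (hkd h') hwd).contDiffAt
    ((contDiffAt_gauge q₀ hwd h').differentiableAt (by simp))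
    ((hα.contDiffAt ((isOpen_extChartAt_target u).mem_nhds
      (mem_extChartAt_target u))).differentiableAt (by simp))
    (by
      filter_upwards [hev] with e he
      ext1 V
      have h2 := vform_md_kap q₀ C he.2 (md 𝓘(ℝ, EP) 𝓘(ℝ, EP) w e V)
      have h3 := md_comp_apply (g := fun u' => kap q₀ (u', f)) (f := w)
        ((hkd he.2).mdifferentiableAt infinity_ne_zero)
        ((contMDiffAt_chart_symm u he.1).mdifferentiableAt infinity_ne_zero) V
      rw [md_eq_fderiv] at h3
      rw [← h3] at h2
      exact h2)
    (by rw [hα0, hV]) (by rw [hα0, hW])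
  rw [hk.fderiv] at h1
  simp only [hwe] at h1
  exact h1

/-- The `gauge` map is complex linear. -/
theorem gauge_smul {u : P} {f : F}
    (h : mk B 𝓕 u f ∈ (extChartAt (𝓘(ℝ, EM).prod 𝓘(ℝ, EF)) q₀).source) (k : ℂ) (c : EG) :
    gauge q₀ u f (k • c) = k • gauge q₀ u f c := by
  refine md_smul_complex ?_ k c
  have h1 := ((𝓕.contMDiff_translate ((sect q₀).coord u)).comp (𝓕.contMDiff_orbit f)) (1 : G)
  refine (ContMDiffAt.comp (g := extChartAt 𝓘(ℝ, EF) (fibPt q₀)) (1 : G) ?_ h1).mdifferentiableAt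
    (by simp)
  simp only [Function.comp_apply, 𝓕.smul_one]
  exact contMDiffAt_complex_chart _ ((mem_source_iff q₀).1 h).2.2

/-- `gauge` is the differential of the orbit map followed by that of a translation and a chart of F,
both of which are invertible. -/
theorem gauge_eq_zero_iff {u : P} {f : F}
    (h : mk B 𝓕 u f ∈ (extChartAt (𝓘(ℝ, EM).prod 𝓘(ℝ, EF)) q₀).source) (c : EG) :
    gauge q₀ u f c = 0 ↔ md 𝓘(ℝ, EG) 𝓘(ℝ, EF) (fun g : G => 𝓕.smul g f) 1 c = 0 := by
  have hF : IsManifold 𝓘(ℝ, EF) ∞ F := isManifold_fibre 𝓕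
  obtain ⟨h1, h2, h3⟩ := (mem_source_iff q₀).1 h
  set g := (sect q₀).coord u with hg
  set ψ := extChartAt 𝓘(ℝ, EF) (fibPt q₀) with hψ
  have ho : MDifferentiableAt 𝓘(ℝ, EG) 𝓘(ℝ, EF) (fun h : G => 𝓕.smul h f) 1 :=
    (𝓕.contMDiff_orbit_real f 1).mdifferentiableAt infinity_ne_zero
  have ht : MDifferentiableAt 𝓘(ℝ, EF) 𝓘(ℝ, EF) (fun f' => ψ (𝓕.smul g f')) (𝓕.smul 1 f) := by
    rw [𝓕.smul_one]
    exact ((contMDiffAt_chart (fibPt q₀) h3).comp f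
      (𝓕.contMDiff_translate_real g f)).mdifferentiableAt infinity_ne_zero
  have hgauge : gauge q₀ u f c = md 𝓘(ℝ, EF) 𝓘(ℝ, EF) (fun f' => ψ (𝓕.smul g f')) (𝓕.smul 1 f)
      (md 𝓘(ℝ, EG) 𝓘(ℝ, EF) (fun g : G => 𝓕.smul g f) 1 c) :=
    md_comp_apply (g := fun f' => ψ (𝓕.smul g f')) (f := fun h : G => 𝓕.smul h f) ht ho c
  constructor
  · intro h0
    -- Applying `z ↦ g⁻¹ · ψ⁻¹(z)` undoes the translation and the chart and recovers the orbit map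
    -- near 1.
    have hb : MDifferentiableAt 𝓘(ℝ, EF) 𝓘(ℝ, EF) (fun z => 𝓕.smul g⁻¹ (ψ.symm z))
        (ψ (𝓕.smul g (𝓕.smul 1 f))) := by
      rw [𝓕.smul_one]
      exact ((𝓕.contMDiff_translate_real g⁻¹ _).comp _ (contMDiffAt_chart_symm (fibPt q₀)
        (ψ.map_source h3))).mdifferentiableAt infinity_ne_zero
    have h4 := md_comp_apply (g := fun z => 𝓕.smul g⁻¹ (ψ.symm z))
      (f := fun h : G => ψ (𝓕.smul g (𝓕.smul h f))) hb (MDifferentiableAt.comp (g := fun f' => ψ (𝓕.smul g f')) (1 : G) ht ho) c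
    change _ = md 𝓘(ℝ, EF) 𝓘(ℝ, EF) _ _ (gauge q₀ u f c) at h4
    rw [h0, map_zero] at h4
    rw [← h4]
    refine congrArg (fun L : EG →L[ℝ] EF => L c) (md_congr ?_)
    have hc : ContinuousAt (fun h : G => 𝓕.smul g (𝓕.smul h f)) 1 :=
      (((𝓕.contMDiff_translate_real g).comp (𝓕.contMDiff_orbit_real f)).continuous).continuousAt
    have hs : ∀ᶠ f' in 𝓝 (𝓕.smul g (𝓕.smul 1 f)), f' ∈ ψ.source := by
      rw [𝓕.smul_one]
      exact (isOpen_extChartAt_source (I := 𝓘(ℝ, EF)) (fibPt q₀)).mem_nhds h3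
    filter_upwards [hc.eventually hs] with h hh
    rw [ψ.left_inv hh, ← 𝓕.smul_mul, inv_mul_cancel, 𝓕.smul_one]
  · intro h0
    rw [hgauge, h0, map_zero]

end Assoc

/-- The vector field on `F` given by an element of the Lie algebra vanishes at `f` if and only if
the element preserves the subspace `f`. -/
theorem md_orbit_eq_zero_iff (𝓕 : HomogeneousSubmanifold Γ r EF F) (f : F) (c : EG) :
    md 𝓘(ℝ, EG) 𝓘(ℝ, EF) (fun g : G => 𝓕.smul g f) 1 c = 0 ↔
      ∀ w ∈ (𝓕.incl f).1, Γ.lieRep c w ∈ (𝓕.incl f).1 := by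
  have hG : IsManifold 𝓘(ℝ, EG) ∞ G := isManifold_real inferInstance
  have hGr : IsManifold 𝓘(ℝ, GrModel r m) ∞ (Gr r m) := isManifold_real inferInstance
  set W₀ := 𝓕.incl f with hW₀
  -- This is the very splitting chosen for the preferred chart at `W₀`, so that `ψ.symm` is
  -- `graphPoint e` by definition.
  set e := (exists_mem_grChart_source W₀).choose with he
  set ψ := extChartAt 𝓘(ℝ, GrModel r m) W₀ with hψ
  have hsrc : ∀ W : Gr r m, W ∈ ψ.source → graphPoint e (ψ W) = W := by
    intro W hW
    exact ψ.left_inv hW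
  set A : G → GrModel r m := fun g => ψ (𝓕.incl (𝓕.smul g f)) with hA
  have hi : ContMDiff 𝓘(ℝ, EF) 𝓘(ℝ, GrModel r m) ∞ 𝓕.incl := fun f =>
    contMDiffAt_real (𝓕.contMDiff_incl f)
  have ho := 𝓕.contMDiff_orbit_real f
  have hψd : ContMDiffAt 𝓘(ℝ, GrModel r m) 𝓘(ℝ, GrModel r m) ∞ ψ W₀ :=
    contMDiffAt_chart W₀ (mem_extChartAt_source W₀)
  have h1f : 𝓕.incl (𝓕.smul 1 f) = W₀ := by rw [𝓕.smul_one]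
  have hAd : MDifferentiableAt 𝓘(ℝ, EG) 𝓘(ℝ, GrModel r m) A 1 := by
    have h1 : ContMDiffAt 𝓘(ℝ, EG) 𝓘(ℝ, GrModel r m) ∞ (fun g => 𝓕.incl (𝓕.smul g f)) (1 : G) :=
      (hi.comp ho) 1
    refine (ContMDiffAt.comp (g := ψ) (1 : G) ?_ h1).mdifferentiableAt infinity_ne_zero
    rw [h1f]
    exact hψd
  -- the differential of `A` vanishes exactly where that of the orbit map does
  have hAiff : md 𝓘(ℝ, EG) 𝓘(ℝ, GrModel r m) A 1 c = 0 ↔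
      md 𝓘(ℝ, EG) 𝓘(ℝ, EF) (fun g : G => 𝓕.smul g f) 1 c = 0 := by
    have h1 : md 𝓘(ℝ, EG) 𝓘(ℝ, GrModel r m) A 1 c
        = md 𝓘(ℝ, GrModel r m) 𝓘(ℝ, GrModel r m) ψ W₀
          (md 𝓘(ℝ, EF) 𝓘(ℝ, GrModel r m) 𝓕.incl f
            (md 𝓘(ℝ, EG) 𝓘(ℝ, EF) (fun g : G => 𝓕.smul g f) 1 c)) := by
      have h2 := md_comp_apply (g := 𝓕.incl) (f := fun g : G => 𝓕.smul g f) (x := 1)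
        ((hi _).mdifferentiableAt infinity_ne_zero) ((ho 1).mdifferentiableAt infinity_ne_zero) c
      have h3 := md_comp_apply (g := ψ) (f := fun g : G => 𝓕.incl (𝓕.smul g f)) (x := 1)
        (by rw [h1f]; exact hψd.mdifferentiableAt infinity_ne_zero)
        (((hi.comp ho) 1).mdifferentiableAt infinity_ne_zero) c
      rw [h2] at h3
      simp only [𝓕.smul_one] at h3
      exact h3
    rw [h1, md_chart_self]
    have h2 : ∀ v : EF, md 𝓘(ℝ, EF) 𝓘(ℝ, GrModel r m) 𝓕.incl f v
        = mfderiv 𝓘(ℂ, EF) 𝓘(ℂ, GrModel r m) 𝓕.incl f v := fun v =>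
      md_eq_mfderiv_complex ((𝓕.contMDiff_incl f).mdifferentiableAt (by simp)) v
    constructor
    · intro h3
      apply 𝓕.immersion_incl f
      refine (h2 _).symm.trans (h3.trans ?_)
      exact ((h2 0).symm.trans (map_zero _)).symm
    · intro h3
      rw [h3, map_zero]
  rw [← hAiff]
  have hRd : MDifferentiableAt 𝓘(ℝ, EG) 𝓘(ℝ, (Fin m → ℂ) →L[ℂ] (Fin m → ℂ))
      (fun g : G => (Γ.rep g : (Fin m → ℂ) →L[ℂ] (Fin m → ℂ))) 1 := by
    have h1 : ContMDiff 𝓘(ℂ, EG) 𝓘(ℂ, (Fin m → ℂ) →L[ℂ] (Fin m → ℂ)) ω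
        (fun g : G => (Γ.rep g : (Fin m → ℂ) →L[ℂ] (Fin m → ℂ))) :=
      Units.contMDiff_val.comp Γ.contMDiff_rep
    exact (contMDiffAt_real (h1 1)).mdifferentiableAt infinity_ne_zero
  have hA' := hasFDerivAt_chart (I := 𝓘(ℝ, EG)) (1 : G) hAd
  have hR' := hasFDerivAt_chart (I := 𝓘(ℝ, EG)) (1 : G) hRd
  set γ := (extChartAt 𝓘(ℝ, EG) (1 : G)).symm with hγ
  set x₀ := extChartAt 𝓘(ℝ, EG) (1 : G) 1 with hx₀
  have hγ0 : γ x₀ = 1 := extChartAt_to_inv (1 : G)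
  set L₁ : (Fin m → ℂ) →L[ℂ] (Fin r → ℂ) :=
    (ContinuousLinearMap.fst ℂ (Fin r → ℂ) (Fin (m - r) → ℂ)).comp (e.symm : _ →L[ℂ] _) with hL₁
  set L₂ : (Fin m → ℂ) →L[ℂ] (Fin (m - r) → ℂ) :=
    (ContinuousLinearMap.snd ℂ (Fin r → ℂ) (Fin (m - r) → ℂ)).comp (e.symm : _ →L[ℂ] _) with hL₂
  -- In the splitting `e`, the subspace is the graph of `A'`, so membership is the linear equation
  -- `L₂ w = A' (L₁ w)`.
  have hmem : ∀ (A' : GrModel r m) (w : Fin m → ℂ),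
      w ∈ (graphPoint e A').1 ↔ L₂ w = A' (L₁ w) := by
    intro A' w
    constructor
    · rintro ⟨k, rfl⟩
      simp [hL₁, hL₂, graphMap]
    · intro h
      refine ⟨L₁ w, ?_⟩
      change e (L₁ w, A' (L₁ w)) = w
      rw [← h]
      exact e.apply_symm_apply w
  have hA0 : graphPoint e (A 1) = W₀ := by
    change graphPoint e (ψ (𝓕.incl (𝓕.smul 1 f))) = W₀
    rw [h1f]
    exact hsrc W₀ (mem_extChartAt_source W₀)
  -- For `w` in `W₀` the vector `g w` lies in `g · W₀`, the graph of `A g`.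
  have hgr : ∀ᶠ g in 𝓝 (1 : G), ∀ w ∈ W₀.1,
      L₂ ((Γ.rep g : (Fin m → ℂ) →L[ℂ] (Fin m → ℂ)) w)
        = A g (L₁ ((Γ.rep g : (Fin m → ℂ) →L[ℂ] (Fin m → ℂ)) w)) := by
    have hc : ContinuousAt (fun g : G => 𝓕.incl (𝓕.smul g f)) 1 :=
      ((hi.comp ho).continuous).continuousAt
    have hs : ∀ᶠ W in 𝓝 (𝓕.incl (𝓕.smul 1 f)), W ∈ ψ.source := by
      rw [h1f]
      exact extChartAt_source_mem_nhds W₀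
    filter_upwards [hc.eventually hs] with g hg w hw
    rw [← hmem]
    change _ ∈ (graphPoint e (ψ (𝓕.incl (𝓕.smul g f)))).1
    rw [hsrc _ hg, 𝓕.incl_smul]
    exact Submodule.mem_map_of_mem hw
  -- The derivative of the graph equation at `g = 1`. The term containing the derivative of `A` is
  -- exactly the failure of `lieRep c w` to lie in `W₀`.
  have hder : ∀ w ∈ W₀.1, L₂ (Γ.lieRep c w)
      = md 𝓘(ℝ, EG) 𝓘(ℝ, GrModel r m) A 1 c (L₁ w) + A 1 (L₁ (Γ.lieRep c w)) := by
    intro w hw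
    have hev : HasFDerivAt (fun x => (Γ.rep (γ x) : (Fin m → ℂ) →L[ℂ] (Fin m → ℂ)) w)
        (((ContinuousLinearMap.apply ℂ (Fin m → ℂ) w).restrictScalars ℝ).comp
          (md 𝓘(ℝ, EG) 𝓘(ℝ, (Fin m → ℂ) →L[ℂ] (Fin m → ℂ))
            (fun g : G => (Γ.rep g : (Fin m → ℂ) →L[ℂ] (Fin m → ℂ))) 1)) x₀ :=
      ((ContinuousLinearMap.apply ℂ (Fin m → ℂ) w).restrictScalars ℝ).hasFDerivAt.comp x₀ hR'
    have h1 := (L₂.restrictScalars ℝ).hasFDerivAt.comp x₀ hev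
    have h2 := (L₁.restrictScalars ℝ).hasFDerivAt.comp x₀ hev
    have hA'' : HasFDerivAt (fun x => (A (γ x)).restrictScalars ℝ)
        ((ContinuousLinearMap.restrictScalarsL ℂ (Fin r → ℂ) (Fin (m - r) → ℂ) ℝ ℝ).comp
          (md 𝓘(ℝ, EG) 𝓘(ℝ, GrModel r m) A 1)) x₀ :=
      (ContinuousLinearMap.restrictScalarsL ℂ (Fin r → ℂ) (Fin (m - r) → ℂ) ℝ ℝ).hasFDerivAt.comp
        x₀ hA'
    have h3 := hA''.clm_apply h2
    have h4 : Filter.Tendsto γ (𝓝 x₀) (𝓝 1) := by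
      have := (contMDiffAt_chart_symm (I := 𝓘(ℝ, EG)) (1 : G)
        (mem_extChartAt_target (1 : G))).continuousAt
      rwa [ContinuousAt, extChartAt_to_inv] at this
    have h5 := h1.congr_of_eventuallyEq (f₁ := fun x => A (γ x)
        (L₁ ((Γ.rep (γ x) : (Fin m → ℂ) →L[ℂ] (Fin m → ℂ)) w))) (by
      filter_upwards [h4.eventually hgr] with x hx
      exact (hx w hw).symm)
    have h6 := congrArg (fun L : EG →L[ℝ] (Fin (m - r) → ℂ) => L c) (h5.unique h3)
    simp only [Function.comp_apply, hγ0, map_one] at h6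
    refine h6.trans ?_
    rw [add_comm]
    rfl
  constructor
  · intro h0 w hw
    rw [← hA0, hmem, hder w hw, h0]
    simp
  · intro h0
    -- Every `k` is `L₁ w` for the vector `w` of `W₀` lying over it in the graph, so the derivative
    -- of `A` is tested on all of `ℂ^r`.
    ext1 k
    have hw : graphMap e (A 1) k ∈ W₀.1 := by
      rw [← hA0]
      exact ⟨k, rfl⟩
    have h1 := hder _ hw
    have h2 := h0 _ hw
    rw [← hA0, hmem] at h2
    rw [h2] at h1
    replace h1 := add_eq_right.1 h1.symm
    have h3 : L₁ (graphMap e (A 1) k) = k := by simp [hL₁, graphMap]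
    rw [h3] at h1
    exact h1

end Curvature

/-! ### Smoothness of vector fields in charts, and extension by cutoff. -/

section VectorFields

variable {E H N : Type*} [NormedAddCommGroup E] [NormedSpace ℝ E] [CompleteSpace E]
  [TopologicalSpace H] [TopologicalSpace N] [ChartedSpace H N] {I : ModelWithCorners ℝ E H}
  [I.Boundaryless] [IsManifold I ∞ N] (q₀ : N)

/-- On the source of the chart, `X` is the pullback of `hat I q₀ X`; smoothness passes through
pullback by the chart, whose differential is invertible. -/
theorem contMDiffAt_of_contDiffAt_hat {X : ∀ q : N, TangentSpace I q} {q : N}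
    (hq : q ∈ (extChartAt I q₀).source) (hX : ContDiffAt ℝ ∞ (hat I q₀ X) (extChartAt I q₀ q)) :
    ContMDiffAt I I.tangent ∞ (fun q => (⟨q, X q⟩ : TangentBundle I N)) q := by
  have h := ContMDiffAt.mpullback_vectorField_preimage (I := I) (I' := 𝓘(ℝ, E)) (n := ∞)
    (m := ∞) (f := extChartAt I q₀) (x₀ := q) (contMDiffAt_vectorSpace_iff_contDiffAt.2 hX)
    (contMDiffAt_chart q₀ hq) (isInvertible_mfderiv_extChartAt hq) le_rfl
  refine h.congr_of_eventuallyEq ?_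
  filter_upwards [(isOpen_extChartAt_source (I := I) q₀).mem_nhds hq] with q hq
  have h1 := isInvertible_mfderiv_extChartAt (I := I) hq
  have : X q = VectorField.mpullback I 𝓘(ℝ, E) (extChartAt I q₀) (hat I q₀ X) q := by
    apply h1.injective
    refine Eq.trans ?_ (ContinuousLinearMap.IsInvertible.self_apply_inverse h1 _).symm
    change _ = hat I q₀ X (extChartAt I q₀ q)
    unfold hat
    rw [(extChartAt I q₀).left_inv hq]
    rfl
  simp only [this]

theorem contDiffAt_hat_of_mem {X : ∀ q : N, TangentSpace I q} {y : E}
    (hy : y ∈ (extChartAt I q₀).target)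
    (hX : ContMDiffAt I I.tangent ∞ (fun q => (⟨q, X q⟩ : TangentBundle I N))
      ((extChartAt I q₀).symm y)) :
    ContDiffAt ℝ ∞ (hat I q₀ X) y := by
  have hinv : ∀ y ∈ (extChartAt I q₀).target,
      (mfderiv 𝓘(ℝ, E) I (extChartAt I q₀).symm y).IsInvertible := by
    intro y hy
    have h := isInvertible_mfderivWithin_extChartAt_symm (I := I) hy
    rwa [I.range_eq_univ, mfderivWithin_univ] at h
  have h := ContMDiffAt.mpullback_vectorField_preimage (I := 𝓘(ℝ, E)) (I' := I) (n := ∞)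
    (m := ∞) (f := (extChartAt I q₀).symm) (x₀ := y) hX (contMDiffAt_chart_symm q₀ hy)
    (hinv y hy) le_rfl
  refine (contMDiffAt_vectorSpace_iff_contDiffAt.1 h).congr_of_eventuallyEq ?_
  filter_upwards [(isOpen_extChartAt_target (I := I) q₀).mem_nhds hy] with y hy
  apply (hinv y hy).injective
  refine Eq.trans ?_ (ContinuousLinearMap.IsInvertible.self_apply_inverse (hinv y hy) _).symm
  exact md_hat q₀ X hy

/-- A smooth section of a complex distribution over a neighbourhood of a point extends to a global
smooth section, after shrinking the neighbourhood. -/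
theorem exists_isSmoothSection [FiniteDimensional ℝ E] [T2Space N]
    {p : ∀ x : N, Submodule ℂ (CTangent I x)} {x₀ : N} {U : Set N} (hU : U ∈ 𝓝 x₀)
    {A₁ A₂ : ∀ x : N, TangentSpace I x}
    (h₁ : ContMDiffOn I I.tangent ∞ (fun x => (⟨x, A₁ x⟩ : TangentBundle I N)) U)
    (h₂ : ContMDiffOn I I.tangent ∞ (fun x => (⟨x, A₂ x⟩ : TangentBundle I N)) U)
    (hp : ∀ x ∈ U, toC (A₁ x) (A₂ x) ∈ p x) :
    ∃ X : ∀ x : N, CTangent I x, IsSmoothSection I X ∧ (∀ x, X x ∈ p x) ∧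
      ∀ᶠ x in 𝓝 x₀, X x = toC (A₁ x) (A₂ x) := by
  -- A bump function with closed support in the interior of `U`; multiplying by it makes the local
  -- section globally smooth.
  obtain ⟨f, -, hf⟩ := (SmoothBumpFunction.nhds_basis_tsupport (I := I) x₀).mem_iff.1
    (interior_mem_nhds.2 hU)
  have hsm : ∀ {A : ∀ x : N, TangentSpace I x},
      ContMDiffOn I I.tangent ∞ (fun x => (⟨x, A x⟩ : TangentBundle I N)) U →
      ContMDiff I I.tangent ∞ (fun x => (⟨x, f x • A x⟩ : TangentBundle I N)) := fun h =>
    ContMDiffOn.smul_section_of_tsupport (V := fun x : N => TangentSpace I x)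
      f.contMDiff.contMDiffOn isOpen_interior hf (h.mono interior_subset)
  refine ⟨fun x => toC (f x • A₁ x) (f x • A₂ x), ⟨?_, ?_⟩, ?_, ?_⟩
  · simp only [rePart_toC]
    exact hsm h₁
  · simp only [imPart_toC]
    exact hsm h₂
  · intro x
    beta_reduce
    -- Inside `U` the cutoff is a scalar multiple of a vector of `p x`. Outside `U`, where `A₁` and
    -- `A₂` are arbitrary, it is zero.
    by_cases hx : x ∈ U
    · have h3 : toC (f x • A₁ x) (f x • A₂ x) = (f x : ℂ) • toC (A₁ x) (A₂ x) := by
        rw [smul_toC]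
        simp
      rw [h3]
      exact Submodule.smul_mem _ _ (hp x hx)
    · have h3 : f x = 0 := by
        by_contra h4
        exact hx (interior_subset (hf (subset_tsupport _ h4)))
      have h4 : toC (f x • A₁ x) (f x • A₂ x) = 0 := by simp [h3, toC]
      rw [h4]
      exact Submodule.zero_mem _
  · filter_upwards [f.eventuallyEq_one] with x hx
    rw [hx]
    simp

end VectorFields

/-! ### The base component of a bracket on a product. -/

section Bracket

variable {E E' : Type*} [NormedAddCommGroup E] [NormedSpace ℝ E]
  [NormedAddCommGroup E'] [NormedSpace ℝ E']

/-- The first component of the Lie bracket of vector fields on a product. -/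
theorem lieBracket_fst {X Y : E × E' → E × E'} {x : E} {z : E'}
    (hX : DifferentiableAt ℝ X (x, z)) (hY : DifferentiableAt ℝ Y (x, z)) :
    (VectorField.lieBracket ℝ X Y (x, z)).1
      = VectorField.lieBracket ℝ (fun x => (X (x, z)).1) (fun x => (Y (x, z)).1) x
        + (fderiv ℝ (fun z => (Y (x, z)).1) z (X (x, z)).2
          - fderiv ℝ (fun z => (X (x, z)).1) z (Y (x, z)).2) := by
  have key : ∀ {Z : E × E' → E × E'}, DifferentiableAt ℝ Z (x, z) → ∀ (a : E) (b : E'),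
      (fderiv ℝ Z (x, z) (a, b)).1
        = fderiv ℝ (fun x => (Z (x, z)).1) x a + fderiv ℝ (fun z => (Z (x, z)).1) z b := by
    intro Z hZ a b
    have h0 : HasFDerivAt (fun w => (Z w).1)
        ((ContinuousLinearMap.fst ℝ E E').comp (fderiv ℝ Z (x, z))) (x, z) :=
      (ContinuousLinearMap.fst ℝ E E').hasFDerivAt.comp (x, z) hZ.hasFDerivAt
    have h1 := HasFDerivAt.comp (g := fun w => (Z w).1) (f := fun x => (x, z)) x h0
      (hasFDerivAt_prodMk_left x z)
    have h2 := HasFDerivAt.comp (g := fun w => (Z w).1) (f := fun z => (x, z)) z h0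
      (hasFDerivAt_prodMk_right x z)
    have h3 : fderiv ℝ (fun x => (Z (x, z)).1) x = _ := h1.fderiv
    have h4 : fderiv ℝ (fun z => (Z (x, z)).1) z = _ := h2.fderiv
    rw [h3, h4]
    simp [← Prod.fst_add, ← map_add]
  simp only [VectorField.lieBracket_eq, Prod.fst_sub]
  rw [key hY _ _, key hX _ _]
  abel

end Bracket

/-! ### Exterior derivative of the vertical part on complex vectors. -/

section VerticalPart

variable {EM : Type*} [NormedAddCommGroup EM] [NormedSpace ℝ EM]
  {M : Type*} [TopologicalSpace M] [ChartedSpace EM M] [IsManifold 𝓘(ℝ, EM) ∞ M]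
  {EG : Type*} [NormedAddCommGroup EG] [NormedSpace ℂ EG]
  {G : Type*} [Group G] [TopologicalSpace G] [ChartedSpace EG G] [LieGroup 𝓘(ℂ, EG) ω G]
  {EP : Type*} [NormedAddCommGroup EP] [NormedSpace ℝ EP]
  {P : Type*} [TopologicalSpace P] [ChartedSpace EP P] [IsManifold 𝓘(ℝ, EP) ∞ P]
  {EF : Type*} [NormedAddCommGroup EF] [NormedSpace ℂ EF]
  {F : Type*} [TopologicalSpace F] [ChartedSpace EF F] [IsManifold 𝓘(ℂ, EF) ω F]
  {m r : ℕ} {Γ : ComplexLieSubgroup m EG G}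

variable {B : PrincipalBundle EM M EG G EP P} {𝓕 : HomogeneousSubmanifold Γ r EF F}

theorem ComplexLieSubgroup.lieRep_smul (Γ : ComplexLieSubgroup m EG G) (k : ℂ) (c : EG) :
    Γ.lieRep (k • c : EG) = k • Γ.lieRep c :=
  md_smul_complex (((Units.contMDiff_val (n := ω)).comp Γ.contMDiff_rep) (1 : G)
    |>.mdifferentiableAt (by simp)) k c

theorem ComplexLieSubgroup.lieRep_add (Γ : ComplexLieSubgroup m EG G) (c c' : EG) :
    Γ.lieRep (c + c' : EG) = Γ.lieRep c + Γ.lieRep c' :=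
  map_add (md 𝓘(ℝ, EG) 𝓘(ℝ, (Fin m → ℂ) →L[ℂ] (Fin m → ℂ))
    (fun g : G => (Γ.rep g : (Fin m → ℂ) →L[ℂ] (Fin m → ℂ))) 1) c c'

theorem ComplexLieSubgroup.lieRep_sub (Γ : ComplexLieSubgroup m EG G) (c c' : EG) :
    Γ.lieRep (c - c' : EG) = Γ.lieRep c - Γ.lieRep c' :=
  map_sub (md 𝓘(ℝ, EG) 𝓘(ℝ, (Fin m → ℂ) →L[ℂ] (Fin m → ℂ))
    (fun g : G => (Γ.rep g : (Fin m → ℂ) →L[ℂ] (Fin m → ℂ))) 1) c c'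

/-- The exterior derivative of the connection form, on the model spaces. -/
def Connection.dm (C : Connection B) (u : P) (V W : EP) : EG := C.dForm u V W

/-- The curvature form on complex horizontal vectors, with values in the Lie algebra. -/
def Connection.lieCurvature (C : Connection B) (u : P) (V W : CTangent 𝓘(ℝ, EP) u) : EG :=
  (C.dm u (reT V) (reT W) - C.dm u (imT V) (imT W))
    + Complex.I • (C.dm u (reT V) (imT W) + C.dm u (imT V) (reT W))

/-- As `lieRep` is complex linear, the complex bilinear extension of the curvature can be formed in
the Lie algebra, where `gauge` acts on it. -/
theorem Connection.curvature_eq (C : Connection B) (u : P) (V W : CTangent 𝓘(ℝ, EP) u) :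
    C.curvature Γ u V W = Γ.lieRep (C.lieCurvature u V W) := by
  rw [lieCurvature, Γ.lieRep_add, Γ.lieRep_sub, Γ.lieRep_smul, Γ.lieRep_add]
  rfl

namespace Assoc

variable (q₀ : Assoc B 𝓕)

theorem gauge_lieCurvature_eq_zero_iff (C : Connection B) {u : P} {f : F}
    (h : mk B 𝓕 u f ∈ (extChartAt (𝓘(ℝ, EM).prod 𝓘(ℝ, EF)) q₀).source)
    (V W : CTangent 𝓘(ℝ, EP) u) :
    gauge q₀ u f (C.lieCurvature u V W) = 0 ↔
      ∀ w ∈ (𝓕.incl f).1, C.curvature Γ u V W w ∈ (𝓕.incl f).1 := by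
  rw [gauge_eq_zero_iff q₀ h, md_orbit_eq_zero_iff, C.curvature_eq]

/-- The exterior derivative of the vertical part on complex vectors which are annihilated by it is
given by the curvature form on horizontal lifts. -/
theorem extd_vform_complex [FiniteDimensional ℝ EM] [FiniteDimensional ℝ EP]
    (C : Connection B) {u : P} {f : F}
    (h : mk B 𝓕 u f ∈ (extChartAt (𝓘(ℝ, EM).prod 𝓘(ℝ, EF)) q₀).source)
    {V W : CTangent 𝓘(ℝ, EP) u} (hV : C.IsHorizontal V) (hW : C.IsHorizontal W)
    {X₁ X₂ Y₁ Y₂ : EM × EF}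
    (hX₁ : (md 𝓘(ℝ, EP) 𝓘(ℝ, EM × EF) (fun u' => kap q₀ (u', f)) u (reT V)).1 = X₁.1)
    (hX₂ : (md 𝓘(ℝ, EP) 𝓘(ℝ, EM × EF) (fun u' => kap q₀ (u', f)) u (imT V)).1 = X₂.1)
    (hY₁ : (md 𝓘(ℝ, EP) 𝓘(ℝ, EM × EF) (fun u' => kap q₀ (u', f)) u (reT W)).1 = Y₁.1)
    (hY₂ : (md 𝓘(ℝ, EP) 𝓘(ℝ, EM × EF) (fun u' => kap q₀ (u', f)) u (imT W)).1 = Y₂.1)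
    (hX : vform q₀ C (kap q₀ (u, f)) X₁ + Complex.I • vform q₀ C (kap q₀ (u, f)) X₂ = 0)
    (hY : vform q₀ C (kap q₀ (u, f)) Y₁ + Complex.I • vform q₀ C (kap q₀ (u, f)) Y₂ = 0) :
    (extd (vform q₀ C) (kap q₀ (u, f)) X₁ Y₁ - extd (vform q₀ C) (kap q₀ (u, f)) X₂ Y₂)
      + Complex.I • (extd (vform q₀ C) (kap q₀ (u, f)) X₁ Y₂
          + extd (vform q₀ C) (kap q₀ (u, f)) X₂ Y₁)
      = gauge q₀ u f (C.lieCurvature u V W) := by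
  set K := md 𝓘(ℝ, EP) 𝓘(ℝ, EM × EF) (fun u' => kap q₀ (u', f)) u with hK
  set y := kap q₀ (u, f) with hy
  have hyt := kap_mem_target q₀ h
  have hV₁ : C.fm u (reT V) = 0 := hV.1
  have hV₂ : C.fm u (imT V) = 0 := hV.2
  have hW₁ : C.fm u (reT W) = 0 := hW.1
  have hW₂ : C.fm u (imT W) = 0 := hW.2
  -- a vector is the sum of a horizontal one and of its vertical part
  have hsplit : ∀ {V : EP} {X : EM × EF}, C.fm u V = 0 → (K V).1 = X.1 →
      X = K V + (0, vform q₀ C y X) := by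
    intro V X h1 h2
    have h3 : vform q₀ C y (K V) = 0 := by
      rw [hy, hK, vform_md_kap q₀ C h, h1, map_zero]
    have h4 : X = K V + (0, X.2 - (K V).2) := Prod.ext (by simp [h2]) (by simp)
    have h5 : vform q₀ C y X = X.2 - (K V).2 := by
      rw [h4, map_add, h3, zero_add]
      simp [vform]
    rw [h5, ← h4]
  have hI : ∀ v : EF, Complex.I • Complex.I • v = -v := fun v => by
    rw [smul_smul, Complex.I_mul_I, neg_one_smul]
  -- The vanishing of the complexified form says that the vertical part of the imaginary vector is i
  -- times that of the real one, that is, the vertical part is of type (0,1).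
  have hneg : ∀ {a b : EF}, a + Complex.I • b = 0 → b = Complex.I • a := by
    intro a b hab
    have h1 := congrArg (fun v : EF => Complex.I • v) hab
    simp only [smul_add, hI, smul_zero] at h1
    rw [← sub_eq_add_neg, sub_eq_zero] at h1
    exact h1.symm
  set δ := extd (vform q₀ C) y with hδ
  have hadd : ∀ a b c, δ (a + b) c = δ a c + δ b c := by
    intro a b c
    simp only [hδ, extd, map_add, add_apply]
    abel
  have hadd' : ∀ a b c, δ a (b + c) = δ a b + δ a c := by
    intro a b c
    simp only [hδ, extd, map_add, add_apply]
    abel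
  have halt : ∀ a b, δ a b = -δ b a := by
    intro a b
    simp only [hδ, extd]
    abel
  -- Holomorphy of the infinitesimal action, through `extd_vform_vertical`.
  have hvert : ∀ (ζ : EF) w, δ (0, Complex.I • ζ) w = Complex.I • δ (0, ζ) w := by
    intro ζ w
    rw [hδ, extd_vform_vertical q₀ C hyt, extd_vform_vertical q₀ C hyt,
      fderiv_infAct_smul q₀ ((mem_target_iff q₀).1 hyt).2.2]
  have hvert' : ∀ (ζ : EF) w, δ w (0, Complex.I • ζ) = Complex.I • δ w (0, ζ) := by
    intro ζ w
    rw [halt, hvert, halt w, smul_neg]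
  have hhor : ∀ {V W : EP}, C.fm u V = 0 → C.fm u W = 0 →
      δ (K V) (K W) = gauge q₀ u f (C.dm u V W) := fun h1 h2 =>
    extd_vform_horizontal q₀ C h h1 h2
  have e1 := hsplit hV₁ hX₁
  have e2 := hsplit hV₂ hX₂
  have e3 := hsplit hW₁ hY₁
  have e4 := hsplit hW₂ hY₂
  rw [hneg hX] at e2
  rw [hneg hY] at e4
  generalize vform q₀ C y X₁ = ξ at e1 e2
  generalize vform q₀ C y Y₁ = η at e3 e4
  rw [e1, e2, e3, e4, Connection.lieCurvature]
  -- Each term with a vertical argument `ξ` has a partner with `iξ` and a further factor i, and the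
  -- two cancel. Only the values on horizontal vectors remain.
  simp only [hadd, hadd', hvert, hvert', smul_add, hI]
  rw [map_add, map_sub, map_add, gauge_smul q₀ h, gauge_smul q₀ h, ← hhor hV₁ hW₁, ← hhor hV₂ hW₂, ← hhor hV₁ hW₂,
    ← hhor hV₂ hW₁]
  module

end Assoc

end VerticalPart

/-! ### The complex bracket in the preferred chart. -/

section ComplexBracket

variable {E H N : Type*} [NormedAddCommGroup E] [NormedSpace ℝ E]
  [TopologicalSpace H] [TopologicalSpace N] [ChartedSpace H N] {I : ModelWithCorners ℝ E H}
  [I.Boundaryless] [IsManifold I ∞ N] (q₀ : N)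

theorem reT_complexBracket (X Y : ∀ q : N, CTangent I q) :
    reT (complexBracket I X Y q₀)
      = VectorField.lieBracket ℝ (hat I q₀ fun q => rePart (X q)) (hat I q₀ fun q => rePart (Y q))
          (extChartAt I q₀ q₀)
        - VectorField.lieBracket ℝ (hat I q₀ fun q => imPart (X q)) (hat I q₀ fun q => imPart (Y q))
          (extChartAt I q₀ q₀) := by
  rw [← mlieBracket_eq, ← mlieBracket_eq]
  exact reT_ofT _ _

theorem imT_complexBracket (X Y : ∀ q : N, CTangent I q) :
    imT (complexBracket I X Y q₀)
      = VectorField.lieBracket ℝ (hat I q₀ fun q => rePart (X q)) (hat I q₀ fun q => imPart (Y q))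
          (extChartAt I q₀ q₀)
        + VectorField.lieBracket ℝ (hat I q₀ fun q => imPart (X q)) (hat I q₀ fun q => rePart (Y q))
          (extChartAt I q₀ q₀) := by
  rw [← mlieBracket_eq, ← mlieBracket_eq]
  exact imT_ofT _ _

theorem hat_congr {X Y : ∀ q : N, TangentSpace I q} (h : ∀ᶠ q in 𝓝 q₀, X q = Y q) :
    hat I q₀ X =ᶠ[𝓝 (extChartAt I q₀ q₀)] hat I q₀ Y := by
  have h1 : Filter.Tendsto (extChartAt I q₀).symm (𝓝 (extChartAt I q₀ q₀)) (𝓝 q₀) := by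
    have h2 := (contMDiffAt_chart_symm (I := I) q₀ (mem_extChartAt_target q₀)).continuousAt
    rwa [ContinuousAt, extChartAt_to_inv] at h2
  filter_upwards [h1.eventually h] with y hy
  rw [hat, hat, hy]

theorem hat_self (X : ∀ q : N, TangentSpace I q) :
    hat I q₀ X (extChartAt I q₀ q₀) = X q₀ := by
  rw [hat, extChartAt_to_inv]
  exact md_chart_self q₀ _

/-- Allows a base point to be replaced by an equal one; the two tangent vectors live in formally
different spaces. -/
theorem ofT_mem_congr {p : ∀ x : N, Submodule ℂ (CTangent I x)} {x x' : N} (h : x = x') {v w : E} :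
    ofT I x v w ∈ p x ↔ ofT I x' v w ∈ p x' := by
  subst h
  rfl

theorem ofT_reT_imT {q : N} (Z : CTangent I q) : ofT I q (reT Z) (imT Z) = Z :=
  ctangent_ext (by simp) (by simp)

/-- A subspace of a finite-dimensional space is an intersection of kernels of functionals. A
functional vanishing on `S` is zero along `g` near `z`, hence on its derivative. -/
theorem fderiv_mem_submodule {E W : Type*} [NormedAddCommGroup E] [NormedSpace ℝ E]
    [NormedAddCommGroup W] [NormedSpace ℝ W] [FiniteDimensional ℝ W] (S : Submodule ℝ W)
    {g : E → W} {z : E} (hg : DifferentiableAt ℝ g z) (h : ∀ᶠ y in 𝓝 z, g y ∈ S) (ζ : E) :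
    fderiv ℝ g z ζ ∈ S := by
  by_contra hn
  obtain ⟨l, hl, hS⟩ := S.exists_le_ker_of_notMem hn
  have h1 := l.toContinuousLinearMap.hasFDerivAt.comp z hg.hasFDerivAt
  have h2 : HasFDerivAt (l.toContinuousLinearMap ∘ g) (0 : E →L[ℝ] ℝ) z := by
    refine (hasFDerivAt_const (0 : ℝ) z).congr_of_eventuallyEq ?_
    filter_upwards [h] with y hy
    exact hS hy
  exact hl (congrArg (fun L : E →L[ℝ] ℝ => L ζ) (h1.unique h2))

end ComplexBracket

/-! ### The vertical part of the bracket on the associated bundle. -/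

section BracketOnAssoc

variable {EM : Type*} [NormedAddCommGroup EM] [NormedSpace ℝ EM]
  {M : Type*} [TopologicalSpace M] [ChartedSpace EM M] [IsManifold 𝓘(ℝ, EM) ∞ M]
  {EG : Type*} [NormedAddCommGroup EG] [NormedSpace ℂ EG]
  {G : Type*} [Group G] [TopologicalSpace G] [ChartedSpace EG G] [LieGroup 𝓘(ℂ, EG) ω G]
  {EP : Type*} [NormedAddCommGroup EP] [NormedSpace ℝ EP]
  {P : Type*} [TopologicalSpace P] [ChartedSpace EP P] [IsManifold 𝓘(ℝ, EP) ∞ P]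
  {EF : Type*} [NormedAddCommGroup EF] [NormedSpace ℂ EF]
  {F : Type*} [TopologicalSpace F] [ChartedSpace EF F] [IsManifold 𝓘(ℂ, EF) ω F]
  {m r : ℕ} {Γ : ComplexLieSubgroup m EG G}

variable {B : PrincipalBundle EM M EG G EP P} {𝓕 : HomogeneousSubmanifold Γ r EF F}

namespace Assoc

variable (q₀ : Assoc B 𝓕)

theorem proj_chart_symm {y : EM × EF}
    (hy : y ∈ (extChartAt (𝓘(ℝ, EM).prod 𝓘(ℝ, EF)) q₀).target) :
    proj ((extChartAt (𝓘(ℝ, EM).prod 𝓘(ℝ, EF)) q₀).symm y)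
      = (extChartAt 𝓘(ℝ, EM) (proj q₀)).symm y.1 :=
  (sect q₀).proj_sec _ ((mem_target_iff q₀).1 hy).2.1

theorem md_proj_self (v : EM × EF) :
    md (𝓘(ℝ, EM).prod 𝓘(ℝ, EF)) 𝓘(ℝ, EM) (proj : Assoc B 𝓕 → M) q₀ v = v.1 := by
  have h := md_chart_fst q₀ (mem_extChartAt_source (I := 𝓘(ℝ, EM).prod 𝓘(ℝ, EF)) q₀) v
  rw [md_chart_self, md_chart_self] at h
  exact h.symm

/-- The first component of a vector field, in the preferred chart. -/
theorem hat_fst (X : ∀ q : Assoc B 𝓕, TangentSpace (𝓘(ℝ, EM).prod 𝓘(ℝ, EF)) q) {y : EM × EF}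
    (hy : y ∈ (extChartAt (𝓘(ℝ, EM).prod 𝓘(ℝ, EF)) q₀).target) :
    (hat (𝓘(ℝ, EM).prod 𝓘(ℝ, EF)) q₀ X y).1
      = md 𝓘(ℝ, EM) 𝓘(ℝ, EM) (extChartAt 𝓘(ℝ, EM) (proj q₀))
          ((extChartAt 𝓘(ℝ, EM) (proj q₀)).symm y.1)
          (md (𝓘(ℝ, EM).prod 𝓘(ℝ, EF)) 𝓘(ℝ, EM) (proj : Assoc B 𝓕 → M)
            ((extChartAt (𝓘(ℝ, EM).prod 𝓘(ℝ, EF)) q₀).symm y)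
            (X ((extChartAt (𝓘(ℝ, EM).prod 𝓘(ℝ, EF)) q₀).symm y))) := by
  refine (md_chart_fst q₀ ((extChartAt (𝓘(ℝ, EM).prod 𝓘(ℝ, EF)) q₀).map_target hy) _).trans ?_
  rw [proj_chart_symm q₀ hy]

/-- In the chart, being projected into `p` only concerns the base component of the field, and the
subspace it must lie in depends on `y.1` alone. -/
theorem cdiff_proj_mem_iff (p : ∀ x : M, Submodule ℂ (CTangent 𝓘(ℝ, EM) x))
    (X : ∀ q : Assoc B 𝓕, CTangent (𝓘(ℝ, EM).prod 𝓘(ℝ, EF)) q) {y : EM × EF}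
    (hy : y ∈ (extChartAt (𝓘(ℝ, EM).prod 𝓘(ℝ, EF)) q₀).target) :
    cdiff (𝓘(ℝ, EM).prod 𝓘(ℝ, EF)) 𝓘(ℝ, EM) proj
        ((extChartAt (𝓘(ℝ, EM).prod 𝓘(ℝ, EF)) q₀).symm y)
        (X ((extChartAt (𝓘(ℝ, EM).prod 𝓘(ℝ, EF)) q₀).symm y))
        ∈ p (proj ((extChartAt (𝓘(ℝ, EM).prod 𝓘(ℝ, EF)) q₀).symm y)) ↔
      ofT 𝓘(ℝ, EM) ((extChartAt 𝓘(ℝ, EM) (proj q₀)).symm y.1)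
        (md 𝓘(ℝ, EM) 𝓘(ℝ, EM) (extChartAt 𝓘(ℝ, EM) (proj q₀)).symm y.1
          (hat (𝓘(ℝ, EM).prod 𝓘(ℝ, EF)) q₀ (fun q => rePart (X q)) y).1)
        (md 𝓘(ℝ, EM) 𝓘(ℝ, EM) (extChartAt 𝓘(ℝ, EM) (proj q₀)).symm y.1
          (hat (𝓘(ℝ, EM).prod 𝓘(ℝ, EF)) q₀ (fun q => imPart (X q)) y).1)
        ∈ p ((extChartAt 𝓘(ℝ, EM) (proj q₀)).symm y.1) := by
  have hy1 := ((mem_target_iff q₀).1 hy).1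
  rw [hat_fst q₀ _ hy, hat_fst q₀ _ hy, md_symm_chart _ hy1, md_symm_chart _ hy1,
    ← ofT_mem_congr (proj_chart_symm q₀ hy)]
  generalize (extChartAt (𝓘(ℝ, EM).prod 𝓘(ℝ, EF)) q₀).symm y = q
  rw [← ofT_reT_imT (cdiff (𝓘(ℝ, EM).prod 𝓘(ℝ, EF)) 𝓘(ℝ, EM) proj q (X q)), reT_cdiff, imT_cdiff]
  rfl

theorem cvform_self (C : Connection B) (Z : CTangent (𝓘(ℝ, EM).prod 𝓘(ℝ, EF)) q₀) :
    cvform q₀ C Z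
      = vform q₀ C (extChartAt (𝓘(ℝ, EM).prod 𝓘(ℝ, EF)) q₀ q₀) (reT Z)
        + Complex.I • vform q₀ C (extChartAt (𝓘(ℝ, EM).prod 𝓘(ℝ, EF)) q₀ q₀) (imT Z) := by
  rw [cvform, md_chart_self, md_chart_self]

/-- The vertical part of the bracket of complex vector fields on `P ×_G F` whose vertical parts
vanish is given by the curvature form. -/
theorem cvform_complexBracket [FiniteDimensional ℝ EM] [FiniteDimensional ℝ EP] [CompleteSpace EF]
    (C : Connection B) {X Y : ∀ q : Assoc B 𝓕, CTangent (𝓘(ℝ, EM).prod 𝓘(ℝ, EF)) q}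
    (hX : IsSmoothSection (𝓘(ℝ, EM).prod 𝓘(ℝ, EF)) X)
    (hY : IsSmoothSection (𝓘(ℝ, EM).prod 𝓘(ℝ, EF)) Y) {u : P} {f : F}
    (hX0 : ∀ q ∈ (extChartAt (𝓘(ℝ, EM).prod 𝓘(ℝ, EF)) (mk B 𝓕 u f)).source,
      cvform (mk B 𝓕 u f) C (X q) = 0)
    (hY0 : ∀ q ∈ (extChartAt (𝓘(ℝ, EM).prod 𝓘(ℝ, EF)) (mk B 𝓕 u f)).source,
      cvform (mk B 𝓕 u f) C (Y q) = 0)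
    {V W : CTangent 𝓘(ℝ, EP) u} (hV : C.IsHorizontal V) (hW : C.IsHorizontal W)
    (hXV : cdiff (𝓘(ℝ, EM).prod 𝓘(ℝ, EF)) 𝓘(ℝ, EM) proj (mk B 𝓕 u f) (X (mk B 𝓕 u f))
      = cdiff 𝓘(ℝ, EP) 𝓘(ℝ, EM) B.proj u V)
    (hYW : cdiff (𝓘(ℝ, EM).prod 𝓘(ℝ, EF)) 𝓘(ℝ, EM) proj (mk B 𝓕 u f) (Y (mk B 𝓕 u f))
      = cdiff 𝓘(ℝ, EP) 𝓘(ℝ, EM) B.proj u W) :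
    cvform (mk B 𝓕 u f) C (complexBracket (𝓘(ℝ, EM).prod 𝓘(ℝ, EF)) X Y (mk B 𝓕 u f))
      = -gauge (mk B 𝓕 u f) u f (C.lieCurvature u V W) := by
  set q₀ := mk B 𝓕 u f with hq₀
  have hsrc : mk B 𝓕 u f ∈ (extChartAt (𝓘(ℝ, EM).prod 𝓘(ℝ, EF)) q₀).source :=
    mem_extChartAt_source q₀
  have hy₀ : kap q₀ (u, f) = extChartAt (𝓘(ℝ, EM).prod 𝓘(ℝ, EF)) q₀ q₀ :=
    (chart_mk q₀ ((mem_source_iff q₀).1 hsrc).1 f).symm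
  have htgt := mem_extChartAt_target (I := 𝓘(ℝ, EM).prod 𝓘(ℝ, EF)) q₀
  have hsm : ∀ {X : ∀ q : Assoc B 𝓕, TangentSpace (𝓘(ℝ, EM).prod 𝓘(ℝ, EF)) q},
      ContMDiff (𝓘(ℝ, EM).prod 𝓘(ℝ, EF)) (𝓘(ℝ, EM).prod 𝓘(ℝ, EF)).tangent ∞
        (fun q => (⟨q, X q⟩ : TangentBundle (𝓘(ℝ, EM).prod 𝓘(ℝ, EF)) (Assoc B 𝓕))) →
      DifferentiableAt ℝ (hat (𝓘(ℝ, EM).prod 𝓘(ℝ, EF)) q₀ X)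
        (extChartAt (𝓘(ℝ, EM).prod 𝓘(ℝ, EF)) q₀ q₀) := fun h =>
    (contDiffAt_hat_of_mem q₀ htgt (h _)).differentiableAt infinity_ne_zero
  have hev : ∀ {X : ∀ q : Assoc B 𝓕, CTangent (𝓘(ℝ, EM).prod 𝓘(ℝ, EF)) q},
      (∀ q ∈ (extChartAt (𝓘(ℝ, EM).prod 𝓘(ℝ, EF)) q₀).source, cvform q₀ C (X q) = 0) →
      ∀ᶠ y in 𝓝 (extChartAt (𝓘(ℝ, EM).prod 𝓘(ℝ, EF)) q₀ q₀),
        vform q₀ C y (hat (𝓘(ℝ, EM).prod 𝓘(ℝ, EF)) q₀ (fun q => rePart (X q)) y)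
          + Complex.I • vform q₀ C y
            (hat (𝓘(ℝ, EM).prod 𝓘(ℝ, EF)) q₀ (fun q => imPart (X q)) y) = 0 := by
    intro X h
    filter_upwards [(isOpen_extChartAt_target (I := 𝓘(ℝ, EM).prod 𝓘(ℝ, EF)) q₀).mem_nhds htgt]
      with y hy
    have h1 := h _ ((extChartAt (𝓘(ℝ, EM).prod 𝓘(ℝ, EF)) q₀).map_target hy)
    rw [cvform, (extChartAt (𝓘(ℝ, EM).prod 𝓘(ℝ, EF)) q₀).right_inv hy] at h1
    exact h1
  have hfst : ∀ V : EP, (md 𝓘(ℝ, EP) 𝓘(ℝ, EM × EF) (fun u' => kap q₀ (u', f)) u V).1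
      = md 𝓘(ℝ, EP) 𝓘(ℝ, EM) B.proj u V := by
    intro V
    rw [← md_chart_md_mk q₀ hsrc, md_chart_fst q₀ hsrc, md_proj_md_mk, ← hq₀, md_chart_self]
  have hre : ∀ {X : ∀ q : Assoc B 𝓕, CTangent (𝓘(ℝ, EM).prod 𝓘(ℝ, EF)) q}
      {V : CTangent 𝓘(ℝ, EP) u}, cdiff (𝓘(ℝ, EM).prod 𝓘(ℝ, EF)) 𝓘(ℝ, EM) proj q₀ (X q₀)
        = cdiff 𝓘(ℝ, EP) 𝓘(ℝ, EM) B.proj u V →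
      (md 𝓘(ℝ, EP) 𝓘(ℝ, EM × EF) (fun u' => kap q₀ (u', f)) u (reT V)).1
        = (hat (𝓘(ℝ, EM).prod 𝓘(ℝ, EF)) q₀ (fun q => rePart (X q))
            (extChartAt (𝓘(ℝ, EM).prod 𝓘(ℝ, EF)) q₀ q₀)).1 := by
    intro X V h
    have h1 : md (𝓘(ℝ, EM).prod 𝓘(ℝ, EF)) 𝓘(ℝ, EM) proj q₀ (reT (X q₀))
        = md 𝓘(ℝ, EP) 𝓘(ℝ, EM) B.proj u (reT V) :=
      (reT_cdiff _ _).symm.trans ((congrArg reT h).trans (reT_cdiff _ _))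
    rw [md_proj_self] at h1
    rw [hfst, hat_self]
    exact h1.symm
  have him : ∀ {X : ∀ q : Assoc B 𝓕, CTangent (𝓘(ℝ, EM).prod 𝓘(ℝ, EF)) q}
      {V : CTangent 𝓘(ℝ, EP) u}, cdiff (𝓘(ℝ, EM).prod 𝓘(ℝ, EF)) 𝓘(ℝ, EM) proj q₀ (X q₀)
        = cdiff 𝓘(ℝ, EP) 𝓘(ℝ, EM) B.proj u V →
      (md 𝓘(ℝ, EP) 𝓘(ℝ, EM × EF) (fun u' => kap q₀ (u', f)) u (imT V)).1
        = (hat (𝓘(ℝ, EM).prod 𝓘(ℝ, EF)) q₀ (fun q => imPart (X q))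
            (extChartAt (𝓘(ℝ, EM).prod 𝓘(ℝ, EF)) q₀ q₀)).1 := by
    intro X V h
    have h1 : md (𝓘(ℝ, EM).prod 𝓘(ℝ, EF)) 𝓘(ℝ, EM) proj q₀ (imT (X q₀))
        = md 𝓘(ℝ, EP) 𝓘(ℝ, EM) B.proj u (imT V) :=
      (imT_cdiff _ _).symm.trans ((congrArg imT h).trans (imT_cdiff _ _))
    rw [md_proj_self] at h1
    rw [hfst, hat_self]
    exact h1.symm
  -- The form annihilates X and Y, so its value on the bracket is minus its exterior derivative on
  -- them; `h2` identifies the latter with the curvature on the lifts V and W.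
  have h1 := form_bracket ((contDiffAt_vform q₀ C htgt).differentiableAt infinity_ne_zero)
    (hsm hX.1) (hsm hX.2) (hsm hY.1) (hsm hY.2) (hev hX0) (hev hY0)
  have h2 := extd_vform_complex q₀ C hsrc hV hW (hre hXV) (him hXV) (hre hYW) (him hYW)
    (by rw [hy₀]; exact (hev hX0).self_of_nhds) (by rw [hy₀]; exact (hev hY0).self_of_nhds)
  rw [hy₀] at h2
  rw [cvform_self, reT_complexBracket, imT_complexBracket, h1, h2]

end Assoc

end BracketOnAssoc

/-! ### The projection of the bracket lies in `p` when `p` is integrable. -/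

section HorizontalPart

variable {EM : Type*} [NormedAddCommGroup EM] [NormedSpace ℝ EM]
  {M : Type*} [TopologicalSpace M] [ChartedSpace EM M] [IsManifold 𝓘(ℝ, EM) ∞ M]
  {EG : Type*} [NormedAddCommGroup EG] [NormedSpace ℂ EG]
  {G : Type*} [Group G] [TopologicalSpace G] [ChartedSpace EG G] [LieGroup 𝓘(ℂ, EG) ω G]
  {EP : Type*} [NormedAddCommGroup EP] [NormedSpace ℝ EP]
  {P : Type*} [TopologicalSpace P] [ChartedSpace EP P] [IsManifold 𝓘(ℝ, EP) ∞ P]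
  {EF : Type*} [NormedAddCommGroup EF] [NormedSpace ℂ EF]
  {F : Type*} [TopologicalSpace F] [ChartedSpace EF F] [IsManifold 𝓘(ℂ, EF) ω F]
  {m r : ℕ} {Γ : ComplexLieSubgroup m EG G}

variable {B : PrincipalBundle EM M EG G EP P} {𝓕 : HomogeneousSubmanifold Γ r EF F}

/-- A complex subspace of `T^ℂ_x M`, as a real subspace of the space of pairs of tangent vectors. -/
def realSubspace {x : M} (S : Submodule ℂ (CTangent 𝓘(ℝ, EM) x)) : Submodule ℝ (EM × EM) where
  carrier := {v | ofT 𝓘(ℝ, EM) x v.1 v.2 ∈ S}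
  zero_mem' := by
    have h : ofT 𝓘(ℝ, EM) x (0 : EM) 0 = 0 := ctangent_ext (by simp) (by simp)
    change ofT 𝓘(ℝ, EM) x (0 : EM) 0 ∈ S
    rw [h]
    exact S.zero_mem
  add_mem' := by
    intro v w hv hw
    have h : ofT 𝓘(ℝ, EM) x (v + w).1 (v + w).2
        = ofT 𝓘(ℝ, EM) x v.1 v.2 + ofT 𝓘(ℝ, EM) x w.1 w.2 :=
      ctangent_ext (by simp [reT_add]) (by simp [imT_add])
    change ofT 𝓘(ℝ, EM) x (v + w).1 (v + w).2 ∈ S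
    rw [h]
    exact S.add_mem hv hw
  smul_mem' := by
    intro k v hv
    have h : ofT 𝓘(ℝ, EM) x (k • v).1 (k • v).2 = (k : ℂ) • ofT 𝓘(ℝ, EM) x v.1 v.2 :=
      ctangent_ext (by rw [reT_smul]; simp) (by rw [imT_smul]; simp)
    change ofT 𝓘(ℝ, EM) x (k • v).1 (k • v).2 ∈ S
    rw [h]
    exact S.smul_mem _ hv

namespace Assoc

variable (q₀ : Assoc B 𝓕)

/-- The base component of the preferred chart at `q₀` evaluated at `q₀`. -/
abbrev basePt : EM := extChartAt 𝓘(ℝ, EM) (proj q₀) (proj q₀)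

/-- The fibre component of the preferred chart at `q₀` evaluated at `q₀`. -/
abbrev fibCoord : EF := (extChartAt (𝓘(ℝ, EM).prod 𝓘(ℝ, EF)) q₀ q₀).2

theorem chart_self_eq :
    extChartAt (𝓘(ℝ, EM).prod 𝓘(ℝ, EF)) q₀ q₀ = (basePt q₀, fibCoord q₀) := rfl

theorem mk_mem_target : (basePt q₀, fibCoord q₀) ∈
    (extChartAt (𝓘(ℝ, EM).prod 𝓘(ℝ, EF)) q₀).target :=
  mem_extChartAt_target (I := 𝓘(ℝ, EM).prod 𝓘(ℝ, EF)) q₀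

variable {p : ∀ x : M, Submodule ℂ (CTangent 𝓘(ℝ, EM) x)}
  {X : ∀ q : Assoc B 𝓕, CTangent (𝓘(ℝ, EM).prod 𝓘(ℝ, EF)) q}

/-- The horizontal part of a section of the distribution over a slice `z = const` in the preferred
chart extends to a section of `p`. -/
theorem exists_section_of_slice [FiniteDimensional ℝ EM] [CompleteSpace EF] [T2Space M]
    (hX : IsSmoothSection (𝓘(ℝ, EM).prod 𝓘(ℝ, EF)) X)
    (hXp : ∀ q, cdiff (𝓘(ℝ, EM).prod 𝓘(ℝ, EF)) 𝓘(ℝ, EM) proj q (X q) ∈ p (proj q)) :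
    ∃ X' : ∀ x : M, CTangent 𝓘(ℝ, EM) x, IsSmoothSection 𝓘(ℝ, EM) X' ∧ (∀ x, X' x ∈ p x) ∧
      (hat 𝓘(ℝ, EM) (proj q₀) (fun x => rePart (X' x)) =ᶠ[𝓝 (basePt q₀)] fun x =>
        (hat (𝓘(ℝ, EM).prod 𝓘(ℝ, EF)) q₀ (fun q => rePart (X q)) (x, fibCoord q₀)).1) ∧
      (hat 𝓘(ℝ, EM) (proj q₀) (fun x => imPart (X' x)) =ᶠ[𝓝 (basePt q₀)] fun x =>
        (hat (𝓘(ℝ, EM).prod 𝓘(ℝ, EF)) q₀ (fun q => imPart (X q)) (x, fibCoord q₀)).1) := by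
  set e := extChartAt 𝓘(ℝ, EM) (proj q₀) with he
  set z₀ := fibCoord q₀ with hz₀
  set T := (extChartAt (𝓘(ℝ, EM).prod 𝓘(ℝ, EF)) q₀).target with hT
  have hTo : IsOpen T := isOpen_extChartAt_target (I := 𝓘(ℝ, EM).prod 𝓘(ℝ, EF)) q₀
  -- the slice of a vector field, as a vector field on `M`
  let A : (∀ q : Assoc B 𝓕, TangentSpace (𝓘(ℝ, EM).prod 𝓘(ℝ, EF)) q) →
      ∀ x : M, TangentSpace 𝓘(ℝ, EM) x := fun Z x =>
    md 𝓘(ℝ, EM) 𝓘(ℝ, EM) e.symm (e x) (hat (𝓘(ℝ, EM).prod 𝓘(ℝ, EF)) q₀ Z (e x, z₀)).1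
  have hA : ∀ Z, ∀ x ∈ e.target, hat 𝓘(ℝ, EM) (proj q₀) (A Z) x
      = (hat (𝓘(ℝ, EM).prod 𝓘(ℝ, EF)) q₀ Z (x, z₀)).1 := by
    intro Z x hx
    refine hat_eq (I := 𝓘(ℝ, EM)) (proj q₀) hx ?_
    change md 𝓘(ℝ, EM) 𝓘(ℝ, EM) e.symm (e (e.symm x)) _ = _
    rw [e.right_inv hx]
  set U : Set M := {x | x ∈ e.source ∧ (e x, z₀) ∈ T} with hU
  have hUn : U ∈ 𝓝 (proj q₀) := by
    refine Filter.inter_mem (extChartAt_source_mem_nhds (I := 𝓘(ℝ, EM)) (proj q₀)) ?_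
    have h1 : ContinuousAt (fun x => (e x, z₀)) (proj q₀) :=
      (contMDiffAt_chart (I := 𝓘(ℝ, EM)) (proj q₀)
        (mem_extChartAt_source (I := 𝓘(ℝ, EM)) (proj q₀))).continuousAt.prodMk continuousAt_const
    exact h1.preimage_mem_nhds (hTo.mem_nhds (mk_mem_target q₀))
  have hAs : ∀ {Z : ∀ q : Assoc B 𝓕, TangentSpace (𝓘(ℝ, EM).prod 𝓘(ℝ, EF)) q},
      ContMDiff (𝓘(ℝ, EM).prod 𝓘(ℝ, EF)) (𝓘(ℝ, EM).prod 𝓘(ℝ, EF)).tangent ∞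
        (fun q => (⟨q, Z q⟩ : TangentBundle (𝓘(ℝ, EM).prod 𝓘(ℝ, EF)) (Assoc B 𝓕))) →
      ContMDiffOn 𝓘(ℝ, EM) 𝓘(ℝ, EM).tangent ∞
        (fun x => (⟨x, A Z x⟩ : TangentBundle 𝓘(ℝ, EM) M)) U := by
    intro Z hZ x hx
    refine (contMDiffAt_of_contDiffAt_hat (I := 𝓘(ℝ, EM)) (proj q₀) hx.1 ?_).contMDiffWithinAt
    have h1 : ContDiffAt ℝ ∞
        (fun x => (hat (𝓘(ℝ, EM).prod 𝓘(ℝ, EF)) q₀ Z (x, z₀)).1) (e x) :=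
      contDiffAt_fst.comp (e x) (ContDiffAt.comp (e x) (contDiffAt_hat_of_mem q₀ hx.2 (hZ _))
        (contDiffAt_id.prodMk contDiffAt_const))
    refine h1.congr_of_eventuallyEq ?_
    filter_upwards [(isOpen_extChartAt_target (I := 𝓘(ℝ, EM)) (proj q₀)).mem_nhds
      (e.map_source hx.1)] with x' hx'
    exact hA Z x' hx'
  obtain ⟨X', h1, h2, h3⟩ := exists_isSmoothSection (I := 𝓘(ℝ, EM)) (p := p) hUn
    (hAs hX.1) (hAs hX.2) (by
      intro x hx
      have h1 := (cdiff_proj_mem_iff q₀ p X hx.2).1 (hXp _)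
      exact (ofT_mem_congr (e.left_inv hx.1)).1 h1)
  refine ⟨X', h1, h2, ?_, ?_⟩
  · have h4 := hat_congr (I := 𝓘(ℝ, EM)) (proj q₀) (X := fun x => rePart (X' x))
      (Y := A fun q => rePart (X q)) (by
        filter_upwards [h3] with x hx
        rw [hx, rePart_toC])
    filter_upwards [h4, extChartAt_target_mem_nhds (I := 𝓘(ℝ, EM)) (proj q₀)] with x hx hx'
    rw [hx, hA _ x hx']
  · have h4 := hat_congr (I := 𝓘(ℝ, EM)) (proj q₀) (X := fun x => imPart (X' x))
      (Y := A fun q => imPart (X q)) (by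
        filter_upwards [h3] with x hx
        rw [hx, imPart_toC])
    filter_upwards [h4, extChartAt_target_mem_nhds (I := 𝓘(ℝ, EM)) (proj q₀)] with x hx hx'
    rw [hx, hA _ x hx']

theorem differentiableAt_hat [CompleteSpace EM] [CompleteSpace EF]
    {Z : ∀ q : Assoc B 𝓕, TangentSpace (𝓘(ℝ, EM).prod 𝓘(ℝ, EF)) q}
    (hZ : ContMDiff (𝓘(ℝ, EM).prod 𝓘(ℝ, EF)) (𝓘(ℝ, EM).prod 𝓘(ℝ, EF)).tangent ∞
      (fun q => (⟨q, Z q⟩ : TangentBundle (𝓘(ℝ, EM).prod 𝓘(ℝ, EF)) (Assoc B 𝓕)))) :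
    DifferentiableAt ℝ (hat (𝓘(ℝ, EM).prod 𝓘(ℝ, EF)) q₀ Z) (basePt q₀, fibCoord q₀) :=
  (contDiffAt_hat_of_mem q₀ (mk_mem_target q₀) (hZ _)).differentiableAt infinity_ne_zero

/-- The derivatives along the fibre of the horizontal part of a section of the distribution are
in `p`. -/
theorem fderiv_hat_mem [FiniteDimensional ℝ EM] [CompleteSpace EF]
    (hX : IsSmoothSection (𝓘(ℝ, EM).prod 𝓘(ℝ, EF)) X)
    (hXp : ∀ q, cdiff (𝓘(ℝ, EM).prod 𝓘(ℝ, EF)) 𝓘(ℝ, EM) proj q (X q) ∈ p (proj q)) (ζ : EF) :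
    ofT 𝓘(ℝ, EM) (proj q₀)
      (fderiv ℝ (fun z => (hat (𝓘(ℝ, EM).prod 𝓘(ℝ, EF)) q₀ (fun q => rePart (X q))
        (basePt q₀, z)).1) (fibCoord q₀) ζ)
      (fderiv ℝ (fun z => (hat (𝓘(ℝ, EM).prod 𝓘(ℝ, EF)) q₀ (fun q => imPart (X q))
        (basePt q₀, z)).1) (fibCoord q₀) ζ) ∈ p (proj q₀) := by
  have hd : ∀ {Z : ∀ q : Assoc B 𝓕, TangentSpace (𝓘(ℝ, EM).prod 𝓘(ℝ, EF)) q},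
      ContMDiff (𝓘(ℝ, EM).prod 𝓘(ℝ, EF)) (𝓘(ℝ, EM).prod 𝓘(ℝ, EF)).tangent ∞
        (fun q => (⟨q, Z q⟩ : TangentBundle (𝓘(ℝ, EM).prod 𝓘(ℝ, EF)) (Assoc B 𝓕))) →
      DifferentiableAt ℝ (fun z => (hat (𝓘(ℝ, EM).prod 𝓘(ℝ, EF)) q₀ Z (basePt q₀, z)).1)
        (fibCoord q₀) := fun hZ =>
    differentiableAt_fst.comp (fibCoord q₀) (DifferentiableAt.comp (fibCoord q₀)
      (differentiableAt_hat q₀ hZ) ((differentiableAt_const _).prodMk differentiableAt_id))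
  -- With the base point fixed and only `z` varying, the base components stay in one fixed subspace,
  -- and so do their derivatives.
  have h1 := fderiv_mem_submodule (realSubspace (p (proj q₀))) ((hd hX.1).prodMk (hd hX.2)) (by
    have h2 : ContinuousAt (fun z : EF => (basePt q₀, z)) (fibCoord q₀) :=
      continuousAt_const.prodMk continuousAt_id
    filter_upwards [h2.preimage_mem_nhds ((isOpen_extChartAt_target
      (I := 𝓘(ℝ, EM).prod 𝓘(ℝ, EF)) q₀).mem_nhds (mk_mem_target q₀))] with z hz
    have h3 := (cdiff_proj_mem_iff q₀ p X hz).1 (hXp _)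
    rw [md_symm_self, md_symm_self] at h3
    exact (ofT_mem_congr (extChartAt_to_inv (I := 𝓘(ℝ, EM)) (proj q₀))).1 h3) ζ
  rw [(hd hX.1).fderiv_prodMk (hd hX.2)] at h1
  exact h1

/-- The horizontal part of the bracket of sections of the distribution is in `p`, if `p` is
integrable. -/
theorem cdiff_proj_complexBracket_mem [FiniteDimensional ℝ EM] [CompleteSpace EF] [T2Space M]
    (hp : IsIntegrable 𝓘(ℝ, EM) p)
    {Y : ∀ q : Assoc B 𝓕, CTangent (𝓘(ℝ, EM).prod 𝓘(ℝ, EF)) q}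
    (hX : IsSmoothSection (𝓘(ℝ, EM).prod 𝓘(ℝ, EF)) X)
    (hXp : ∀ q, cdiff (𝓘(ℝ, EM).prod 𝓘(ℝ, EF)) 𝓘(ℝ, EM) proj q (X q) ∈ p (proj q))
    (hY : IsSmoothSection (𝓘(ℝ, EM).prod 𝓘(ℝ, EF)) Y)
    (hYp : ∀ q, cdiff (𝓘(ℝ, EM).prod 𝓘(ℝ, EF)) 𝓘(ℝ, EM) proj q (Y q) ∈ p (proj q)) :
    cdiff (𝓘(ℝ, EM).prod 𝓘(ℝ, EF)) 𝓘(ℝ, EM) proj q₀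
      (complexBracket (𝓘(ℝ, EM).prod 𝓘(ℝ, EF)) X Y q₀) ∈ p (proj q₀) := by
  obtain ⟨X', hX', hXp', hX₁, hX₂⟩ := exists_section_of_slice q₀ hX hXp
  obtain ⟨Y', hY', hYp', hY₁, hY₂⟩ := exists_section_of_slice q₀ hY hYp
  have h0 := hp X' Y' hX' hY' hXp' hYp' (proj q₀)
  have hDX := fderiv_hat_mem q₀ hX hXp
  have hDY := fderiv_hat_mem q₀ hY hYp
  set X₁ := hat (𝓘(ℝ, EM).prod 𝓘(ℝ, EF)) q₀ (fun q => rePart (X q)) with hX₁'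
  set X₂ := hat (𝓘(ℝ, EM).prod 𝓘(ℝ, EF)) q₀ (fun q => imPart (X q)) with hX₂'
  set Y₁ := hat (𝓘(ℝ, EM).prod 𝓘(ℝ, EF)) q₀ (fun q => rePart (Y q)) with hY₁'
  set Y₂ := hat (𝓘(ℝ, EM).prod 𝓘(ℝ, EF)) q₀ (fun q => imPart (Y q)) with hY₂'
  set y := (basePt q₀, fibCoord q₀) with hy
  have e1 := lieBracket_fst (differentiableAt_hat q₀ hX.1) (differentiableAt_hat q₀ hY.1)
  have e2 := lieBracket_fst (differentiableAt_hat q₀ hX.1) (differentiableAt_hat q₀ hY.2)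
  have e3 := lieBracket_fst (differentiableAt_hat q₀ hX.2) (differentiableAt_hat q₀ hY.1)
  have e4 := lieBracket_fst (differentiableAt_hat q₀ hX.2) (differentiableAt_hat q₀ hY.2)
  rw [← hX₁.lieBracket_vectorField_eq hY₁] at e1
  rw [← hX₁.lieBracket_vectorField_eq hY₂] at e2
  rw [← hX₂.lieBracket_vectorField_eq hY₁] at e3
  rw [← hX₂.lieBracket_vectorField_eq hY₂] at e4
  -- The complexified form of `lieBracket_fst`: the bracket of the slices, plus the derivative of Y
  -- along the fibre component of X, minus that of X along the fibre component of Y.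
  have key : cdiff (𝓘(ℝ, EM).prod 𝓘(ℝ, EF)) 𝓘(ℝ, EM) proj q₀
      (complexBracket (𝓘(ℝ, EM).prod 𝓘(ℝ, EF)) X Y q₀)
      = complexBracket 𝓘(ℝ, EM) X' Y' (proj q₀)
        + ((ofT 𝓘(ℝ, EM) (proj q₀) (fderiv ℝ (fun z => (Y₁ (basePt q₀, z)).1) (fibCoord q₀) (X₁ y).2)
              (fderiv ℝ (fun z => (Y₂ (basePt q₀, z)).1) (fibCoord q₀) (X₁ y).2)
            + Complex.I • ofT 𝓘(ℝ, EM) (proj q₀)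
              (fderiv ℝ (fun z => (Y₁ (basePt q₀, z)).1) (fibCoord q₀) (X₂ y).2)
              (fderiv ℝ (fun z => (Y₂ (basePt q₀, z)).1) (fibCoord q₀) (X₂ y).2))
          - (ofT 𝓘(ℝ, EM) (proj q₀) (fderiv ℝ (fun z => (X₁ (basePt q₀, z)).1) (fibCoord q₀) (Y₁ y).2)
              (fderiv ℝ (fun z => (X₂ (basePt q₀, z)).1) (fibCoord q₀) (Y₁ y).2)
            + Complex.I • ofT 𝓘(ℝ, EM) (proj q₀)
              (fderiv ℝ (fun z => (X₁ (basePt q₀, z)).1) (fibCoord q₀) (Y₂ y).2)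
              (fderiv ℝ (fun z => (X₂ (basePt q₀, z)).1) (fibCoord q₀) (Y₂ y).2))) := by
    apply ctangent_ext
    · rw [reT_cdiff, md_proj_self, reT_complexBracket, chart_self_eq, Prod.fst_sub, e1, e4]
      simp only [reT_add, reT_sub, reT_smul, reT_ofT, imT_ofT, reT_complexBracket, Complex.I_re,
        Complex.I_im]
      module
    · rw [imT_cdiff, md_proj_self, imT_complexBracket, chart_self_eq, Prod.fst_add, e2, e3]
      simp only [imT_add, imT_sub, imT_smul, reT_ofT, imT_ofT, imT_complexBracket, Complex.I_re,
        Complex.I_im]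
      module
  rw [key]
  exact add_mem h0 (sub_mem (add_mem (hDY _) (Submodule.smul_mem _ _ (hDY _)))
    (add_mem (hDX _) (Submodule.smul_mem _ _ (hDX _))))

end Assoc

end HorizontalPart

/-! ### Horizontal lifts of vector fields to the associated bundle. -/

section Lift

variable {EM : Type*} [NormedAddCommGroup EM] [NormedSpace ℝ EM]
  {M : Type*} [TopologicalSpace M] [ChartedSpace EM M] [IsManifold 𝓘(ℝ, EM) ∞ M]
  {EG : Type*} [NormedAddCommGroup EG] [NormedSpace ℂ EG]
  {G : Type*} [Group G] [TopologicalSpace G] [ChartedSpace EG G] [LieGroup 𝓘(ℂ, EG) ω G]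
  {EP : Type*} [NormedAddCommGroup EP] [NormedSpace ℝ EP]
  {P : Type*} [TopologicalSpace P] [ChartedSpace EP P] [IsManifold 𝓘(ℝ, EP) ∞ P]
  {EF : Type*} [NormedAddCommGroup EF] [NormedSpace ℂ EF]
  {F : Type*} [TopologicalSpace F] [ChartedSpace EF F] [IsManifold 𝓘(ℂ, EF) ω F]
  {m r : ℕ} {Γ : ComplexLieSubgroup m EG G}

variable {B : PrincipalBundle EM M EG G EP P} {𝓕 : HomogeneousSubmanifold Γ r EF F}

namespace Assoc

/-- The horizontal lift to `P ×_G F` of a tangent vector of `M`. -/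
def lift (C : Connection B) (q : Assoc B 𝓕) (v : EM) : EM × EF :=
  md 𝓘(ℝ, EP) (𝓘(ℝ, EM).prod 𝓘(ℝ, EF)) (fun u => mk B 𝓕 u (exists_mk q).choose_spec.choose)
    (exists_mk q).choose (C.exists_horizontal (exists_mk q).choose v).choose

/-- `lift` is made from arbitrary choices of a representative and of a horizontal vector. These
properties suffice below, and `hat_lift` shows that the result does not depend on the choices. -/
theorem exists_lift_eq (C : Connection B) (q : Assoc B 𝓕) (v : EM) :
    ∃ (u : P) (f : F) (V : EP), mk B 𝓕 u f = q ∧ C.fm u V = 0 ∧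
      md 𝓘(ℝ, EP) 𝓘(ℝ, EM) B.proj u V = v ∧
      lift C q v = md 𝓘(ℝ, EP) (𝓘(ℝ, EM).prod 𝓘(ℝ, EF)) (fun u => mk B 𝓕 u f) u V :=
  ⟨_, _, _, (exists_mk q).choose_spec.choose_spec,
    (C.exists_horizontal (exists_mk q).choose v).choose_spec.1,
    (C.exists_horizontal (exists_mk q).choose v).choose_spec.2, rfl⟩

theorem md_proj_lift (C : Connection B) (q : Assoc B 𝓕) (v : EM) :
    md (𝓘(ℝ, EM).prod 𝓘(ℝ, EF)) 𝓘(ℝ, EM) (proj : Assoc B 𝓕 → M) q (lift C q v) = v := by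
  obtain ⟨u, f, V, rfl, -, h1, h2⟩ := exists_lift_eq C q v
  rw [h2, md_proj_md_mk, h1]

variable (q₀ : Assoc B 𝓕)

theorem vform_lift (C : Connection B) {q : Assoc B 𝓕}
    (hq : q ∈ (extChartAt (𝓘(ℝ, EM).prod 𝓘(ℝ, EF)) q₀).source) (v : EM) :
    vform q₀ C (extChartAt (𝓘(ℝ, EM).prod 𝓘(ℝ, EF)) q₀ q)
      (md (𝓘(ℝ, EM).prod 𝓘(ℝ, EF)) 𝓘(ℝ, EM × EF) (extChartAt (𝓘(ℝ, EM).prod 𝓘(ℝ, EF)) q₀) q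
        (lift C q v)) = 0 := by
  obtain ⟨u, f, V, rfl, h1, -, h2⟩ := exists_lift_eq C q v
  rw [h2, md_chart_md_mk q₀ hq, chart_mk q₀ ((mem_source_iff q₀).1 hq).1, vform_md_kap q₀ C hq, h1,
    map_zero]

/-- The horizontal lift of a vector field on `M`. -/
def liftField (C : Connection B) (X : ∀ x : M, TangentSpace 𝓘(ℝ, EM) x) (q : Assoc B 𝓕) :
    TangentSpace (𝓘(ℝ, EM).prod 𝓘(ℝ, EF)) q := lift C q (X (proj q))

/-- The horizontal lift of a vector field on `M`, in the preferred chart. -/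
theorem hat_lift (C : Connection B) (X : ∀ x : M, TangentSpace 𝓘(ℝ, EM) x) {y : EM × EF}
    (hy : y ∈ (extChartAt (𝓘(ℝ, EM).prod 𝓘(ℝ, EF)) q₀).target) :
    hat (𝓘(ℝ, EM).prod 𝓘(ℝ, EF)) q₀ (liftField C X) y
      = (hat 𝓘(ℝ, EM) (proj q₀) X y.1,
          -infAct q₀ y.2 (locForm q₀ C y.1 (hat 𝓘(ℝ, EM) (proj q₀) X y.1))) := by
  have h1 : (hat (𝓘(ℝ, EM).prod 𝓘(ℝ, EF)) q₀ (liftField C X) y).1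
      = hat 𝓘(ℝ, EM) (proj q₀) X y.1 := by
    refine (hat_fst q₀ _ hy).trans ((congrArg _ (md_proj_lift C _ _)).trans ?_)
    rw [proj_chart_symm q₀ hy]
    rfl
  have h2 : vform q₀ C y (hat (𝓘(ℝ, EM).prod 𝓘(ℝ, EF)) q₀ (liftField C X) y)
      = 0 := by
    have h3 := vform_lift q₀ C ((extChartAt (𝓘(ℝ, EM).prod 𝓘(ℝ, EF)) q₀).map_target hy)
      (X (proj ((extChartAt (𝓘(ℝ, EM).prod 𝓘(ℝ, EF)) q₀).symm y)))
    rw [(extChartAt (𝓘(ℝ, EM).prod 𝓘(ℝ, EF)) q₀).right_inv hy] at h3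
    exact h3
  refine Prod.ext h1 ?_
  -- `vform` is the fibre component plus the infinitesimal action of the connection on the base
  -- component, so its vanishing determines the fibre component.
  rw [← h1]
  exact eq_neg_of_add_eq_zero_left h2

/-- The choices in `lift` say nothing about smoothness; it is read off from the chart formula
`hat_lift`. -/
theorem contMDiff_lift [FiniteDimensional ℝ EM] [CompleteSpace EF] (C : Connection B)
    {X : ∀ x : M, TangentSpace 𝓘(ℝ, EM) x}
    (hX : ContMDiff 𝓘(ℝ, EM) 𝓘(ℝ, EM).tangent ∞
      (fun x => (⟨x, X x⟩ : TangentBundle 𝓘(ℝ, EM) M))) :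
    ContMDiff (𝓘(ℝ, EM).prod 𝓘(ℝ, EF)) (𝓘(ℝ, EM).prod 𝓘(ℝ, EF)).tangent ∞
      (fun q => (⟨q, liftField C X q⟩ :
        TangentBundle (𝓘(ℝ, EM).prod 𝓘(ℝ, EF)) (Assoc B 𝓕))) := by
  intro q₀
  refine contMDiffAt_of_contDiffAt_hat (I := 𝓘(ℝ, EM).prod 𝓘(ℝ, EF)) q₀
    (X := liftField C X)
    (mem_extChartAt_source (I := 𝓘(ℝ, EM).prod 𝓘(ℝ, EF)) q₀) ?_
  obtain ⟨h1, h2, h3⟩ := (mem_target_iff q₀).1 (mk_mem_target q₀)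
  have h4 : ContDiffAt ℝ ∞ (fun y : EM × EF => hat 𝓘(ℝ, EM) (proj q₀) X y.1)
      (basePt q₀, fibCoord q₀) :=
    ContDiffAt.comp (g := hat 𝓘(ℝ, EM) (proj q₀) X) (f := Prod.fst) (basePt q₀, fibCoord q₀)
      (contDiffAt_hat_of_mem (I := 𝓘(ℝ, EM)) (proj q₀) h1 (hX _)) contDiffAt_fst
  have h5 : ContDiffAt ℝ ∞ (fun y : EM × EF => infAct q₀ y.2) (basePt q₀, fibCoord q₀) :=
    (contDiffAt_infAct q₀ h3).comp (basePt q₀, fibCoord q₀) contDiffAt_snd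
  have h6 : ContDiffAt ℝ ∞ (fun y : EM × EF => locForm q₀ C y.1) (basePt q₀, fibCoord q₀) :=
    (contDiffAt_locForm q₀ C h1 h2).comp (basePt q₀, fibCoord q₀) contDiffAt_fst
  refine (h4.prodMk (h5.clm_apply (h6.clm_apply h4)).neg).congr_of_eventuallyEq ?_
  filter_upwards [(isOpen_extChartAt_target (I := 𝓘(ℝ, EM).prod 𝓘(ℝ, EF)) q₀).mem_nhds
    (mk_mem_target q₀)] with y hy
  exact hat_lift q₀ C X hy

/-- The horizontal lift of a complex vector field on `M`. -/
def clift (C : Connection B) (X : ∀ x : M, CTangent 𝓘(ℝ, EM) x) (q : Assoc B 𝓕) :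
    CTangent (𝓘(ℝ, EM).prod 𝓘(ℝ, EF)) q :=
  ofT (𝓘(ℝ, EM).prod 𝓘(ℝ, EF)) q (lift C q (reT (X (proj q)))) (lift C q (imT (X (proj q))))

theorem rePart_clift (C : Connection B) (X : ∀ x : M, CTangent 𝓘(ℝ, EM) x) :
    (fun q : Assoc B 𝓕 => rePart (clift C X q)) = liftField C fun x => rePart (X x) :=
  funext fun q => reT_ofT (I := 𝓘(ℝ, EM).prod 𝓘(ℝ, EF)) (q := q) _ _

theorem imPart_clift (C : Connection B) (X : ∀ x : M, CTangent 𝓘(ℝ, EM) x) :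
    (fun q : Assoc B 𝓕 => imPart (clift C X q)) = liftField C fun x => imPart (X x) :=
  funext fun q => imT_ofT (I := 𝓘(ℝ, EM).prod 𝓘(ℝ, EF)) (q := q) _ _

theorem isSmoothSection_clift [FiniteDimensional ℝ EM] [CompleteSpace EF] (C : Connection B)
    {X : ∀ x : M, CTangent 𝓘(ℝ, EM) x} (hX : IsSmoothSection 𝓘(ℝ, EM) X) :
    IsSmoothSection (𝓘(ℝ, EM).prod 𝓘(ℝ, EF)) (clift (𝓕 := 𝓕) C X) := by
  constructor
  · have h := contMDiff_lift (𝓕 := 𝓕) C hX.1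
    exact (funext fun q => congrArg _ (congrFun (rePart_clift C X) q) :
      (fun q : Assoc B 𝓕 => (⟨q, rePart (clift C X q)⟩ :
        TangentBundle (𝓘(ℝ, EM).prod 𝓘(ℝ, EF)) (Assoc B 𝓕))) = _) ▸ h
  · have h := contMDiff_lift (𝓕 := 𝓕) C hX.2
    exact (funext fun q => congrArg _ (congrFun (imPart_clift C X) q) :
      (fun q : Assoc B 𝓕 => (⟨q, imPart (clift C X q)⟩ :
        TangentBundle (𝓘(ℝ, EM).prod 𝓘(ℝ, EF)) (Assoc B 𝓕))) = _) ▸ h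

theorem cdiff_proj_clift (C : Connection B) (X : ∀ x : M, CTangent 𝓘(ℝ, EM) x) (q : Assoc B 𝓕) :
    cdiff (𝓘(ℝ, EM).prod 𝓘(ℝ, EF)) 𝓘(ℝ, EM) proj q (clift C X q) = X (proj q) := by
  apply ctangent_ext
  · rw [reT_cdiff, clift, reT_ofT, md_proj_lift]
  · rw [imT_cdiff, clift, imT_ofT, md_proj_lift]

theorem cvform_clift (C : Connection B) (X : ∀ x : M, CTangent 𝓘(ℝ, EM) x) {q : Assoc B 𝓕}
    (hq : q ∈ (extChartAt (𝓘(ℝ, EM).prod 𝓘(ℝ, EF)) q₀).source) :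
    cvform q₀ C (clift C X q) = 0 := by
  rw [cvform, clift, reT_ofT, imT_ofT, vform_lift q₀ C hq, vform_lift q₀ C hq, smul_zero, add_zero]

/-- The base component of a lifted field does not depend on the fibre coordinate, so the correction
terms of `lieBracket_fst` vanish. -/
theorem lieBracket_lift_fst [FiniteDimensional ℝ EM] [CompleteSpace EF] (C : Connection B)
    {X Y : ∀ x : M, TangentSpace 𝓘(ℝ, EM) x}
    (hX : ContMDiff 𝓘(ℝ, EM) 𝓘(ℝ, EM).tangent ∞
      (fun x => (⟨x, X x⟩ : TangentBundle 𝓘(ℝ, EM) M)))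
    (hY : ContMDiff 𝓘(ℝ, EM) 𝓘(ℝ, EM).tangent ∞
      (fun x => (⟨x, Y x⟩ : TangentBundle 𝓘(ℝ, EM) M))) :
    (VectorField.lieBracket ℝ
        (hat (𝓘(ℝ, EM).prod 𝓘(ℝ, EF)) q₀ (liftField C X))
        (hat (𝓘(ℝ, EM).prod 𝓘(ℝ, EF)) q₀ (liftField C Y))
        (basePt q₀, fibCoord q₀)).1
      = VectorField.lieBracket ℝ (hat 𝓘(ℝ, EM) (proj q₀) X) (hat 𝓘(ℝ, EM) (proj q₀) Y)
          (basePt q₀) := by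
  have ht := (isOpen_extChartAt_target (I := 𝓘(ℝ, EM).prod 𝓘(ℝ, EF)) q₀).mem_nhds
    (mk_mem_target q₀)
  have hx : ∀ X : ∀ x : M, TangentSpace 𝓘(ℝ, EM) x,
      (fun x => (hat (𝓘(ℝ, EM).prod 𝓘(ℝ, EF)) q₀ (liftField C X)
        (x, fibCoord q₀)).1) =ᶠ[𝓝 (basePt q₀)] hat 𝓘(ℝ, EM) (proj q₀) X := by
    intro X
    have h1 : ContinuousAt (fun x : EM => (x, fibCoord q₀)) (basePt q₀) :=
      continuousAt_id.prodMk continuousAt_const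
    filter_upwards [h1.preimage_mem_nhds ht] with x hx
    rw [hat_lift q₀ C X hx]
  have hz : ∀ X : ∀ x : M, TangentSpace 𝓘(ℝ, EM) x,
      fderiv ℝ (fun z => (hat (𝓘(ℝ, EM).prod 𝓘(ℝ, EF)) q₀ (liftField C X)
        (basePt q₀, z)).1) (fibCoord q₀) = 0 := by
    intro X
    have h1 : ContinuousAt (fun z : EF => (basePt q₀, z)) (fibCoord q₀) :=
      continuousAt_const.prodMk continuousAt_id
    have h2 : (fun z => (hat (𝓘(ℝ, EM).prod 𝓘(ℝ, EF)) q₀ (liftField C X)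
        (basePt q₀, z)).1) =ᶠ[𝓝 (fibCoord q₀)] fun _ => hat 𝓘(ℝ, EM) (proj q₀) X (basePt q₀) := by
      filter_upwards [h1.preimage_mem_nhds ht] with z hz
      rw [hat_lift q₀ C X hz]
    rw [h2.fderiv_eq]
    exact fderiv_const_apply _
  rw [lieBracket_fst (differentiableAt_hat q₀ (contMDiff_lift C hX))
    (differentiableAt_hat q₀ (contMDiff_lift C hY)), hz, hz,
    (hx X).lieBracket_vectorField_eq (hx Y)]
  simp

/-- The bracket of the horizontal lifts of complex vector fields is mapped to the bracket of the
vector fields. -/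
theorem cdiff_proj_complexBracket_clift [FiniteDimensional ℝ EM] [CompleteSpace EF]
    (C : Connection B) {X Y : ∀ x : M, CTangent 𝓘(ℝ, EM) x} (hX : IsSmoothSection 𝓘(ℝ, EM) X)
    (hY : IsSmoothSection 𝓘(ℝ, EM) Y) :
    cdiff (𝓘(ℝ, EM).prod 𝓘(ℝ, EF)) 𝓘(ℝ, EM) proj q₀
        (complexBracket (𝓘(ℝ, EM).prod 𝓘(ℝ, EF)) (clift C X) (clift C Y) q₀)
      = complexBracket 𝓘(ℝ, EM) X Y (proj q₀) := by
  apply ctangent_ext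
  · rw [reT_cdiff, md_proj_self, reT_complexBracket, reT_complexBracket, rePart_clift, rePart_clift,
      imPart_clift, imPart_clift, chart_self_eq, Prod.fst_sub, lieBracket_lift_fst q₀ C hX.1 hY.1,
      lieBracket_lift_fst q₀ C hX.2 hY.2]
  · rw [imT_cdiff, md_proj_self, imT_complexBracket, imT_complexBracket, rePart_clift, rePart_clift,
      imPart_clift, imPart_clift, chart_self_eq, Prod.fst_add, lieBracket_lift_fst q₀ C hX.1 hY.2,
      lieBracket_lift_fst q₀ C hX.2 hY.1]

end Assoc

end Lift

/-! ### Linear combinations of smooth complex sections. -/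

section SmoothSections

variable {E H N : Type*} [NormedAddCommGroup E] [NormedSpace ℝ E] [TopologicalSpace H]
  [TopologicalSpace N] [ChartedSpace H N] {I : ModelWithCorners ℝ E H} [IsManifold I ∞ N]

theorem isSmoothSection_zero : IsSmoothSection I (fun q : N => (0 : CTangent I q)) := by
  constructor
  · simp only [map_zero]
    exact Bundle.contMDiff_zeroSection ℝ (TangentSpace I : N → Type _)
  · simp only [map_zero]
    exact Bundle.contMDiff_zeroSection ℝ (TangentSpace I : N → Type _)

theorem IsSmoothSection.add {X Y : ∀ q : N, CTangent I q} (hX : IsSmoothSection I X)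
    (hY : IsSmoothSection I Y) : IsSmoothSection I (fun q => X q + Y q) := by
  constructor
  · simp only [map_add]
    exact ContMDiff.add_section (V := fun q : N => TangentSpace I q) hX.1 hY.1
  · simp only [map_add]
    exact ContMDiff.add_section (V := fun q : N => TangentSpace I q) hX.2 hY.2

theorem IsSmoothSection.const_smul {X : ∀ q : N, CTangent I q} (hX : IsSmoothSection I X) (c : ℂ) :
    IsSmoothSection I (fun q => c • X q) := by
  have hs : ∀ {A : ∀ q : N, TangentSpace I q} (k : ℝ),
      ContMDiff I I.tangent ∞ (fun q => (⟨q, A q⟩ : TangentBundle I N)) →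
      ContMDiff I I.tangent ∞ (fun q => (⟨q, k • A q⟩ : TangentBundle I N)) := fun k h =>
    ContMDiff.const_smul_section (V := fun q : N => TangentSpace I q) (a := k) h
  constructor
  · simp only [rePart_smul]
    exact ContMDiff.sub_section (V := fun q : N => TangentSpace I q) (hs _ hX.1) (hs _ hX.2)
  · simp only [imPart_smul]
    exact ContMDiff.add_section (V := fun q : N => TangentSpace I q) (hs _ hX.2) (hs _ hX.1)

theorem tangentBundle_mk_congr {x x' : N} (h : x = x') (v : E) :
    (⟨x, v⟩ : TangentBundle I N) = ⟨x', v⟩ := by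
  subst h
  rfl

end SmoothSections

/-! ### Points of the Grassmannian as graphs in the preferred chart. -/

section Grassmannian

variable {r m : ℕ}

theorem exists_graphMap_eq (W₀ : Gr r m) :
    ∃ e : Splitting r m, ∀ W, W ∈ (extChartAt 𝓘(ℝ, GrModel r m) W₀).source →
      W = graphPoint e (extChartAt 𝓘(ℝ, GrModel r m) W₀ W) :=
  ⟨(exists_mem_grChart_source W₀).choose, fun _ hW =>
    ((extChartAt 𝓘(ℝ, GrModel r m) W₀).left_inv hW).symm⟩

end Grassmannian

/-! ### Every vector of `p` extends to a smooth section of `p`. -/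

section Extension

variable {EM : Type*} [NormedAddCommGroup EM] [NormedSpace ℝ EM]
  {M : Type*} [TopologicalSpace M] [ChartedSpace EM M] [IsManifold 𝓘(ℝ, EM) ∞ M]
  {EG : Type*} [NormedAddCommGroup EG] [NormedSpace ℂ EG]
  {G : Type*} [Group G] [TopologicalSpace G] [ChartedSpace EG G] [LieGroup 𝓘(ℂ, EG) ω G]
  {EP : Type*} [NormedAddCommGroup EP] [NormedSpace ℝ EP]
  {P : Type*} [TopologicalSpace P] [ChartedSpace EP P] [IsManifold 𝓘(ℝ, EP) ∞ P]
  {EF : Type*} [NormedAddCommGroup EF] [NormedSpace ℂ EF]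
  {F : Type*} [TopologicalSpace F] [ChartedSpace EF F] [IsManifold 𝓘(ℂ, EF) ω F]
  {m r : ℕ} {Γ : ComplexLieSubgroup m EG G}

variable {B : PrincipalBundle EM M EG G EP P} {𝓕 : HomogeneousSubmanifold Γ r EF F}

variable (θ : FrameSubbundle B Γ)

/-- Smoothness of a frame is given for each fixed `w` only. Expansion in the standard basis handles
vectors `w` that vary with the point. -/
theorem FrameSubbundle.reT_frame (u : P) (w : Fin m → ℂ) :
    reT (θ.frame u w) = ∑ j, ((w j).re • reT (θ.frame u fun i => if j = i then 1 else 0)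
      - (w j).im • imT (θ.frame u fun i => if j = i then 1 else 0)) := by
  have h := LinearMap.pi_apply_eq_sum_univ (θ.frame u).toLinearMap w
  refine (congrArg rePart h).trans ?_
  rw [map_sum]
  exact Finset.sum_congr rfl fun j _ => rePart_smul _ _

theorem FrameSubbundle.imT_frame (u : P) (w : Fin m → ℂ) :
    imT (θ.frame u w) = ∑ j, ((w j).re • imT (θ.frame u fun i => if j = i then 1 else 0)
      + (w j).im • reT (θ.frame u fun i => if j = i then 1 else 0)) := by
  have h := LinearMap.pi_apply_eq_sum_univ (θ.frame u).toLinearMap w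
  refine (congrArg imPart h).trans ?_
  rw [map_sum]
  exact Finset.sum_congr rfl fun j _ => imPart_smul _ _

variable {θ}

/-- The indices of the inductive predicate are turned into equations, so that it can be unpacked at
the point `p.toFun x₀`, which is not a variable. -/
theorem InSubspace.exists_eq {x : M} {q : Assoc B 𝓕} {v : CTangent 𝓘(ℝ, EM) x}
    (h : InSubspace θ 𝓕 x q v) :
    ∃ (u : P) (f : F) (w : Fin m → ℂ), w ∈ (𝓕.incl f).1 ∧ B.proj u = x ∧ Assoc.mk B 𝓕 u f = q ∧
      ofT 𝓘(ℝ, EM) x (reT (θ.frame u w)) (imT (θ.frame u w)) = v := by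
  obtain ⟨u, f, w, hw⟩ := h
  exact ⟨u, f, w, hw, rfl, rfl, ofT_reT_imT _⟩

theorem SmoothSection.frame_mem_distribution (p : SmoothSection B 𝓕) {x : M} {u : P} {f : F}
    {w : Fin m → ℂ} (hx : B.proj u = x) (hq : Assoc.mk B 𝓕 u f = p.toFun x)
    (hw : w ∈ (𝓕.incl f).1) :
    ofT 𝓘(ℝ, EM) x (reT (θ.frame u w)) (imT (θ.frame u w)) ∈ p.distribution θ x := by
  subst hx
  refine Submodule.subset_span ?_
  have h := InSubspace.intro (θ := θ) (𝓕 := 𝓕) u f w hw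
  rw [hq] at h
  rw [ofT_reT_imT]
  exact h

/-- Each generator of the distribution given by a section of `P ×_G F` extends to a section of the
distribution. -/
theorem SmoothSection.exists_section_of_inSubspace [FiniteDimensional ℝ EM] [T2Space M]
    (p : SmoothSection B 𝓕) {x₀ : M} {v : CTangent 𝓘(ℝ, EM) x₀}
    (hv : InSubspace θ 𝓕 x₀ (p.toFun x₀) v) :
    ∃ X : ∀ x : M, CTangent 𝓘(ℝ, EM) x, IsSmoothSection 𝓘(ℝ, EM) X ∧
      (∀ x, X x ∈ p.distribution θ x) ∧ X x₀ = v := by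
  have hF : IsManifold 𝓘(ℝ, EF) ∞ F := Assoc.isManifold_fibre 𝓕
  have hGr : IsManifold 𝓘(ℝ, GrModel r m) ∞ (Gr r m) := isManifold_real inferInstance
  set q₀ := p.toFun x₀ with hq₀
  set φ := extChartAt (𝓘(ℝ, EM).prod 𝓘(ℝ, EF)) q₀ with hφ
  set σ := Assoc.sect q₀ with hσ
  set f : M → F := fun x => (extChartAt 𝓘(ℝ, EF) (Assoc.fibPt q₀)).symm (φ (p.toFun x)).2 with hf
  have hx₀ : p.toFun x₀ ∈ φ.source := mem_extChartAt_source (I := 𝓘(ℝ, EM).prod 𝓘(ℝ, EF)) q₀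
  -- the section `p` in the trivialization given by `σ`
  have hp : ∀ x, p.toFun x ∈ φ.source →
      x ∈ σ.domain ∧ Assoc.mk B 𝓕 (σ.sec x) (f x) = p.toFun x := by
    intro x hx
    have h1 := (Assoc.mem_target_iff q₀).1 (φ.map_source hx)
    have h2 : (extChartAt 𝓘(ℝ, EM) (Assoc.proj q₀)).symm (φ (p.toFun x)).1 = x := by
      have h3 := Assoc.proj_chart_symm q₀ (φ.map_source hx)
      rw [φ.left_inv hx, p.proj_toFun] at h3
      exact h3.symm
    have h4 := Assoc.chart_symm_eq q₀ (φ (p.toFun x))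
    rw [φ.left_inv hx, h2] at h4
    rw [h2] at h1
    exact ⟨h1.2.1, h4.symm⟩
  have hfd : ∀ x, p.toFun x ∈ φ.source → ContMDiffAt 𝓘(ℝ, EM) 𝓘(ℝ, EF) ∞ f x := by
    intro x hx
    have h1 : ContMDiffAt 𝓘(ℝ, EM) 𝓘(ℝ, EM × EF) ∞ (fun x => φ (p.toFun x)) x :=
      ContMDiffAt.comp (g := φ) x (contMDiffAt_chart q₀ hx) (p.contMDiff_toFun x)
    have h2 : ContMDiffAt 𝓘(ℝ, EM) 𝓘(ℝ, EF) ∞ (fun x => (φ (p.toFun x)).2) x :=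
      ContMDiffAt.comp (g := fun y : EM × EF => y.2) x contDiff_snd.contMDiff.contMDiffAt h1
    exact ContMDiffAt.comp (g := (extChartAt 𝓘(ℝ, EF) (Assoc.fibPt q₀)).symm) x
      (contMDiffAt_chart_symm (I := 𝓘(ℝ, EF)) (Assoc.fibPt q₀)
        ((Assoc.mem_target_iff q₀).1 (φ.map_source hx)).2.2) h2
  have hid : ∀ x, p.toFun x ∈ φ.source →
      ContMDiffAt 𝓘(ℝ, EM) 𝓘(ℝ, GrModel r m) ∞ (fun x => 𝓕.incl (f x)) x := fun x hx =>
    ContMDiffAt.comp (g := 𝓕.incl) x (contMDiffAt_real (𝓕.contMDiff_incl (f x))) (hfd x hx)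
  -- a section of the subspaces of `ℂ^m` given by `p`
  set W₀ := 𝓕.incl (f x₀) with hW₀
  set ψ := extChartAt 𝓘(ℝ, GrModel r m) W₀ with hψ
  obtain ⟨e, he⟩ := exists_graphMap_eq W₀
  obtain ⟨u, f', w, hw, hu, hq, rfl⟩ := hv.exists_eq
  -- The frame `u` representing the vector is exchanged for the frame `σ.sec x₀`, which extends to
  -- nearby points; the two differ by an element of G.
  obtain ⟨g, hg1, hg2⟩ : ∃ g : G, σ.sec x₀ = B.act u g ∧ f' = 𝓕.smul g (f x₀) :=
    Quotient.exact (hq.trans (hp x₀ hx₀).2.symm)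
  obtain ⟨w', hw', hgw⟩ : ∃ w' ∈ W₀.1, (Γ.rep g : (Fin m → ℂ) →L[ℂ] (Fin m → ℂ)) w' = w := by
    rw [hg2, 𝓕.incl_smul] at hw
    exact hw
  obtain ⟨k, hk⟩ : ∃ k, graphMap e (ψ W₀) k = w' := by
    rw [he W₀ (mem_extChartAt_source (I := 𝓘(ℝ, GrModel r m)) W₀)] at hw'
    exact hw'
  -- The parameter `k` is kept fixed while the subspace moves, so `c x` stays in the subspace given
  -- by `p` at `x` and starts at `w'`.
  set c : M → Fin m → ℂ := fun x => graphMap e (ψ (𝓕.incl (f x))) k with hc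
  set U : Set M := {x | p.toFun x ∈ φ.source ∧ 𝓕.incl (f x) ∈ ψ.source} with hU
  have hUn : U ∈ 𝓝 x₀ :=
    Filter.inter_mem
      ((p.contMDiff_toFun x₀).continuousAt.preimage_mem_nhds
        (extChartAt_source_mem_nhds (I := 𝓘(ℝ, EM).prod 𝓘(ℝ, EF)) q₀))
      ((hid x₀ hx₀).continuousAt.preimage_mem_nhds
        (extChartAt_source_mem_nhds (I := 𝓘(ℝ, GrModel r m)) W₀))
  have hcd : ContMDiffOn 𝓘(ℝ, EM) 𝓘(ℝ, Fin m → ℂ) ∞ c U := by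
    intro x hx
    have h1 : ContMDiffAt 𝓘(ℝ, EM) 𝓘(ℝ, GrModel r m) ∞ (fun x => ψ (𝓕.incl (f x))) x :=
      ContMDiffAt.comp (g := ψ) x (contMDiffAt_chart W₀ hx.2) (hid x hx.1)
    have h2 : ContDiff ℝ ∞ (fun A : GrModel r m => graphMap e A k) :=
      (((contDiff_graphMap e).clm_apply contDiff_const).restrict_scalars ℝ).of_le le_top
    exact (ContMDiffAt.comp (g := fun A : GrModel r m => graphMap e A k) x
      h2.contMDiff.contMDiffAt h1).contMDiffWithinAt
  have hre : ∀ j, ContMDiffOn 𝓘(ℝ, EM) 𝓘(ℝ, ℝ) ∞ (fun x => (c x j).re) U := fun j =>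
    ContMDiff.comp_contMDiffOn (g := fun w : Fin m → ℂ => (w j).re)
      (Complex.reCLM.contDiff.comp (contDiff_apply ℝ ℂ j)).contMDiff hcd
  have him : ∀ j, ContMDiffOn 𝓘(ℝ, EM) 𝓘(ℝ, ℝ) ∞ (fun x => (c x j).im) U := fun j =>
    ContMDiff.comp_contMDiffOn (g := fun w : Fin m → ℂ => (w j).im)
      (Complex.imCLM.contDiff.comp (contDiff_apply ℝ ℂ j)).contMDiff hcd
  -- the local frame of `T^ℂ M`
  let R : Fin m → ∀ x : M, TangentSpace 𝓘(ℝ, EM) x := fun j x =>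
    (reT (θ.frame (σ.sec x) fun i => if j = i then 1 else 0) : EM)
  let J : Fin m → ∀ x : M, TangentSpace 𝓘(ℝ, EM) x := fun j x =>
    (imT (θ.frame (σ.sec x) fun i => if j = i then 1 else 0) : EM)
  have hR : ∀ j, ContMDiffOn 𝓘(ℝ, EM) 𝓘(ℝ, EM).tangent ∞
      (fun x => (⟨x, R j x⟩ : TangentBundle 𝓘(ℝ, EM) M)) U := by
    intro j
    refine (((θ.contMDiff_rePart fun i => if j = i then 1 else 0).comp_contMDiffOn σ.contMDiffOn_sec).mono
      (fun x hx => (hp x hx.1).1)).congr fun x hx => ?_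
    exact tangentBundle_mk_congr (σ.proj_sec x (hp x hx.1).1).symm _
  have hJ : ∀ j, ContMDiffOn 𝓘(ℝ, EM) 𝓘(ℝ, EM).tangent ∞
      (fun x => (⟨x, J j x⟩ : TangentBundle 𝓘(ℝ, EM) M)) U := by
    intro j
    refine (((θ.contMDiff_imPart fun i => if j = i then 1 else 0).comp_contMDiffOn σ.contMDiffOn_sec).mono
      (fun x hx => (hp x hx.1).1)).congr fun x hx => ?_
    exact tangentBundle_mk_congr (σ.proj_sec x (hp x hx.1).1).symm _
  obtain ⟨X, hX, hXp, hXe⟩ := exists_isSmoothSection (I := 𝓘(ℝ, EM)) (p := p.distribution θ) hUn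
    (A₁ := fun x => ∑ j, ((c x j).re • R j x - (c x j).im • J j x))
    (A₂ := fun x => ∑ j, ((c x j).re • J j x + (c x j).im • R j x))
    (ContMDiffOn.sum_section (V := fun x : M => TangentSpace 𝓘(ℝ, EM) x) fun j _ =>
      ContMDiffOn.sub_section (V := fun x : M => TangentSpace 𝓘(ℝ, EM) x)
        (ContMDiffOn.smul_section (V := fun x : M => TangentSpace 𝓘(ℝ, EM) x) (hre j) (hR j))
        (ContMDiffOn.smul_section (V := fun x : M => TangentSpace 𝓘(ℝ, EM) x) (him j) (hJ j)))
    (ContMDiffOn.sum_section (V := fun x : M => TangentSpace 𝓘(ℝ, EM) x) fun j _ =>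
      ContMDiffOn.add_section (V := fun x : M => TangentSpace 𝓘(ℝ, EM) x)
        (ContMDiffOn.smul_section (V := fun x : M => TangentSpace 𝓘(ℝ, EM) x) (hre j) (hJ j))
        (ContMDiffOn.smul_section (V := fun x : M => TangentSpace 𝓘(ℝ, EM) x) (him j) (hR j)))
    (by
      intro x hx
      obtain ⟨h1, h2⟩ := hp x hx.1
      have h3 : c x ∈ (𝓕.incl (f x)).1 := by
        rw [he _ hx.2]
        exact ⟨k, rfl⟩
      have h4 := p.frame_mem_distribution (θ := θ) (σ.proj_sec x h1) h2 h3
      rw [θ.reT_frame, θ.imT_frame] at h4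
      exact h4)
  refine ⟨X, hX, hXp, hXe.self_of_nhds.trans ?_⟩
  have hcx : c x₀ = w' := hk
  -- Equivariance of the frames identifies the value at `x₀`, written in the frame `σ.sec x₀`, with
  -- the original vector written in the frame `u`.
  have hfr := θ.frame_act u g w'
  rw [hgw, ← hg1] at hfr
  have h1 : reT (θ.frame (σ.sec x₀) w') = reT (θ.frame u w) :=
    congrArg (fun z : Σ x : M, CTangent 𝓘(ℝ, EM) x => (reT z.2 : EM)) hfr
  have h2 : imT (θ.frame (σ.sec x₀) w') = imT (θ.frame u w) :=
    congrArg (fun z : Σ x : M, CTangent 𝓘(ℝ, EM) x => (imT z.2 : EM)) hfr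
  rw [← h1, ← h2, θ.reT_frame, θ.imT_frame, ← hcx]
  rfl

/-- Each vector in the distribution given by a section of `P ×_G F` extends to a section of the
distribution. -/
theorem SmoothSection.exists_section [FiniteDimensional ℝ EM] [T2Space M]
    (p : SmoothSection B 𝓕) {x₀ : M} {v : CTangent 𝓘(ℝ, EM) x₀} (hv : v ∈ p.distribution θ x₀) :
    ∃ X : ∀ x : M, CTangent 𝓘(ℝ, EM) x, IsSmoothSection 𝓘(ℝ, EM) X ∧
      (∀ x, X x ∈ p.distribution θ x) ∧ X x₀ = v := by
  induction hv using Submodule.span_induction with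
  | mem v hv => exact p.exists_section_of_inSubspace hv
  | zero => exact ⟨_, isSmoothSection_zero, fun x => Submodule.zero_mem _, rfl⟩
  | add v w _ _ h1 h2 =>
    obtain ⟨X, hX, hXp, rfl⟩ := h1
    obtain ⟨Y, hY, hYp, rfl⟩ := h2
    exact ⟨_, hX.add hY, fun x => Submodule.add_mem _ (hXp x) (hYp x), rfl⟩
  | smul c v _ h1 =>
    obtain ⟨X, hX, hXp, rfl⟩ := h1
    exact ⟨_, hX.const_smul c, fun x => Submodule.smul_mem _ c (hXp x), rfl⟩

end Extension

/-! ### The two implications. -/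

section Integrability

variable {EM : Type*} [NormedAddCommGroup EM] [NormedSpace ℝ EM]
  {M : Type*} [TopologicalSpace M] [ChartedSpace EM M] [IsManifold 𝓘(ℝ, EM) ∞ M]
  {EG : Type*} [NormedAddCommGroup EG] [NormedSpace ℂ EG]
  {G : Type*} [Group G] [TopologicalSpace G] [ChartedSpace EG G] [LieGroup 𝓘(ℂ, EG) ω G]
  {EP : Type*} [NormedAddCommGroup EP] [NormedSpace ℝ EP]
  {P : Type*} [TopologicalSpace P] [ChartedSpace EP P] [IsManifold 𝓘(ℝ, EP) ∞ P]
  {EF : Type*} [NormedAddCommGroup EF] [NormedSpace ℂ EF]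
  {F : Type*} [TopologicalSpace F] [ChartedSpace EF F] [IsManifold 𝓘(ℂ, EF) ω F]
  {m r : ℕ} {Γ : ComplexLieSubgroup m EG G}

variable {B : PrincipalBundle EM M EG G EP P} {𝓕 : HomogeneousSubmanifold Γ r EF F}

variable {C : Connection B} {p : ∀ x : M, Submodule ℂ (CTangent 𝓘(ℝ, EM) x)}

theorem Connection.exists_horizontal_complex (C : Connection B) (u : P)
    (v : CTangent 𝓘(ℝ, EM) (B.proj u)) :
    ∃ V : CTangent 𝓘(ℝ, EP) u, C.IsHorizontal V ∧ cdiff 𝓘(ℝ, EP) 𝓘(ℝ, EM) B.proj u V = v := by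
  obtain ⟨V₁, h1, h1'⟩ := C.exists_horizontal u (reT v)
  obtain ⟨V₂, h2, h2'⟩ := C.exists_horizontal u (imT v)
  refine ⟨ofT 𝓘(ℝ, EP) u V₁ V₂, ⟨?_, ?_⟩, ?_⟩
  · exact (congrArg (C.fm u) (reT_ofT (I := 𝓘(ℝ, EP)) (q := u) V₁ V₂)).trans h1
  · exact (congrArg (C.fm u) (imT_ofT (I := 𝓘(ℝ, EP)) (q := u) V₁ V₂)).trans h2
  · apply ctangent_ext
    · rw [reT_cdiff, reT_ofT, h1']
    · rw [imT_cdiff, imT_ofT, h2']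

/-- The bracket is tested by the two conditions of `mem_inducedDistribution_iff`: integrability of
`p` gives the projected one, and the curvature condition on horizontal lifts of the projections of X
and Y gives the vertical one. -/
theorem isIntegrable_inducedDistribution [FiniteDimensional ℝ EM] [FiniteDimensional ℝ EP]
    [CompleteSpace EF] [T2Space M] (hp : IsIntegrable 𝓘(ℝ, EM) p)
    (hC : ∀ q : Assoc B 𝓕, C.CurvaturePreserves p 𝓕 q) :
    IsIntegrable (𝓘(ℝ, EM).prod 𝓘(ℝ, EF)) (inducedDistribution C 𝓕 p) := by
  intro X Y hX hY hXD hYD q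
  obtain ⟨u, f, rfl⟩ := Assoc.exists_mk q
  set q := Assoc.mk B 𝓕 u f with hq
  have hs : ∀ q : Assoc B 𝓕, q ∈ (extChartAt (𝓘(ℝ, EM).prod 𝓘(ℝ, EF)) q).source := fun q =>
    mem_extChartAt_source (I := 𝓘(ℝ, EM).prod 𝓘(ℝ, EF)) q
  have hXp := fun q => ((Assoc.mem_inducedDistribution_iff q C p (hs q) _).1 (hXD q)).1
  have hYp := fun q => ((Assoc.mem_inducedDistribution_iff q C p (hs q) _).1 (hYD q)).1
  refine (Assoc.mem_inducedDistribution_iff q C p (hs q) _).2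
    ⟨Assoc.cdiff_proj_complexBracket_mem q hp hX hXp hY hYp, ?_⟩
  obtain ⟨V, hV, hXV⟩ := C.exists_horizontal_complex u
    (cdiff (𝓘(ℝ, EM).prod 𝓘(ℝ, EF)) 𝓘(ℝ, EM) Assoc.proj q (X q))
  obtain ⟨W, hW, hYW⟩ := C.exists_horizontal_complex u
    (cdiff (𝓘(ℝ, EM).prod 𝓘(ℝ, EF)) 𝓘(ℝ, EM) Assoc.proj q (Y q))
  rw [Assoc.cvform_complexBracket C hX hY
    (fun q' hq' => ((Assoc.mem_inducedDistribution_iff q C p hq' _).1 (hXD q')).2)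
    (fun q' hq' => ((Assoc.mem_inducedDistribution_iff q C p hq' _).1 (hYD q')).2)
    hV hW hXV.symm hYW.symm, neg_eq_zero, Assoc.gauge_lieCurvature_eq_zero_iff q C (hs q)]
  exact hC q u f rfl V W hV hW (hXV ▸ hXp q) (hYW ▸ hYp q)

theorem Assoc.clift_mem (C : Connection B) {X : ∀ x : M, CTangent 𝓘(ℝ, EM) x}
    (hX : ∀ x, X x ∈ p x) (q : Assoc B 𝓕) : clift C X q ∈ inducedDistribution C 𝓕 p q := by
  refine (mem_inducedDistribution_iff q C p
    (mem_extChartAt_source (I := 𝓘(ℝ, EM).prod 𝓘(ℝ, EF)) q) _).2 ⟨?_, cvform_clift q C X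
    (mem_extChartAt_source (I := 𝓘(ℝ, EM).prod 𝓘(ℝ, EF)) q)⟩
  rw [cdiff_proj_clift]
  exact hX _

theorem Assoc.exists_proj_eq (B : PrincipalBundle EM M EG G EP P)
    (𝓕 : HomogeneousSubmanifold Γ r EF F) (x : M) : ∃ q : Assoc B 𝓕, proj q = x := by
  obtain ⟨σ, hσ⟩ := B.locally_trivial x
  obtain ⟨f⟩ := 𝓕.nonempty
  exact ⟨mk B 𝓕 (σ.sec x) f, σ.proj_sec x hσ⟩

/-- Horizontal lifts of sections of `p` are sections of the induced distribution, and their bracket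
projects to the bracket on M. As F is nonempty, every point of M is reached. -/
theorem isIntegrable_of_inducedDistribution [FiniteDimensional ℝ EM] [CompleteSpace EF]
    (h : IsIntegrable (𝓘(ℝ, EM).prod 𝓘(ℝ, EF)) (inducedDistribution C 𝓕 p)) :
    IsIntegrable 𝓘(ℝ, EM) p := by
  intro X Y hX hY hXp hYp x
  obtain ⟨q, rfl⟩ := Assoc.exists_proj_eq B 𝓕 x
  have h1 := h _ _ (Assoc.isSmoothSection_clift C hX) (Assoc.isSmoothSection_clift C hY)
    (Assoc.clift_mem C hXp) (Assoc.clift_mem C hYp) q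
  have h2 := ((Assoc.mem_inducedDistribution_iff q C p
    (mem_extChartAt_source (I := 𝓘(ℝ, EM).prod 𝓘(ℝ, EF)) q) _).1 h1).1
  rwa [Assoc.cdiff_proj_complexBracket_clift q C hX hY] at h2

/-- The curvature condition concerns arbitrary vectors of `p`, while integrability only speaks of
sections. The hypothesis `hext` bridges this: the projections of V and W extend to sections of `p`,
and the vertical part of the bracket of their lifts is the curvature on V and W. -/
theorem curvaturePreserves_of_inducedDistribution [FiniteDimensional ℝ EM] [FiniteDimensional ℝ EP]
    [CompleteSpace EF]
    (hext : ∀ (x₀ : M) (v : CTangent 𝓘(ℝ, EM) x₀), v ∈ p x₀ → ∃ X : ∀ x : M, CTangent 𝓘(ℝ, EM) x,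
      IsSmoothSection 𝓘(ℝ, EM) X ∧ (∀ x, X x ∈ p x) ∧ X x₀ = v)
    (h : IsIntegrable (𝓘(ℝ, EM).prod 𝓘(ℝ, EF)) (inducedDistribution C 𝓕 p)) (q : Assoc B 𝓕) :
    C.CurvaturePreserves p 𝓕 q := by
  rintro u f rfl V W hV hW hVp hWp
  obtain ⟨X, hX, hXp, hXV⟩ := hext _ _ hVp
  obtain ⟨Y, hY, hYp, hYW⟩ := hext _ _ hWp
  set q := Assoc.mk B 𝓕 u f with hq
  have hs : q ∈ (extChartAt (𝓘(ℝ, EM).prod 𝓘(ℝ, EF)) q).source :=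
    mem_extChartAt_source (I := 𝓘(ℝ, EM).prod 𝓘(ℝ, EF)) q
  have h1 := h _ _ (Assoc.isSmoothSection_clift C hX) (Assoc.isSmoothSection_clift C hY)
    (Assoc.clift_mem C hXp) (Assoc.clift_mem C hYp) q
  have h2 := ((Assoc.mem_inducedDistribution_iff q C p hs _).1 h1).2
  rw [Assoc.cvform_complexBracket C (Assoc.isSmoothSection_clift C hX)
    (Assoc.isSmoothSection_clift C hY) (fun q' hq' => Assoc.cvform_clift q C X hq')
    (fun q' hq' => Assoc.cvform_clift q C Y hq') hV hW
    ((Assoc.cdiff_proj_clift C X q).trans hXV) ((Assoc.cdiff_proj_clift C Y q).trans hYW),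
    neg_eq_zero, Assoc.gauge_lieCurvature_eq_zero_iff q C hs] at h2
  exact h2

end Integrability

end Twistor

end

/-! ### The theorem. -/

open Twistor in
theorem corollary1p2
    {m₁ r₁ m₂ r₂ : ℕ} (hr₁ : 1 ≤ r₁ ∧ r₁ ≤ m₁) (hr₂ : 1 ≤ r₂ ∧ r₂ ≤ m₂)
    -- the manifold `M`, of dimension `m₁`
    {M : Type*} [TopologicalSpace M] [ChartedSpace (EuclideanSpace ℝ (Fin m₁)) M]
    [IsManifold 𝓘(ℝ, EuclideanSpace ℝ (Fin m₁)) ∞ M]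
    [T2Space M] [SecondCountableTopology M] [ConnectedSpace M]
    -- the complex Lie groups `G₁`, `G₂`
    {EG₁ : Type*} [NormedAddCommGroup EG₁] [NormedSpace ℂ EG₁] [FiniteDimensional ℂ EG₁]
    {G₁ : Type*} [Group G₁] [TopologicalSpace G₁] [ChartedSpace EG₁ G₁] [LieGroup 𝓘(ℂ, EG₁) ω G₁]
    (Γ₁ : ComplexLieSubgroup m₁ EG₁ G₁)
    {EG₂ : Type*} [NormedAddCommGroup EG₂] [NormedSpace ℂ EG₂] [FiniteDimensional ℂ EG₂]
    {G₂ : Type*} [Group G₂] [TopologicalSpace G₂] [ChartedSpace EG₂ G₂] [LieGroup 𝓘(ℂ, EG₂) ω G₂]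
    (Γ₂ : ComplexLieSubgroup m₂ EG₂ G₂)
    -- the complex submanifolds `F₁`, `F₂` of the Grassmannians
    {EF₁ : Type*} [NormedAddCommGroup EF₁] [NormedSpace ℂ EF₁] [FiniteDimensional ℂ EF₁]
    {F₁ : Type*} [TopologicalSpace F₁] [ChartedSpace EF₁ F₁] [IsManifold 𝓘(ℂ, EF₁) ω F₁]
    (𝓕₁ : HomogeneousSubmanifold Γ₁ r₁ EF₁ F₁)
    {EF₂ : Type*} [NormedAddCommGroup EF₂] [NormedSpace ℂ EF₂] [FiniteDimensional ℂ EF₂]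
    {F₂ : Type*} [TopologicalSpace F₂] [ChartedSpace EF₂ F₂] [IsManifold 𝓘(ℂ, EF₂) ω F₂]
    (𝓕₂ : HomogeneousSubmanifold Γ₂ r₂ EF₂ F₂)
    -- the principal bundles `P₁`, `P₂`; the first is a subbundle of the complex frame bundle
    {EP₁ : Type*} [NormedAddCommGroup EP₁] [NormedSpace ℝ EP₁] [FiniteDimensional ℝ EP₁]
    {P₁ : Type*} [TopologicalSpace P₁] [ChartedSpace EP₁ P₁] [IsManifold 𝓘(ℝ, EP₁) ∞ P₁]
    (B₁ : PrincipalBundle (EuclideanSpace ℝ (Fin m₁)) M EG₁ G₁ EP₁ P₁)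
    (θ₁ : FrameSubbundle B₁ Γ₁)
    {EP₂ : Type*} [NormedAddCommGroup EP₂] [NormedSpace ℝ EP₂] [FiniteDimensional ℝ EP₂]
    {P₂ : Type*} [TopologicalSpace P₂] [ChartedSpace EP₂ P₂] [IsManifold 𝓘(ℝ, EP₂) ∞ P₂]
    (B₂ : PrincipalBundle (EuclideanSpace ℝ (Fin m₁)) M EG₂ G₂ EP₂ P₂)
    -- the connection on `P₂`, and the section `p` of `Q₁ = P₁ ×_{G₁} F₁`
    (C₂ : Connection B₂) (p : SmoothSection B₁ 𝓕₁) :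
    IsIntegrable (𝓘(ℝ, EuclideanSpace ℝ (Fin m₁)).prod 𝓘(ℝ, EF₂))
        (inducedDistribution C₂ 𝓕₂ (p.distribution θ₁)) ↔
      IsIntegrable 𝓘(ℝ, EuclideanSpace ℝ (Fin m₁)) (p.distribution θ₁) ∧
        ∀ (x : M) (q : Assoc B₂ 𝓕₂), q.proj = x →
          C₂.CurvaturePreserves (p.distribution θ₁) 𝓕₂ q := by
  have : CompleteSpace EF₂ := FiniteDimensional.complete ℂ EF₂
  constructor
  · intro h
    exact ⟨isIntegrable_of_inducedDistribution h, fun x q _ =>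
      curvaturePreserves_of_inducedDistribution (fun x₀ v hv => p.exists_section hv) h q⟩
  · rintro ⟨h1, h2⟩
    exact isIntegrable_inducedDistribution h1 fun q => h2 q.proj q rfl
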